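/- Let $p$ be an odd prime and let $\varepsilon>0$ be real. There is a constant $C$, depending only on $p$ and $\varepsilon$, such that the following holds for every finite field $\mathbb F_q$ with $q\equiv 1 \pmod p$, every multiplicative character $\chi_p:\mathbb F_q\to\mathbb C$ of order $p$ (with $\chi_p(0)=0$), and all integers $d_1,\dots,d_{p-1}\ge 0$. Let $\mathcal F_{(d_1,\dots,d_{p-1})}$ be the set of polynomials of the form $F=F_1F_2^2\cdots F_{p-1}^{p-1}$ with $F_1,\dots,F_{p-1}\in\mathbb F_q[X]$ monic, square-free and pairwise coprime, $\deg F_j=d_j$. Let $x_1,\dots,x_q$ be an enumeration of the elements of $\mathbb F_q$, and let $\varepsilon_1,\dots,\varepsilon_q\in\mathbb C$ be such that exactly $m$ of them are $0$ and the others are $p$-th roots of unity. Then $$\frac{\left|\{F\in\mathcal F_{(d_1,\dots,d_{p-1})}:\chi_p(F(x_i))=\varepsilon_i,\ 1\le i\le q\}\right|}{\left|\mathcal F_{(d_1,\dots,d_{p-1})}\right|}=\left(\frac{p-1}{q+p-1}\right)^m\left(\frac{q}{p(q+p-1)}\right)^{q-m}(1+\delta)$$ for a real number $\delta$ with $$|\delta|\le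 C\left(q^{\varepsilon(d_2+\dots+d_{p-1}+q)+(1-\varepsilon)m}\left(q^{-d_2}+\dots+q^{-d_{p-1}}\right)+q^{-(d_1-m)/2+q}\right).$$ -/

import Mathlib

open Polynomial

/-- The set `𝓕_(d₁, …, d_r)` of all polynomials `F = F₁ F₂² ⋯ F_r ^ r` over `K` with
`F₁, …, F_r` monic, square-free and pairwise coprime, of degrees `d₁, …, d_r`.
Only the values `d 1, …, d r` of `d` matter. -/
def polyFamily (K : Type*) [Field K] (r : ℕ) (d : ℕ → ℕ) : Set K[X] :=
  {F | ∃ G : ℕ → K[X],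
    (∀ i ∈ Finset.Icc 1 r, (G i).Monic ∧ Squarefree (G i) ∧ (G i).natDegree = d i) ∧
    (∀ i ∈ Finset.Icc 1 r, ∀ j ∈ Finset.Icc 1 r, i ≠ j → IsCoprime (G i) (G j)) ∧
    F = ∏ i ∈ Finset.Icc 1 r, G i ^ i}

/-- Over a finite field the family is finite, so that `Set.ncard` really counts it. -/
theorem polyFamily_finite (K : Type*) [Field K] [Finite K] (r : ℕ) (d : ℕ → ℕ) :
    (polyFamily K r d).Finite := by
  have hfin : (((degreeLT K ((∑ i ∈ Finset.Icc 1 r, i * d i) + 1) : Submodule K K[X]) :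
      Set K[X])).Finite := by
    have : Finite (degreeLT K ((∑ i ∈ Finset.Icc 1 r, i * d i) + 1)) :=
      Finite.of_equiv _ (degreeLTEquiv K ((∑ i ∈ Finset.Icc 1 r, i * d i) + 1)).symm.toEquiv
    exact Set.toFinite _
  refine hfin.subset ?_
  rintro F ⟨G, hG, -, rfl⟩
  rw [SetLike.mem_coe, mem_degreeLT]
  refine lt_of_le_of_lt degree_le_natDegree ?_
  rw [natDegree_prod_of_monic _ _ (fun i hi => (hG i hi).1.pow i)]
  rw [Nat.cast_lt, Nat.lt_succ_iff]
  refine Finset.sum_le_sum fun i hi => ?_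
  rw [(hG i hi).1.natDegree_pow, (hG i hi).2.2]

/-- The size of the relative error:
`q^{ε(d₂ + ⋯ + d_{p-1} + q) + (1 - ε) m} (q^{-d₂} + ⋯ + q^{-d_{p-1}}) + q^{-(d₁ - m)/2 + q}`. -/
noncomputable def errorTerm (p q m : ℕ) (d : ℕ → ℕ) (ε : ℝ) : ℝ :=
  (q : ℝ) ^ (ε * ((∑ j ∈ Finset.Icc 2 (p - 1), (d j : ℝ)) + (q : ℝ)) + (1 - ε) * (m : ℝ)) *
      (∑ j ∈ Finset.Icc 2 (p - 1), (q : ℝ) ^ (-(d j : ℝ))) +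
    (q : ℝ) ^ (-((d 1 : ℝ) - (m : ℝ)) / 2 + (q : ℝ))

/-! Write r = p - 1 and q = |K|. A member of the family is the same thing as its tuple (F_1, …, F_r)
(`prodPow_injOn`). By coprimality at most one F_i vanishes at a given point, so each tuple has a
vanishing pattern `K → Option ι`. Dividing out the corresponding linear factors leaves a coprime
square-free tuple without roots in K, with lower degrees (`card_filter_coprimeTuples_eq_sum`). Let ν
be the number of rootless tuples of degrees d, divided by q^(Σ d). If ν hardly changes when the
degrees are lowered, a pattern with k zeros contributes about ν q^(-k), and all patterns together
contribute ν (1 + r/q)^q. Prescribing the character values leaves the r^m patterns with the right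
zero set, each of weight q^(-m). Equidistribution of χ at the other q - m points contributes
p^(-(q-m)). The quotient of the two densities is the main term; ν cancels and is never evaluated
(`exists_relative_error`).

Both inputs come from varying one F_j with the others fixed, so that F_j runs over square-free
polynomials avoiding a finite set of primes. For stability of ν: with no primes to avoid, N(n) - q
N(n-1) vanishes for n ≥ 3, and each avoided prime of degree d costs a factor (1 - y^(-d))^(-1) for
any fixed y > 1 (`bound_of_one_step`, `abs_sqfreeDiff_le`). For equidistribution: F_1 enters the
product linearly, and adding a Lagrange interpolant to it rescales its values on a set of at most
deg F_1 points at will (`equallyFrequent_char`); square-freeness is imposed by inclusion–exclusion,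
which leaves an error of square-root size (`abs_sqfreeCount_sub_le`). The Euler factors of the
avoided primes are bounded on average over the fixed F_i (`sum_eulerFactor_monicPrimeFactors_le`).
All losses together are at most A^q with A depending on p and ε, hence O(q^(εq)); the choice y = q^ε
gives the stated error.

A relative error also needs a lower bound for the total density. If q ≥ 4r², a union bound over
repeated primes suffices. If q is bounded and all degrees are large, the small primes are sieved
exactly before the union bound. If q and some degree are both bounded, the error term is bounded
below and any quotient in [0, 1] satisfies the claim. -/

open scoped Classical

/-! ### Monic polynomials, prime sets and the recursion for square-free counts -/

section MonicPolynomials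

variable {K : Type*} [Field K]

/-- A finite set of monic irreducible polynomials. -/
def IsPrimeSet (T : Finset K[X]) : Prop := ∀ P ∈ T, P.Monic ∧ Irreducible P

theorem IsPrimeSet.mono {T U : Finset K[X]} (hT : IsPrimeSet T) (h : U ⊆ T) : IsPrimeSet U :=
  fun P hP => hT P (h hP)

theorem eq_of_dvd_of_irreducible {P Q : K[X]} (hP : P.Monic) (hP' : Irreducible P)
    (hQ : Q.Monic) (hQ' : Irreducible Q) (h : P ∣ Q) : P = Q :=
  eq_of_monic_of_associated hP hQ (hP'.associated_of_dvd hQ' h)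

/-- Adding a prime of degree `d` to the set of avoided primes costs a factor `1 / (1 - y⁻ᵈ)`. -/
theorem bound_of_one_step {ι : Type*} {a b : ι → ℕ → ℝ} {σ : ι → ι} {d : ℕ} (hd : 0 < d)
    {y B : ℝ} (hy : 1 < y) (ha : ∀ i n, a i n ≤ B * y ^ n)
    (hb : ∀ i n, b i n ≤ a i n + if d ≤ n then b (σ i) (n - d) else 0) (hB : 0 ≤ B) (i : ι)
    (n : ℕ) : b i n ≤ B * (1 - (y ^ d)⁻¹)⁻¹ * y ^ n := by
  have hyd : 1 < y ^ d := one_lt_pow₀ hy hd.ne'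
  have hz : 0 < 1 - (y ^ d)⁻¹ := sub_pos.2 (inv_lt_one_of_one_lt₀ hyd)
  have hz1 : 1 ≤ (1 - (y ^ d)⁻¹)⁻¹ :=
    (one_le_inv₀ hz).2 (sub_le_self _ (by positivity))
  induction n using Nat.strong_induction_on generalizing i with
  | _ n ih =>
    refine (hb i n).trans ?_
    split_ifs with h
    · refine (add_le_add (ha i n) (ih (n - d) (by omega) (σ i))).trans (le_of_eq ?_)
      have : y ^ (n - d) = y ^ n * (y ^ d)⁻¹ := by
        rw [pow_sub₀ _ (by positivity) h]
      rw [this]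
      have := hz.ne'
      have hyd0 : y ^ d ≠ 0 := by positivity
      generalize (y ^ d)⁻¹ = w at *
      field_simp
      ring
    · rw [add_zero]
      refine (ha i n).trans ?_
      have : 0 ≤ y ^ n := by positivity
      calc B * y ^ n = B * 1 * y ^ n := by ring
        _ ≤ _ := by gcongr

/-- The Euler factor `∏_{P ∈ T} (1 - y ^ (-deg P))⁻¹`. -/
noncomputable def eulerFactor (y : ℝ) (T : Finset K[X]) : ℝ :=
  ∏ P ∈ T, (1 - (y ^ P.natDegree)⁻¹)⁻¹

theorem one_le_euler_term {y : ℝ} (hy : 1 < y) {d : ℕ} (hd : 0 < d) :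
    1 ≤ (1 - (y ^ d)⁻¹)⁻¹ := by
  have hyd : 1 < y ^ d := one_lt_pow₀ hy hd.ne'
  exact (one_le_inv₀ (sub_pos.2 (inv_lt_one_of_one_lt₀ hyd))).2
    (sub_le_self _ (by positivity))

theorem IsPrimeSet.natDegree_pos {T : Finset K[X]} (hT : IsPrimeSet T) {P : K[X]} (hP : P ∈ T) :
    0 < P.natDegree := (hT P hP).2.natDegree_pos

theorem one_le_eulerFactor {y : ℝ} (hy : 1 < y) {T : Finset K[X]} (hT : IsPrimeSet T) :
    1 ≤ eulerFactor y T := by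
  unfold eulerFactor
  induction T using Finset.induction_on with
  | empty => simp
  | insert P T hPT ih =>
    rw [Finset.prod_insert hPT]
    exact one_le_mul_of_one_le_of_one_le (one_le_euler_term hy
      (hT.natDegree_pos (Finset.mem_insert_self _ _))) (ih (hT.mono (Finset.subset_insert _ _)))

/-- Induction on the degree: if f is not square-free, split off the square of a monic irreducible.
-/
theorem exists_sq_mul_squarefree {f : K[X]} (hf : f.Monic) :
    ∃ s g : K[X], s.Monic ∧ g.Monic ∧ Squarefree g ∧ f = s ^ 2 * g := by
  induction h : f.natDegree using Nat.strong_induction_on generalizing f with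
  | _ n ih =>
    by_cases hsq : Squarefree f
    · exact ⟨1, f, monic_one, hf, hsq, by simp⟩
    · rw [squarefree_iff_irreducible_sq_not_dvd_of_ne_zero hf.ne_zero] at hsq
      push Not at hsq
      obtain ⟨P, hP, hdvd⟩ := hsq
      have hu : P.leadingCoeff ≠ 0 := leadingCoeff_ne_zero.2 hP.ne_zero
      set Q := P * C P.leadingCoeff⁻¹ with hQ
      have hQm : Q.Monic := monic_mul_leadingCoeff_inv hP.ne_zero
      have hQP : Associated P Q :=
        associated_mul_unit_right _ _ (isUnit_C.2 (isUnit_iff_ne_zero.2 (inv_ne_zero hu)))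
      have hQd : Q * Q ∣ f := (hQP.mul_mul hQP).symm.dvd.trans hdvd
      obtain ⟨g, rfl⟩ := hQd
      have hg : g.Monic := (hQm.mul hQm).of_mul_monic_left hf
      have hdeg := (hQm.mul hQm).natDegree_mul hg
      rw [hQm.natDegree_mul hQm] at hdeg
      have hpos : 0 < Q.natDegree := (hQP.irreducible hP).natDegree_pos
      obtain ⟨s, a, hs, ha, hsa, rfl⟩ := ih g.natDegree (by omega) hg rfl
      exact ⟨Q * s, a, hQm.mul hs, ha, hsa, by ring⟩

/-- After cancelling gcd(s, t), the square of the remaining part of s divides the square-free b, so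
that part is a unit and s divides t; the situation is symmetric. -/
theorem eq_of_sq_mul_squarefree {s t a b : K[X]} (hs : s.Monic) (ht : t.Monic)
    (ha : Squarefree a) (hb : Squarefree b) (h : s ^ 2 * a = t ^ 2 * b) : s = t := by
  have aux : ∀ {s t a b : K[X]}, s.Monic → t.Monic → Squarefree b → s ^ 2 * a = t ^ 2 * b →
      s ∣ t := by
    intro s t a b hs ht hb h
    obtain ⟨g, s', t', hg, hrel, rfl, rfl⟩ : ∃ g s' t', g ≠ 0 ∧ IsCoprime s' t' ∧
        s = g * s' ∧ t = g * t' := by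
      obtain ⟨s', t', hs', ht', hu⟩ := extract_gcd s t
      exact ⟨gcd s t, s', t', gcd_ne_zero_of_left hs.ne_zero,
        ((gcd_isUnit_iff_isRelPrime).1 hu).isCoprime, hs', ht'⟩
    have h2 : s' ^ 2 * a = t' ^ 2 * b := by
      have : g ^ 2 ≠ 0 := pow_ne_zero _ hg
      apply mul_left_cancel₀ this
      linear_combination h
    have h3 : s' ^ 2 ∣ b := (hrel.pow (m := 2) (n := 2)).dvd_of_dvd_mul_left
      (h2 ▸ dvd_mul_right _ _)
    rw [sq] at h3
    exact mul_dvd_mul_left _ (hb _ h3).dvd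
  exact eq_of_monic_of_associated hs ht
    (associated_of_dvd_dvd (aux hs ht hb h) (aux ht hs ha h.symm))

variable [Fintype K]

/-- The monic polynomials of degree `n` over a finite field. -/
noncomputable def monics (K : Type*) [Field K] [Fintype K] (n : ℕ) : Finset K[X] :=
  Finset.univ.image fun c : Fin n → K => X ^ n + ∑ i : Fin n, C (c i) * X ^ (i : ℕ)

theorem mem_monics {n : ℕ} {f : K[X]} : f ∈ monics K n ↔ f.Monic ∧ f.natDegree = n := by
  simp only [monics, Finset.mem_image, Finset.mem_univ, true_and]
  constructor
  · rintro ⟨c, rfl⟩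
    have hlt : (∑ i : Fin n, C (c i) * X ^ (i : ℕ)).degree < (n : WithBot ℕ) := by
      refine (degree_sum_le _ _).trans_lt ?_
      rw [Finset.sup_lt_iff (by exact WithBot.bot_lt_coe n)]
      intro i _
      exact (degree_C_mul_X_pow_le _ _).trans_lt (by exact_mod_cast i.2)
    exact ⟨monic_X_pow_add hlt, natDegree_eq_of_degree_eq_some
      (by rw [degree_add_eq_left_of_degree_lt (by rwa [degree_X_pow]), degree_X_pow])⟩
  · rintro ⟨hm, rfl⟩
    refine ⟨fun i => f.coeff i, ?_⟩
    rw [Fin.sum_univ_eq_sum_range (fun i => C (f.coeff i) * X ^ i)]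
    exact hm.as_sum.symm

theorem card_monics (n : ℕ) : (monics K n).card = Fintype.card K ^ n := by
  rw [monics, Finset.card_image_of_injective]
  · simp
  · intro c c' h
    funext i
    have := congrArg (fun f : K[X] => f.coeff i) h
    simp only [coeff_add, finsetSum_coeff, coeff_C_mul, coeff_X_pow, add_right_inj] at this
    simpa [Fin.val_inj, eq_comm] using this

theorem mul_mem_monics {a b : ℕ} {f g : K[X]} (hf : f ∈ monics K a) (hg : g ∈ monics K b) :
    f * g ∈ monics K (a + b) := by
  rw [mem_monics] at *
  exact ⟨hf.1.mul hg.1, by rw [hf.1.natDegree_mul hg.1, hf.2, hg.2]⟩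

/-- Multiplication by P is the bijection. The property is carried along as `A (P * f)` so that
recursions over primes can keep track of character conditions. -/
theorem card_filter_dvd {P : K[X]} (hP : P.Monic) (n : ℕ) (A : K[X] → Prop) :
    ((monics K n).filter fun f => P ∣ f ∧ A f).card =
      if P.natDegree ≤ n then ((monics K (n - P.natDegree)).filter fun f => A (P * f)).card
      else 0 := by
  split_ifs with h
  · symm
    refine Finset.card_bij (fun f _ => P * f) ?_ ?_ ?_
    · intro f hf
      rw [Finset.mem_filter] at hf ⊢
      refine ⟨?_, dvd_mul_right _ _, hf.2⟩
      have := mul_mem_monics (mem_monics.2 ⟨hP, rfl⟩) hf.1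
      rwa [Nat.add_sub_cancel' h] at this
    · intro f _ g _ hfg
      exact mul_left_cancel₀ hP.ne_zero hfg
    · intro f hf
      simp only [Finset.mem_filter, mem_monics] at hf
      obtain ⟨⟨hm, hd⟩, ⟨g, rfl⟩, hA⟩ := hf
      have hg : g.Monic := hP.of_mul_monic_left hm
      refine ⟨g, ?_, rfl⟩
      simp only [Finset.mem_filter, mem_monics]
      refine ⟨⟨hg, ?_⟩, hA⟩
      rw [hP.natDegree_mul hg] at hd
      omega
  · rw [Finset.card_eq_zero, Finset.filter_eq_empty_iff]
    rintro f hf ⟨⟨g, rfl⟩, -⟩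
    rw [mem_monics] at hf
    have hg : g.Monic := hP.of_mul_monic_left hf.1
    have := hP.natDegree_mul hg
    omega

/-- The number of square-free monic polynomials of degree `n` with property `A` that are not
divisible by any element of `T`. -/
noncomputable def sqfreeCount (T : Finset K[X]) (n : ℕ) (A : K[X] → Prop) : ℕ :=
  ((monics K n).filter fun f => Squarefree f ∧ (∀ P ∈ T, ¬ P ∣ f) ∧ A f).card

/-- A square-free f is either prime to P or equal to P g with g square-free and prime to P. Hence
avoiding P divides the generating series by 1 + u^(deg P). -/
theorem sqfreeCount_insert {T : Finset K[X]} (hT : IsPrimeSet T) {P : K[X]} (hP : P.Monic)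
    (hP' : Irreducible P) (hPT : P ∉ T) (n : ℕ) (A : K[X] → Prop) :
    sqfreeCount T n A = sqfreeCount (insert P T) n A +
      if P.natDegree ≤ n then sqfreeCount (insert P T) (n - P.natDegree) (fun f => A (P * f))
      else 0 := by
  have key : ∀ f : K[X], (Squarefree (P * f) ∧ (∀ Q ∈ T, ¬ Q ∣ P * f) ∧ A (P * f)) ↔
      (Squarefree f ∧ (∀ Q ∈ insert P T, ¬ Q ∣ f) ∧ A (P * f)) := by
    intro f
    rw [squarefree_mul_iff, isRelPrime_comm, ]
    have h1 : IsRelPrime f P ↔ ¬ P ∣ f := by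
      rw [isRelPrime_comm, hP'.isRelPrime_iff_not_dvd]
    rw [h1, Finset.forall_mem_insert]
    have h2 : (∀ Q ∈ T, ¬ Q ∣ P * f) ↔ ∀ Q ∈ T, ¬ Q ∣ f := by
      refine forall₂_congr fun Q hQ => not_congr ⟨fun h => ?_, fun h => h.mul_left _⟩
      rcases (hT Q hQ).2.prime.dvd_or_dvd h with h | h
      · exact absurd (eq_of_dvd_of_irreducible (hT Q hQ).1 (hT Q hQ).2 hP hP' h ▸ hQ) hPT
      · exact h
    rw [h2]
    have := hP'.squarefree
    tauto
  have h := card_filter_dvd hP n fun f => Squarefree f ∧ (∀ Q ∈ T, ¬ Q ∣ f) ∧ A f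
  simp only [key] at h
  unfold sqfreeCount
  rw [← h, ← Finset.card_filter_add_card_filter_not (s := (monics K n).filter fun f =>
    Squarefree f ∧ (∀ P ∈ T, ¬ P ∣ f) ∧ A f) (fun f => ¬ P ∣ f)]
  simp only [Finset.filter_filter, not_not, Finset.forall_mem_insert]
  congr 2 <;> · ext f; simp only [Finset.mem_filter]; tauto

end MonicPolynomials

/-! ### Square-free polynomials avoiding primes: growth and equidistribution -/

section SquarefreeCounts

variable {K : Type*} [Field K]

theorem prod_injOn_primeSets {T : Finset K[X]} (hT : IsPrimeSet T) :
    Set.InjOn (fun U : Finset K[X] => ∏ P ∈ U, P) {U | U ⊆ T} := by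
  have aux : ∀ U V : Finset K[X], U ⊆ T → V ⊆ T → ∏ P ∈ U, P = ∏ P ∈ V, P → U ⊆ V := by
    intro U V hU hV h P hP
    obtain ⟨Q, hQ, hdvd⟩ := ((hT P (hU hP)).2.prime.dvd_finsetProd_iff _).1
      (h ▸ Finset.dvd_prod_of_mem (fun P => P) hP)
    have hp := hT P (hU hP)
    have hq := hT Q (hV hQ)
    rwa [eq_of_dvd_of_irreducible hp.1 hp.2 hq.1 hq.2 hdvd]
  exact fun U hU V hV h => (aux U V hU hV h).antisymm (aux V U hV hU h.symm)

theorem exists_monic_irreducible_associated {P : K[X]} (hP : Irreducible P) :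
    ∃ Q : K[X], Q.Monic ∧ Irreducible Q ∧ Associated P Q := by
  have hu : P.leadingCoeff ≠ 0 := leadingCoeff_ne_zero.2 hP.ne_zero
  have h : Associated P (P * C P.leadingCoeff⁻¹) :=
    associated_mul_unit_right _ _ (isUnit_C.2 (isUnit_iff_ne_zero.2 (inv_ne_zero hu)))
  exact ⟨_, monic_mul_leadingCoeff_inv hP.ne_zero, h.irreducible hP, h⟩

variable [Fintype K]

/-- Every monic f is s² g with g square-free, in exactly one way; k is the degree of s. -/
theorem card_pow_eq_sum_sqfreeCount (n : ℕ) :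
    Fintype.card K ^ n = ∑ k ∈ Finset.range (n / 2 + 1),
      Fintype.card K ^ k * sqfreeCount (∅ : Finset K[X]) (n - 2 * k) (fun _ => True) := by
  simp only [← card_monics, sqfreeCount, ← Finset.card_product]
  rw [← Finset.card_sigma]
  symm
  refine Finset.card_bij (fun x _ => x.2.1 ^ 2 * x.2.2) ?_ ?_ ?_
  · rintro ⟨k, s, g⟩ h
    simp only [Finset.mem_sigma, Finset.mem_range, Finset.mem_product, Finset.mem_filter,
      mem_monics] at h ⊢
    obtain ⟨hk, ⟨hs, hsd⟩, ⟨hg, hgd⟩, -⟩ := h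
    refine ⟨(hs.pow 2).mul hg, ?_⟩
    rw [(hs.pow 2).natDegree_mul hg, hs.natDegree_pow, hsd, hgd]
    omega
  · rintro ⟨k, s, g⟩ h ⟨k', s', g'⟩ h' he
    simp only [Finset.mem_sigma, Finset.mem_range, Finset.mem_product, Finset.mem_filter,
      mem_monics] at h h' he
    obtain ⟨hk, ⟨hs, hsd⟩, ⟨hg, hgd⟩, hsq, -⟩ := h
    obtain ⟨hk', ⟨hs', hsd'⟩, ⟨hg', hgd'⟩, hsq', -⟩ := h'
    obtain rfl := eq_of_sq_mul_squarefree hs hs' hsq hsq' he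
    obtain rfl := mul_left_cancel₀ (hs.pow 2).ne_zero he
    obtain rfl : k = k' := hsd ▸ hsd'
    rfl
  · intro f hf
    rw [mem_monics] at hf
    obtain ⟨s, g, hs, hg, hsq, rfl⟩ := exists_sq_mul_squarefree hf.1
    have hd := hf.2
    rw [(hs.pow 2).natDegree_mul hg, hs.natDegree_pow] at hd
    refine ⟨⟨s.natDegree, s, g⟩, ?_, rfl⟩
    simp only [Finset.mem_sigma, Finset.mem_range, Finset.mem_product, Finset.mem_filter,
      mem_monics]
    refine ⟨by omega, ⟨hs, trivial⟩, ⟨hg, by omega⟩, hsq, by simp⟩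

theorem sqfreeCount_empty_zero :
    sqfreeCount (∅ : Finset K[X]) 0 (fun _ => True) = 1 := by
  simpa using (card_pow_eq_sum_sqfreeCount (K := K) 0).symm

theorem sqfreeCount_empty_one :
    sqfreeCount (∅ : Finset K[X]) 1 (fun _ => True) = Fintype.card K := by
  simpa using (card_pow_eq_sum_sqfreeCount (K := K) 1).symm

/-- In the decomposition for degree n + 2, the terms with k ≥ 1 are q times the decomposition for
degree n. -/
theorem sqfreeCount_empty_add_two (n : ℕ) :
    sqfreeCount (∅ : Finset K[X]) (n + 2) (fun _ => True) + Fintype.card K ^ (n + 1) =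
      Fintype.card K ^ (n + 2) := by
  rw [card_pow_eq_sum_sqfreeCount (n + 2), pow_succ, card_pow_eq_sum_sqfreeCount n, Finset.sum_mul,
    show (n + 2) / 2 + 1 = (n / 2 + 1) + 1 by omega,
    Finset.sum_range_succ' _ (n / 2 + 1), add_comm]
  simp only [pow_zero, one_mul, mul_zero, Nat.sub_zero]
  congr 1
  refine Finset.sum_congr rfl fun k _ => ?_
  rw [show n + 2 - 2 * (k + 1) = n - 2 * k by omega]
  ring

/-- The deviation of the square-free count from geometric growth. -/
noncomputable def sqfreeDiff (T : Finset K[X]) (n : ℕ) : ℝ :=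
  sqfreeCount T n (fun _ => True) -
    if n = 0 then 0 else (Fintype.card K : ℝ) * sqfreeCount T (n - 1) (fun _ => True)

/-- The difference depends linearly on the counts, so it inherits the recursion of
`sqfreeCount_insert`, including at the boundary degrees n = 0 and n = deg P. -/
theorem sqfreeDiff_insert {T : Finset K[X]} (hT : IsPrimeSet T) {P : K[X]} (hP : P.Monic)
    (hP' : Irreducible P) (hPT : P ∉ T) (n : ℕ) :
    sqfreeDiff T n = sqfreeDiff (insert P T) n +
      if P.natDegree ≤ n then sqfreeDiff (insert P T) (n - P.natDegree) else 0 := by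
  have hd : 0 < P.natDegree := hP'.natDegree_pos
  simp only [sqfreeDiff]
  rw [sqfreeCount_insert hT hP hP' hPT n, sqfreeCount_insert hT hP hP' hPT (n - 1)]
  by_cases hn : n = 0
  · subst hn
    rw [if_pos rfl, if_pos rfl, if_neg (by omega), if_neg (by omega)]
    simp
  · rw [if_neg hn, if_neg hn]
    rcases lt_trichotomy n P.natDegree with h | h | h
    · rw [if_neg (by omega), if_neg (by omega), if_neg (by omega)]
      simp
    · rw [if_pos (by omega), if_neg (by omega), if_pos (by omega), if_pos (by omega)]
      push_cast
      ring
    · rw [if_pos (by omega), if_pos (by omega), if_pos (by omega), if_neg (by omega),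
        show n - 1 - P.natDegree = n - P.natDegree - 1 by omega]
      push_cast
      ring

/-- The generating series of square-free monics is (1 - q u²)/(1 - q u), so the differences are the
coefficients 1, 0, -q, 0, 0, … of 1 - q u². -/
theorem abs_sqfreeDiff_empty_le {y : ℝ} (hy : 1 < y) (n : ℕ) :
    |sqfreeDiff (∅ : Finset K[X]) n| ≤ Fintype.card K * y ^ n := by
  have hq : (1 : ℝ) ≤ Fintype.card K := by exact_mod_cast Fintype.card_pos (α := K)
  have hyn : 1 ≤ y ^ n := one_le_pow₀ hy.le
  have hqy : (Fintype.card K : ℝ) ≤ Fintype.card K * y ^ n :=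
    le_mul_of_one_le_right (by positivity) hyn
  match n with
  | 0 =>
    simp only [sqfreeDiff, sqfreeCount_empty_zero, if_true]
    simpa using hq
  | 1 =>
    have h0 : ((sqfreeCount (∅ : Finset K[X]) (1 - 1) (fun _ => True) : ℕ) : ℝ) = 1 := by
      exact_mod_cast sqfreeCount_empty_zero
    simp only [sqfreeDiff, h0, sqfreeCount_empty_one]
    simp
    linarith
  | 2 =>
    have h2 : sqfreeCount (∅ : Finset K[X]) 2 (fun _ => True) + Fintype.card K ^ 1 =
        Fintype.card K ^ 2 := sqfreeCount_empty_add_two 0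
    have h2' : ((sqfreeCount (∅ : Finset K[X]) 2 (fun _ => True) : ℕ) : ℝ) =
        (Fintype.card K : ℝ) ^ 2 - Fintype.card K := by
      rw [eq_sub_iff_add_eq]; rw [pow_one] at h2; exact_mod_cast h2
    have h0 : ((sqfreeCount (∅ : Finset K[X]) (2 - 1) (fun _ => True) : ℕ) : ℝ) =
        Fintype.card K := by
      exact_mod_cast sqfreeCount_empty_one
    simp only [sqfreeDiff, h2', h0]
    rw [if_neg (by norm_num)]
    rw [show (Fintype.card K : ℝ) ^ 2 - Fintype.card K - Fintype.card K * Fintype.card K =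
      -Fintype.card K by ring, abs_neg, abs_of_nonneg (by positivity)]
    exact hqy
  | k + 3 =>
    have h2 := sqfreeCount_empty_add_two (K := K) (k + 1)
    have h3 := sqfreeCount_empty_add_two (K := K) k
    have h2' : ((sqfreeCount (∅ : Finset K[X]) (k + 3) (fun _ => True) : ℕ) : ℝ) =
        (Fintype.card K : ℝ) ^ (k + 3) - Fintype.card K ^ (k + 2) := by
      rw [eq_sub_iff_add_eq]; exact_mod_cast h2
    have h3' : ((sqfreeCount (∅ : Finset K[X]) (k + 2) (fun _ => True) : ℕ) : ℝ) =
        (Fintype.card K : ℝ) ^ (k + 2) - Fintype.card K ^ (k + 1) := by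
      rw [eq_sub_iff_add_eq]; exact_mod_cast h3
    simp only [sqfreeDiff, h2', show k + 3 - 1 = k + 2 by omega, h3']
    rw [if_neg (by omega)]
    rw [show (Fintype.card K : ℝ) ^ (k + 3) - Fintype.card K ^ (k + 2) -
      Fintype.card K * (Fintype.card K ^ (k + 2) - Fintype.card K ^ (k + 1)) = 0 by ring, abs_zero]
    positivity

/-- Insert the avoided primes one at a time: solving the recursion for the new difference and taking
absolute values gives the hypothesis of `bound_of_one_step`. -/
theorem abs_sqfreeDiff_le {y : ℝ} (hy : 1 < y) {T : Finset K[X]} (hT : IsPrimeSet T) (n : ℕ) :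
    |sqfreeDiff T n| ≤ Fintype.card K * eulerFactor y T * y ^ n := by
  induction T using Finset.induction_on generalizing n with
  | empty => simpa [eulerFactor] using abs_sqfreeDiff_empty_le hy n
  | insert P T hPT ih =>
    have hT' := hT.mono (Finset.subset_insert P T)
    have hP := hT P (Finset.mem_insert_self _ _)
    have h := bound_of_one_step (ι := Unit) (a := fun _ n => |sqfreeDiff T n|)
      (b := fun _ n => |sqfreeDiff (insert P T) n|) (σ := id) (d := P.natDegree)
      hP.2.natDegree_pos hy (fun _ n => ih hT' n) ?_ ?_ () n
    · rw [eulerFactor, Finset.prod_insert hPT]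
      refine h.trans (le_of_eq ?_)
      rw [eulerFactor]
      ring
    · intro _ n
      have h1 := sqfreeDiff_insert hT' hP.1 hP.2 hPT n
      split_ifs at h1 ⊢ with hd
      · rw [h1]
        exact (by
          have := abs_sub (sqfreeDiff (insert P T) n + sqfreeDiff (insert P T) (n - P.natDegree))
            (sqfreeDiff (insert P T) (n - P.natDegree))
          simpa using this)
      · rw [h1]
        simp
    · have := one_le_eulerFactor hy hT'
      positivity

/-- The number of monic polynomials of degree `n` with property `A` that are not divisible by
the square of any element of `T`. -/
noncomputable def sqAvoidCount (T : Finset K[X]) (n : ℕ) (A : K[X] → Prop) : ℕ :=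
  ((monics K n).filter fun f => (∀ P ∈ T, ¬ P ^ 2 ∣ f) ∧ A f).card

/-- If f = P² g, then g may again be divisible by P², so the last term involves T and not `insert P
T`. Unrolling in P therefore stops after one step, and the recursion becomes a finite
inclusion–exclusion. -/
theorem sqAvoidCount_insert {T : Finset K[X]} (hT : IsPrimeSet T) {P : K[X]} (hP : P.Monic)
    (hP' : Irreducible P) (hPT : P ∉ T) (n : ℕ) (A : K[X] → Prop) :
    sqAvoidCount T n A = sqAvoidCount (insert P T) n A +
      if 2 * P.natDegree ≤ n then sqAvoidCount T (n - 2 * P.natDegree) (fun f => A (P ^ 2 * f))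
      else 0 := by
  have key : ∀ f : K[X], ((∀ Q ∈ T, ¬ Q ^ 2 ∣ P ^ 2 * f) ∧ A (P ^ 2 * f)) ↔
      ((∀ Q ∈ T, ¬ Q ^ 2 ∣ f) ∧ A (P ^ 2 * f)) := by
    intro f
    refine and_congr_left fun _ => forall₂_congr fun Q hQ =>
      not_congr ⟨fun h => ?_, fun h => h.mul_left _⟩
    have hc : IsCoprime Q P := ((hT Q hQ).2.coprime_iff_not_dvd).2 fun h =>
      hPT (eq_of_dvd_of_irreducible (hT Q hQ).1 (hT Q hQ).2 hP hP' h ▸ hQ)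
    exact (hc.pow (m := 2) (n := 2)).dvd_of_dvd_mul_left h
  have h := card_filter_dvd (hP.pow 2) n fun f => (∀ Q ∈ T, ¬ Q ^ 2 ∣ f) ∧ A f
  simp only [key, hP.natDegree_pow] at h
  unfold sqAvoidCount
  rw [← h, ← Finset.card_filter_add_card_filter_not (s := (monics K n).filter fun f =>
    (∀ P ∈ T, ¬ P ^ 2 ∣ f) ∧ A f) (fun f => ¬ P ^ 2 ∣ f)]
  simp only [Finset.filter_filter, not_not, Finset.forall_mem_insert]
  congr 2 <;> · ext f; simp only [Finset.mem_filter]; tauto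

/-- Among the monic multiples `g * f` with `f` of a given degree at least `l`, properties `A` and
`B` are equally frequent. -/
def EquallyFrequent (l : ℕ) (A B : K[X] → Prop) : Prop :=
  ∀ g : K[X], g.Monic → ∀ n, l ≤ n →
    ((monics K n).filter fun f => A (g * f)).card = ((monics K n).filter fun f => B (g * f)).card

theorem EquallyFrequent.shift {l : ℕ} {A B : K[X] → Prop} (h : EquallyFrequent l A B) {g : K[X]}
    (hg : g.Monic) : EquallyFrequent l (fun f => A (g * f)) (fun f => B (g * f)) := by
  intro g' hg' n hn
  simpa only [mul_assoc] using h (g * g') (hg.mul hg') n hn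

/-- A bound for the discrepancy of equally frequent properties in degree `n`. -/
noncomputable def discrepancy (q l n : ℕ) : ℝ := if n < l then (q : ℝ) ^ n else 0

/-- Inclusion–exclusion over the subsets U of T, each accounting for the multiples of the square of
∏ U. The cofactor has degree n - 2 deg ∏ U: from l on the two properties occur equally often, and
below l the trivial count is used. -/
theorem abs_sqAvoidCount_sub_le {l : ℕ} {T : Finset K[X]} (hT : IsPrimeSet T) (n : ℕ)
    {A B : K[X] → Prop} (h : EquallyFrequent l A B) :
    |(sqAvoidCount T n A : ℝ) - sqAvoidCount T n B| ≤
      ∑ U ∈ T.powerset, if 2 * ∑ P ∈ U, P.natDegree ≤ n then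
        discrepancy (Fintype.card K) l (n - 2 * ∑ P ∈ U, P.natDegree) else 0 := by
  induction T using Finset.induction_on generalizing n A B with
  | empty =>
    simp only [Finset.powerset_empty, Finset.sum_singleton, Finset.sum_empty, mul_zero,
      Nat.zero_le, if_true, Nat.sub_zero, discrepancy]
    have hle : ∀ A : K[X] → Prop, (sqAvoidCount (∅ : Finset K[X]) n A : ℝ) ≤
        (Fintype.card K : ℝ) ^ n := by
      intro A
      have := Finset.card_filter_le (monics K n)
        (fun f => (∀ P ∈ (∅ : Finset K[X]), ¬ P ^ 2 ∣ f) ∧ A f)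
      rw [card_monics] at this
      exact_mod_cast this
    split_ifs with hn
    · rw [abs_sub_le_iff]
      have h1 := hle A
      have h2 := hle B
      have h3 : (0 : ℝ) ≤ sqAvoidCount (∅ : Finset K[X]) n A := by positivity
      have h4 : (0 : ℝ) ≤ sqAvoidCount (∅ : Finset K[X]) n B := by positivity
      constructor <;> linarith
    · have := h 1 monic_one n (by omega)
      simp only [one_mul] at this
      simp [sqAvoidCount, this]
  | insert P T hPT ih =>
    have hT' := hT.mono (Finset.subset_insert P T)
    have hP := hT P (Finset.mem_insert_self _ _)
    have hA := sqAvoidCount_insert hT' hP.1 hP.2 hPT n A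
    have hB := sqAvoidCount_insert hT' hP.1 hP.2 hPT n B
    rw [Finset.sum_powerset_insert hPT]
    have h1 := ih hT' n h
    have hsum : ∑ U ∈ T.powerset, (if 2 * ∑ P ∈ insert P U, P.natDegree ≤ n then
        discrepancy (Fintype.card K) l (n - 2 * ∑ P ∈ insert P U, P.natDegree) else 0) =
        if 2 * P.natDegree ≤ n then ∑ U ∈ T.powerset,
          (if 2 * ∑ P ∈ U, P.natDegree ≤ n - 2 * P.natDegree then
        discrepancy (Fintype.card K) l (n - 2 * P.natDegree - 2 * ∑ P ∈ U, P.natDegree) else 0)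
        else 0 := by
      have hins : ∀ U ∈ T.powerset, ∑ P ∈ insert P U, P.natDegree =
          P.natDegree + ∑ P ∈ U, P.natDegree := fun U hU =>
        Finset.sum_insert fun hPU => hPT (Finset.mem_powerset.1 hU hPU)
      split_ifs with hd
      · refine Finset.sum_congr rfl fun U hU => ?_
        rw [hins U hU, Nat.sub_sub, mul_add]
        split_ifs <;> first | rfl | omega
      · refine Finset.sum_eq_zero fun U hU => if_neg ?_
        rw [hins U hU]
        omega
    rw [hsum]
    split_ifs at hA hB ⊢ with hd
    · have h2 := ih hT' (n - 2 * P.natDegree) (h.shift (hP.1.pow 2))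
      have hA' := congrArg (Nat.cast (R := ℝ)) hA
      have hB' := congrArg (Nat.cast (R := ℝ)) hB
      rw [abs_le] at h1 h2 ⊢
      push_cast at hA' hB'
      constructor <;> linarith
    · rw [add_zero] at hA hB ⊢
      rwa [hA, hB] at h1

theorem prod_mem_monics {T : Finset K[X]} (hT : IsPrimeSet T) :
    ∏ P ∈ T, P ∈ monics K (∑ P ∈ T, P.natDegree) :=
  mem_monics.2 ⟨monic_prod_of_monic _ _ fun P hP => (hT P hP).1,
    natDegree_prod_of_monic _ _ fun P hP => (hT P hP).1⟩

theorem card_powerset_filter_le {T : Finset K[X]} (hT : IsPrimeSet T) (k : ℕ) :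
    (T.powerset.filter fun U => ∑ P ∈ U, P.natDegree = k).card ≤ Fintype.card K ^ k := by
  rw [← card_monics]
  refine Finset.card_le_card_of_injOn (fun U => ∏ P ∈ U, P) ?_ ?_
  · intro U hU
    simp only [Finset.coe_filter, Finset.mem_powerset, Set.mem_ofPred_eq] at hU
    have := prod_mem_monics (hT.mono hU.1)
    rw [hU.2] at this
    exact this
  · refine (prod_injOn_primeSets hT).mono ?_
    intro U hU
    simp only [Finset.coe_filter, Finset.mem_powerset, Set.mem_ofPred_eq] at hU
    exact hU.1

/-- Group the subsets by k = deg ∏ U; by unique factorization there are at most q^k of them. Only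
the at most l values of k with 0 ≤ n - 2k < l contribute, each at most q^k q^(n-2k) = √q^(n +
(n-2k)) ≤ √q^(n+l). The bound does not depend on T. -/
theorem abs_sqAvoidCount_sub_le' {l : ℕ} {T : Finset K[X]} (hT : IsPrimeSet T) (n : ℕ)
    {A B : K[X] → Prop} (h : EquallyFrequent l A B) :
    |(sqAvoidCount T n A : ℝ) - sqAvoidCount T n B| ≤
      l * (√(Fintype.card K : ℝ) ^ l * √(Fintype.card K : ℝ) ^ n) := by
  set q := Fintype.card K with hq
  have hq1 : (1 : ℝ) ≤ q := by exact_mod_cast Fintype.card_pos (α := K)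
  have hs1 : 1 ≤ √(q : ℝ) := Real.one_le_sqrt.2 hq1
  refine (abs_sqAvoidCount_sub_le hT n h).trans ?_
  calc _ ≤ ∑ U ∈ T.powerset with ∑ P ∈ U, P.natDegree ∈ Finset.range (n + 1),
        (if 2 * ∑ P ∈ U, P.natDegree ≤ n then
          discrepancy q l (n - 2 * ∑ P ∈ U, P.natDegree) else 0) := by
        refine le_of_eq (Finset.sum_filter_of_ne fun U _ hne => ?_).symm
        rw [Finset.mem_range]
        by_contra hlt
        exact hne (if_neg (by omega))
    _ = ∑ k ∈ Finset.range (n + 1), ∑ U ∈ T.powerset with ∑ P ∈ U, P.natDegree = k,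
        (if 2 * k ≤ n then discrepancy q l (n - 2 * k) else 0) := by
        rw [← Finset.sum_fiberwise_of_maps_to (t := Finset.range (n + 1))
          (g := fun U : Finset K[X] => ∑ P ∈ U, P.natDegree)
          (fun U hU => (Finset.mem_filter.1 hU).2)]
        refine Finset.sum_congr rfl fun k hk => ?_
        rw [Finset.filter_filter]
        refine Finset.sum_congr ?_ fun U hU => by rw [(Finset.mem_filter.1 hU).2]
        ext U
        simp only [Finset.mem_filter]
        constructor
        · tauto
        · rintro ⟨h1, rfl⟩; tauto
    _ ≤ ∑ k ∈ Finset.range (n + 1) with 2 * k ≤ n ∧ n - 2 * k < l,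
          (√(q : ℝ) ^ l * √(q : ℝ) ^ n) := by
        rw [Finset.sum_filter]
        refine Finset.sum_le_sum fun k _ => ?_
        rw [Finset.sum_const, nsmul_eq_mul]
        unfold discrepancy
        split_ifs <;> first | (exfalso; omega) | skip
        · have h1 : ((T.powerset.filter fun U => ∑ P ∈ U, P.natDegree = k).card : ℝ) ≤
              (q : ℝ) ^ k := by exact_mod_cast card_powerset_filter_le hT k
          refine (mul_le_mul_of_nonneg_right h1 (by positivity)).trans ?_
          rw [← pow_add]
          nth_rewrite 1 [← Real.sq_sqrt (zero_le_one.trans hq1)]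
          rw [← pow_mul, ← pow_add]
          exact pow_le_pow_right₀ hs1 (by omega)
        · simp
        · simp
    _ ≤ _ := by
        rw [Finset.sum_const, nsmul_eq_mul]
        refine mul_le_mul_of_nonneg_right ?_ (by positivity)
        rw [Nat.cast_le]
        calc _ ≤ (Finset.range l).card := by
              refine Finset.card_le_card_of_injOn (fun k => n - 2 * k) ?_ ?_
              · intro k hk
                simp only [Finset.coe_filter, Finset.mem_range, Set.mem_ofPred_eq] at hk
                simpa using hk.2.2
              · intro k hk k' hk' he
                simp only [Finset.coe_filter, Finset.mem_range, Set.mem_ofPred_eq] at hk hk' he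
                omega
          _ = l := Finset.card_range l

/-- The monic irreducible polynomials of degree at most `N`. -/
noncomputable def irreducibles (K : Type*) [Field K] [Fintype K] (N : ℕ) : Finset K[X] :=
  (Finset.range (N + 1)).biUnion fun n => (monics K n).filter Irreducible

theorem mem_irreducibles {N : ℕ} {P : K[X]} :
    P ∈ irreducibles K N ↔ P.Monic ∧ Irreducible P ∧ P.natDegree ≤ N := by
  simp only [irreducibles, Finset.mem_biUnion, Finset.mem_range, Finset.mem_filter, mem_monics]
  constructor
  · rintro ⟨n, hn, ⟨h1, h2⟩, h3⟩
    exact ⟨h1, h3, by omega⟩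
  · rintro ⟨h1, h2, h3⟩
    exact ⟨_, by omega, ⟨h1, rfl⟩, h2⟩

theorem isPrimeSet_irreducibles (N : ℕ) : IsPrimeSet (irreducibles K N) :=
  fun _ hP => ⟨(mem_irreducibles.1 hP).1, (mem_irreducibles.1 hP).2.1⟩

theorem squarefree_iff_irreducibles {n : ℕ} {f : K[X]} (hf : f ∈ monics K n) :
    Squarefree f ↔ ∀ P ∈ irreducibles K n, ¬ P ^ 2 ∣ f := by
  rw [mem_monics] at hf
  rw [squarefree_iff_irreducible_sq_not_dvd_of_ne_zero hf.1.ne_zero]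
  constructor
  · intro h P hP hd
    exact h P (mem_irreducibles.1 hP).2.1 (by rwa [← sq])
  · intro h P hP hd
    obtain ⟨Q, hQ, hQ', ha⟩ := exists_monic_irreducible_associated hP
    have hd' : Q ^ 2 ∣ f := by
      rw [sq]
      exact (ha.mul_mul ha).symm.dvd.trans hd
    refine h Q (mem_irreducibles.2 ⟨hQ, hQ', ?_⟩) hd'
    have := natDegree_le_of_dvd hd' hf.1.ne_zero
    rw [hQ.natDegree_pow] at this
    omega

/-- With nothing to avoid, square-free means avoiding the squares of all primes of degree at most n,
and the previous bound is uniform in that set. The primes of T are then inserted with y = √q. -/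
theorem abs_sqfreeCount_sub_le {l : ℕ} (hs : 1 < √(Fintype.card K : ℝ)) {T : Finset K[X]}
    (hT : IsPrimeSet T) (n : ℕ) {A B : K[X] → Prop} (h : EquallyFrequent l A B) :
    |(sqfreeCount T n A : ℝ) - sqfreeCount T n B| ≤
      l * √(Fintype.card K : ℝ) ^ l * eulerFactor √(Fintype.card K : ℝ) T *
        √(Fintype.card K : ℝ) ^ n := by
  induction T using Finset.induction_on generalizing n A B with
  | empty =>
    have hrew : ∀ A : K[X] → Prop, sqfreeCount (∅ : Finset K[X]) n A =
        sqAvoidCount (irreducibles K n) n A := by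
      intro A
      unfold sqfreeCount sqAvoidCount
      congr 1
      refine Finset.filter_congr fun f hf => ?_
      rw [squarefree_iff_irreducibles hf]
      simp
    rw [hrew, hrew, eulerFactor, Finset.prod_empty, mul_one, mul_assoc]
    exact abs_sqAvoidCount_sub_le' (isPrimeSet_irreducibles n) n h
  | insert P T hPT ih =>
    have hT' := hT.mono (Finset.subset_insert P T)
    have hP := hT P (Finset.mem_insert_self _ _)
    -- Passing from f to P f changes both properties, so the recursion has to run over all equally
    -- frequent pairs at once.
    let ι := {x : (K[X] → Prop) × (K[X] → Prop) // EquallyFrequent l x.1 x.2}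
    have h := bound_of_one_step (ι := ι)
      (a := fun x n => |(sqfreeCount T n x.1.1 : ℝ) - sqfreeCount T n x.1.2|)
      (b := fun x n =>
        |(sqfreeCount (insert P T) n x.1.1 : ℝ) - sqfreeCount (insert P T) n x.1.2|)
      (σ := fun x => ⟨(fun f => x.1.1 (P * f), fun f => x.1.2 (P * f)), x.2.shift hP.1⟩)
      (d := P.natDegree) hP.2.natDegree_pos hs (fun x n => ih hT' n x.2) ?_ ?_ ⟨(A, B), h⟩ n
    · rw [eulerFactor, Finset.prod_insert hPT]
      refine h.trans (le_of_eq ?_)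
      rw [eulerFactor]
      ring
    · intro x n
      have h1 := sqfreeCount_insert hT' hP.1 hP.2 hPT n x.1.1
      have h2 := sqfreeCount_insert hT' hP.1 hP.2 hPT n x.1.2
      dsimp only
      split_ifs at h1 h2 ⊢ with hd
      · rw [h1, h2]
        push_cast
        generalize ((sqfreeCount (insert P T) (n - P.natDegree) fun f => x.1.1 (P * f) : ℕ) : ℝ) = u
        generalize ((sqfreeCount (insert P T) (n - P.natDegree) fun f => x.1.2 (P * f) : ℕ) : ℝ) = v
        generalize ((sqfreeCount (insert P T) n x.1.1 : ℕ) : ℝ) = u'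
        generalize ((sqfreeCount (insert P T) n x.1.2 : ℕ) : ℝ) = v'
        calc |u' - v'| = |(u' + u - (v' + v)) - (u - v)| := by ring_nf
          _ ≤ _ := abs_sub _ _
      · rw [h1, h2]
        simp
    · have := one_le_eulerFactor hs hT'
      positivity

end SquarefreeCounts

/-! ### Average size of Euler factors -/

section EulerFactors

variable {K : Type*} [Field K]

theorem eulerFactor_union_le {y : ℝ} (hy : 1 < y) {T U : Finset K[X]} (hT : IsPrimeSet T)
    (hU : IsPrimeSet U) : eulerFactor y (T ∪ U) ≤ eulerFactor y T * eulerFactor y U := by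
  have h := Finset.prod_union_inter (s₁ := T) (s₂ := U)
    (f := fun P : K[X] => (1 - (y ^ P.natDegree)⁻¹)⁻¹)
  have h1 : 1 ≤ eulerFactor y (T ∩ U) := one_le_eulerFactor hy (hT.mono Finset.inter_subset_left)
  have hTU : IsPrimeSet (T ∪ U) := fun P hP => (Finset.mem_union.1 hP).elim (hT P) (hU P)
  have h2 : 1 ≤ eulerFactor y (T ∪ U) := one_le_eulerFactor hy hTU
  unfold eulerFactor at *
  rw [← h]
  exact le_mul_of_one_le_right (by linarith) h1

theorem eulerFactor_biUnion_le {ι : Type*} {y : ℝ} (hy : 1 < y) (s : Finset ι)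
    {T : ι → Finset K[X]} (hT : ∀ i, IsPrimeSet (T i)) :
    IsPrimeSet (s.biUnion T) ∧ eulerFactor y (s.biUnion T) ≤ ∏ i ∈ s, eulerFactor y (T i) := by
  have hb : ∀ s : Finset ι, IsPrimeSet (s.biUnion T) := by
    intro s P hP
    obtain ⟨i, -, hi⟩ := Finset.mem_biUnion.1 hP
    exact hT i P hi
  refine ⟨hb s, ?_⟩
  induction s using Finset.induction_on with
  | empty => simp [eulerFactor]
  | insert i s his ih =>
    rw [Finset.biUnion_insert, Finset.prod_insert his]
    have := one_le_eulerFactor hy (hT i)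
    exact (eulerFactor_union_le hy (hT i) (hb s)).trans
      (mul_le_mul_of_nonneg_left ih (by linarith))

/-- The k-th term is 1/(y^(k+1) - 1) ≤ 1/(y^k (y - 1)), and the resulting geometric series sums to
y/(y - 1)². -/
theorem sum_inv_pow_sub_one_le {y : ℝ} (hy : 1 < y) (n : ℕ) :
    ∑ k ∈ Finset.range n, ((1 - (y ^ (k + 1))⁻¹)⁻¹ - 1) ≤ y / (y - 1) ^ 2 := by
  have hy1 : 0 < y - 1 := sub_pos.2 hy
  have hy0 : 0 < y := zero_lt_one.trans hy
  have h : ∑ k ∈ Finset.range n, ((1 - (y ^ (k + 1))⁻¹)⁻¹ - 1) ≤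
      y / (y - 1) ^ 2 * (1 - (y ^ n)⁻¹) := by
    induction n with
    | zero => simp
    | succ n ih =>
      rw [Finset.sum_range_succ]
      have hyn : 1 ≤ y ^ n := one_le_pow₀ hy.le
      have hyn1 : 1 < y ^ (n + 1) := one_lt_pow₀ hy (by omega)
      have h1 : (1 - (y ^ (n + 1))⁻¹)⁻¹ - 1 = 1 / (y ^ (n + 1) - 1) := by
        have : y ^ (n + 1) - 1 ≠ 0 := (sub_pos.2 hyn1).ne'
        have h0 : y ^ (n + 1) ≠ 0 := by positivity
        generalize y ^ (n + 1) = w at *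
        have : 1 - w⁻¹ ≠ 0 := by
          rw [sub_ne_zero]
          intro h
          exact hyn1.ne' (by rw [← inv_inv w, ← h, inv_one])
        field_simp
        ring
      have h2 : 1 / (y ^ (n + 1) - 1) ≤ 1 / (y ^ n * (y - 1)) := by
        refine one_div_le_one_div_of_le (by positivity) ?_
        rw [pow_succ]
        nlinarith
      have h3 : 1 / (y ^ n * (y - 1)) =
          y / (y - 1) ^ 2 * (1 - (y ^ (n + 1))⁻¹) - y / (y - 1) ^ 2 * (1 - (y ^ n)⁻¹) := by
        rw [pow_succ]
        field_simp
        ring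
      linarith
  refine h.trans (mul_le_of_le_one_right (by positivity) ?_)
  exact sub_le_self _ (by positivity)

variable [Fintype K]

/-- The monic irreducible divisors of a polynomial. -/
noncomputable def monicPrimeFactors (f : K[X]) : Finset K[X] :=
  (irreducibles K f.natDegree).filter (· ∣ f)

theorem mem_monicPrimeFactors {f P : K[X]} (hf : f ≠ 0) :
    P ∈ monicPrimeFactors f ↔ P.Monic ∧ Irreducible P ∧ P ∣ f := by
  rw [monicPrimeFactors, Finset.mem_filter, mem_irreducibles]
  exact ⟨fun h => ⟨h.1.1, h.1.2.1, h.2⟩,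
    fun h => ⟨⟨h.1, h.2.1, natDegree_le_of_dvd h.2.2 hf⟩, h.2.2⟩⟩

theorem isPrimeSet_monicPrimeFactors (f : K[X]) : IsPrimeSet (monicPrimeFactors f) :=
  (isPrimeSet_irreducibles _).mono (Finset.filter_subset _ _)

theorem isCoprime_iff_monicPrimeFactors {f g : K[X]} (hg : g ≠ 0) :
    IsCoprime f g ↔ ∀ P ∈ monicPrimeFactors g, ¬ P ∣ f := by
  constructor
  · intro h P hP hd
    rw [mem_monicPrimeFactors hg] at hP
    exact hP.2.1.not_isUnit (h.isUnit_of_dvd' hd hP.2.2)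
  · intro h
    refine isCoprime_of_irreducible_dvd (fun h0 => hg h0.2) fun P hP hPf hPg => ?_
    obtain ⟨Q, hQ, hQ', ha⟩ := exists_monic_irreducible_associated hP
    exact h Q ((mem_monicPrimeFactors hg).2 ⟨hQ, hQ', ha.symm.dvd.trans hPg⟩)
      (ha.symm.dvd.trans hPf)

/-- Distinct monic primes are coprime, so their product must divide f. This is only an inequality
because the left side is 0 once the product has degree above n. -/
theorem card_filter_forall_dvd_le {n : ℕ} {U : Finset K[X]} (hU : IsPrimeSet U) :
    (((monics K n).filter fun f => ∀ P ∈ U, P ∣ f).card : ℝ) ≤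
      (Fintype.card K : ℝ) ^ n * ∏ P ∈ U, ((Fintype.card K : ℝ) ^ P.natDegree)⁻¹ := by
  have hq : (0 : ℝ) < Fintype.card K := by exact_mod_cast Fintype.card_pos (α := K)
  have hsub : ((monics K n).filter fun f => ∀ P ∈ U, P ∣ f) ⊆
      (monics K n).filter fun f => ∏ P ∈ U, P ∣ f ∧ True := by
    intro f hf
    rw [Finset.mem_filter] at hf ⊢
    refine ⟨hf.1, Finset.prod_dvd_of_coprime ?_ hf.2, trivial⟩
    intro P hP Q hQ hne
    exact ((hU P hP).2.coprime_iff_not_dvd).2 fun h =>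
      hne (eq_of_dvd_of_irreducible (hU P hP).1 (hU P hP).2 (hU Q hQ).1 (hU Q hQ).2 h)
  have hcard := Finset.card_le_card hsub
  have hmem := mem_monics.1 (prod_mem_monics hU)
  have hdvd : ((monics K n).filter fun f => ∏ P ∈ U, P ∣ f ∧ True).card =
      if ∑ P ∈ U, P.natDegree ≤ n then (monics K (n - ∑ P ∈ U, P.natDegree)).card else 0 := by
    have h := card_filter_dvd hmem.1 n fun _ => True
    rw [Finset.filter_true, hmem.2] at h
    rw [← h]
    congr
  rw [hdvd] at hcard
  rw [Finset.prod_inv_distrib, Finset.prod_pow_eq_pow_sum]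
  split_ifs at hcard with h
  · rw [card_monics] at hcard
    rw [← pow_sub₀ _ hq.ne' h]
    exact_mod_cast hcard
  · rw [Nat.le_zero.1 hcard, Nat.cast_zero]
    positivity

/-- Euler factors are bounded on average. -/
theorem sum_eulerFactor_monicPrimeFactors_le {y : ℝ} (hy : 1 < y) (n : ℕ) :
    ∑ f ∈ monics K n, eulerFactor y (monicPrimeFactors f) ≤
      Real.exp (y / (y - 1) ^ 2) * (Fintype.card K : ℝ) ^ n := by
  set q : ℝ := (Fintype.card K : ℝ) with hqdef
  have hq : 0 < q := by rw [hqdef]; exact_mod_cast Fintype.card_pos (α := K)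
  let x : K[X] → ℝ := fun P => (1 - (y ^ P.natDegree)⁻¹)⁻¹ - 1
  have hx : ∀ P ∈ irreducibles K n, 0 ≤ x P := fun P hP =>
    sub_nonneg.2 (one_le_euler_term hy ((isPrimeSet_irreducibles n).natDegree_pos hP))
  -- Expanding the product of the 1 + x(P) over P ∣ f into subsets of primes allows the sum over f
  -- to be carried out for each subset.
  have h1 : ∀ f ∈ monics K n, eulerFactor y (monicPrimeFactors f) =
      ∑ U ∈ (irreducibles K n).powerset, if ∀ P ∈ U, P ∣ f then ∏ P ∈ U, x P else 0 := by
    intro f hf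
    rw [eulerFactor, monicPrimeFactors, (mem_monics.1 hf).2, ← Finset.sum_filter]
    rw [show (∏ P ∈ irreducibles K n with P ∣ f, (1 - (y ^ P.natDegree)⁻¹)⁻¹) =
      ∏ P ∈ irreducibles K n with P ∣ f, (1 + x P) from
        Finset.prod_congr rfl fun P _ => by simp [x], Finset.prod_one_add]
    refine Finset.sum_congr ?_ fun _ _ => rfl
    ext U
    simp only [Finset.mem_powerset, Finset.mem_filter, Finset.subset_iff]
    exact ⟨fun h => ⟨fun P hP => (h hP).1, fun P hP => (h hP).2⟩, fun h P hP => ⟨h.1 hP, h.2 P hP⟩⟩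
  rw [Finset.sum_congr rfl h1, Finset.sum_comm]
  calc _ = ∑ U ∈ (irreducibles K n).powerset,
        (((monics K n).filter fun f => ∀ P ∈ U, P ∣ f).card : ℝ) * ∏ P ∈ U, x P := by
        refine Finset.sum_congr rfl fun U _ => ?_
        rw [← Finset.sum_filter, Finset.sum_const, nsmul_eq_mul]
    _ ≤ ∑ U ∈ (irreducibles K n).powerset, q ^ n * ∏ P ∈ U, (x P * (q ^ P.natDegree)⁻¹) := by
        refine Finset.sum_le_sum fun U hU => ?_
        rw [Finset.mem_powerset] at hU
        rw [Finset.prod_mul_distrib, mul_comm (∏ P ∈ U, x P), ← mul_assoc]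
        exact mul_le_mul_of_nonneg_right
          (card_filter_forall_dvd_le ((isPrimeSet_irreducibles n).mono hU))
          (Finset.prod_nonneg fun P hP => hx P (hU hP))
    _ = q ^ n * ∏ P ∈ irreducibles K n, (1 + x P * (q ^ P.natDegree)⁻¹) := by
        rw [← Finset.mul_sum, Finset.prod_one_add]
    _ ≤ q ^ n * Real.exp (y / (y - 1) ^ 2) := by
        refine mul_le_mul_of_nonneg_left ?_ (by positivity)
        have hnn : ∀ P ∈ irreducibles K n, 0 ≤ x P * (q ^ P.natDegree)⁻¹ :=
          fun P hP => mul_nonneg (hx P hP) (by positivity)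
        calc _ ≤ ∏ P ∈ irreducibles K n, Real.exp (x P * (q ^ P.natDegree)⁻¹) := by
              refine Finset.prod_le_prod (fun P hP => by have := hnn P hP; linarith) fun P _ => ?_
              rw [add_comm]
              exact Real.add_one_le_exp _
          _ = Real.exp (∑ P ∈ irreducibles K n, x P * (q ^ P.natDegree)⁻¹) :=
              (Real.exp_sum _ _).symm
          _ ≤ _ := by
            refine Real.exp_le_exp.2 (le_trans ?_ (sum_inv_pow_sub_one_le hy n))
            -- Group the primes by degree k + 1: there are at most q^(k+1) of them, which cancels
            -- the weight q^(-(k+1)) and leaves a bound free of q.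
            rw [← Finset.sum_fiberwise_of_maps_to (t := Finset.range n)
              (g := fun P : K[X] => P.natDegree - 1)]
            · refine Finset.sum_le_sum fun k _ => ?_
              calc _ ≤ ∑ P ∈ irreducibles K n with P.natDegree - 1 = k,
                    (q ^ (k + 1))⁻¹ * ((1 - (y ^ (k + 1))⁻¹)⁻¹ - 1) := by
                    refine Finset.sum_le_sum fun P hP => ?_
                    rw [Finset.mem_filter] at hP
                    have := (isPrimeSet_irreducibles n).natDegree_pos hP.1
                    rw [show k + 1 = P.natDegree by omega, mul_comm]
                _ ≤ q ^ (k + 1) * ((q ^ (k + 1))⁻¹ * ((1 - (y ^ (k + 1))⁻¹)⁻¹ - 1)) := by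
                    rw [Finset.sum_const, nsmul_eq_mul]
                    refine mul_le_mul_of_nonneg_right ?_ (mul_nonneg (by positivity)
                      (sub_nonneg.2 (one_le_euler_term hy (Nat.succ_pos k))))
                    have : ((irreducibles K n).filter fun P => P.natDegree - 1 = k).card ≤
                        (monics K (k + 1)).card := by
                      refine Finset.card_le_card fun P hP => ?_
                      rw [Finset.mem_filter] at hP
                      have := (isPrimeSet_irreducibles n).natDegree_pos hP.1
                      exact mem_monics.2 ⟨(mem_irreducibles.1 hP.1).1, by omega⟩
                    rw [card_monics] at this
                    rw [hqdef]
                    exact_mod_cast this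
                _ = _ := by
                    rw [← mul_assoc, mul_inv_cancel₀ (by positivity), one_mul]
            · intro P hP
              have := (isPrimeSet_irreducibles n).natDegree_pos hP
              have := (mem_irreducibles.1 hP).2.2
              exact Finset.mem_range.2 (by omega)
    _ = _ := mul_comm _ _

end EulerFactors

/-! ### Coprime square-free tuples, one coordinate at a time -/

section Tuples

variable {K : Type*} [Field K] [Fintype K] {ι : Type*} [Fintype ι]

/-- Tuples of pairwise coprime square-free monic polynomials of degrees `e`, not divisible by
any element of `T`. -/
noncomputable def coprimeTuples (T : Finset K[X]) (e : ι → ℕ) : Finset (ι → K[X]) :=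
  (Fintype.piFinset fun i => monics K (e i)).filter fun F =>
    (∀ i, Squarefree (F i)) ∧ (∀ i, ∀ P ∈ T, ¬ P ∣ F i) ∧ ∀ i j, i ≠ j → IsCoprime (F i) (F j)

theorem mem_coprimeTuples {T : Finset K[X]} {e : ι → ℕ} {F : ι → K[X]} :
    F ∈ coprimeTuples T e ↔ (∀ i, (F i).Monic ∧ (F i).natDegree = e i) ∧
      (∀ i, Squarefree (F i)) ∧ (∀ i, ∀ P ∈ T, ¬ P ∣ F i) ∧
        ∀ i j, i ≠ j → IsCoprime (F i) (F j) := by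
  simp only [coprimeTuples, Finset.mem_filter, Fintype.mem_piFinset, mem_monics]

/-- The primes to be avoided by a polynomial that extends the tuple `G`. -/
noncomputable def avoidSet (T : Finset K[X]) (G : ι → K[X]) : Finset K[X] :=
  T ∪ Finset.univ.biUnion fun i => monicPrimeFactors (G i)

theorem isPrimeSet_avoidSet {T : Finset K[X]} (hT : IsPrimeSet T) (G : ι → K[X]) :
    IsPrimeSet (avoidSet T G) := by
  intro P hP
  rcases Finset.mem_union.1 hP with h | h
  · exact hT P h
  · obtain ⟨i, -, hi⟩ := Finset.mem_biUnion.1 h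
    exact isPrimeSet_monicPrimeFactors _ P hi

/-- Degree 0 at j forces G j = 1, so G encodes the other coordinates alone; coprimality of f to them
amounts to avoiding their prime factors. -/
theorem update_mem_coprimeTuples_iff {T : Finset K[X]} {e : ι → ℕ} {j : ι} {G : ι → K[X]}
    (hG : G ∈ coprimeTuples T (Function.update e j 0)) {f : K[X]} :
    Function.update G j f ∈ coprimeTuples T e ↔
      f ∈ monics K (e j) ∧ Squarefree f ∧ ∀ P ∈ avoidSet T G, ¬ P ∣ f := by
  rw [mem_coprimeTuples] at hG ⊢
  obtain ⟨hG1, hG2, hG3, hG4⟩ := hG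
  have hj : G j = 1 := by
    have := hG1 j
    rw [Function.update_self] at this
    exact this.1.natDegree_eq_zero.1 this.2
  have hav : (∀ P ∈ avoidSet T G, ¬ P ∣ f) ↔ (∀ P ∈ T, ¬ P ∣ f) ∧ ∀ i, IsCoprime f (G i) := by
    simp only [avoidSet, Finset.mem_union, Finset.mem_biUnion, Finset.mem_univ, true_and]
    constructor
    · intro h
      exact ⟨fun P hP => h P (.inl hP), fun i =>
        (isCoprime_iff_monicPrimeFactors (hG1 i).1.ne_zero).2 fun P hP => h P (.inr ⟨i, hP⟩)⟩
    · rintro ⟨h1, h2⟩ P (hP | ⟨i, hi⟩)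
      · exact h1 P hP
      · exact (isCoprime_iff_monicPrimeFactors (hG1 i).1.ne_zero).1 (h2 i) P hi
  rw [hav, mem_monics]
  constructor
  · rintro ⟨h1, h2, h3, h4⟩
    have e1 := h1 j
    have e2 := h2 j
    have e3 := h3 j
    rw [Function.update_self] at e1 e2 e3
    refine ⟨e1, e2, e3, fun i => ?_⟩
    by_cases hi : i = j
    · rw [hi, hj]; exact isCoprime_one_right
    · have := h4 j i (Ne.symm hi)
      rwa [Function.update_self, Function.update_of_ne hi] at this
  · rintro ⟨h1, h2, h3, h4⟩
    refine ⟨fun i => ?_, fun i => ?_, fun i => ?_, fun i k hik => ?_⟩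
    · by_cases hi : i = j
      · subst hi; rwa [Function.update_self]
      · have := hG1 i
        rw [Function.update_of_ne hi] at this ⊢
        exact this
    · by_cases hi : i = j
      · subst hi; rwa [Function.update_self]
      · rw [Function.update_of_ne hi]; exact hG2 i
    · by_cases hi : i = j
      · subst hi; rwa [Function.update_self]
      · rw [Function.update_of_ne hi]; exact hG3 i
    · by_cases hi : i = j
      · subst hi
        rw [Function.update_self, Function.update_of_ne (Ne.symm hik)]
        exact h4 k
      · rw [Function.update_of_ne hi]
        by_cases hk : k = j
        · subst hk
          rw [Function.update_self]
          exact (h4 i).symm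
        · rw [Function.update_of_ne hk]
          exact hG4 i k hik

theorem update_one_mem_coprimeTuples {T : Finset K[X]} (hT : IsPrimeSet T) {e : ι → ℕ} {j : ι}
    {F : ι → K[X]} (hF : F ∈ coprimeTuples T e) :
    Function.update F j 1 ∈ coprimeTuples T (Function.update e j 0) := by
  rw [mem_coprimeTuples] at hF ⊢
  obtain ⟨h1, h2, h3, h4⟩ := hF
  refine ⟨fun i => ?_, fun i => ?_, fun i => ?_, fun i k hik => ?_⟩
  · by_cases hi : i = j
    · subst hi; simp
    · rw [Function.update_of_ne hi, Function.update_of_ne hi]; exact h1 i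
  · by_cases hi : i = j
    · subst hi; simp
    · rw [Function.update_of_ne hi]; exact h2 i
  · by_cases hi : i = j
    · subst hi
      rw [Function.update_self]
      exact fun P hP hd => (hT P hP).2.not_isUnit (isUnit_of_dvd_one hd)
    · rw [Function.update_of_ne hi]; exact h3 i
  · by_cases hi : i = j
    · subst hi; rw [Function.update_self]; exact isCoprime_one_left
    · by_cases hk : k = j
      · subst hk; rw [Function.update_self]; exact isCoprime_one_right
      · rw [Function.update_of_ne hi, Function.update_of_ne hk]; exact h4 i k hik

/-- Fibre the tuples by replacing the j-th coordinate with 1. Each fibre is a square-free count with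
avoided primes, to which the one-variable estimates apply. -/
theorem card_filter_coprimeTuples {T : Finset K[X]} (hT : IsPrimeSet T) (e : ι → ℕ) (j : ι)
    (A : (ι → K[X]) → Prop) :
    ((coprimeTuples T e).filter A).card =
      ∑ G ∈ coprimeTuples T (Function.update e j 0),
        sqfreeCount (avoidSet T G) (e j) fun f => A (Function.update G j f) := by
  rw [Finset.card_eq_sum_card_fiberwise (f := fun F => Function.update F j 1)
    (t := coprimeTuples T (Function.update e j 0))]
  · refine Finset.sum_congr rfl fun G hG => ?_
    have hGj : Function.update G j 1 = G := by
      have := (mem_coprimeTuples.1 hG).1 j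
      rw [Function.update_self] at this
      rw [← this.1.natDegree_eq_zero.1 this.2, Function.update_eq_self]
    refine Finset.card_bij (fun F _ => F j) ?_ ?_ ?_
    · intro F hF
      simp only [Finset.mem_filter] at hF ⊢
      obtain ⟨⟨hF, hA⟩, rfl⟩ := hF
      have hup : Function.update (Function.update F j 1) j (F j) = F := by simp
      have := (update_mem_coprimeTuples_iff hG (f := F j)).1 (hup.symm ▸ hF)
      exact ⟨this.1, this.2.1, this.2.2, by rwa [hup]⟩
    · intro F hF F' hF' h
      simp only [Finset.mem_filter] at hF hF'
      funext i
      by_cases hi : i = j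
      · rw [hi, h]
      · have := congrFun (hF.2.trans hF'.2.symm) i
        rwa [Function.update_of_ne hi, Function.update_of_ne hi] at this
    · intro f hf
      simp only [Finset.mem_filter] at hf
      refine ⟨Function.update G j f, ?_, by simp⟩
      simp only [Finset.mem_filter]
      exact ⟨⟨(update_mem_coprimeTuples_iff hG).2 ⟨hf.1, hf.2.1, hf.2.2.1⟩, hf.2.2.2⟩,
        by rw [Function.update_idem, hGj]⟩
  · intro F hF
    exact update_one_mem_coprimeTuples hT (Finset.mem_filter.1 hF).1

/-- All Euler factors are positive, so coprimality and square-freeness can be dropped; the sum then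
splits into one average per coordinate. -/
theorem sum_eulerFactor_avoidSet_le {y : ℝ} (hy : 1 < y) {T : Finset K[X]} (hT : IsPrimeSet T)
    (e : ι → ℕ) :
    ∑ G ∈ coprimeTuples T e, eulerFactor y (avoidSet T G) ≤
      eulerFactor y T * Real.exp (y / (y - 1) ^ 2) ^ Fintype.card ι *
        (Fintype.card K : ℝ) ^ ∑ i, e i := by
  have hT1 := one_le_eulerFactor hy hT
  have hpos : ∀ f : K[X], 0 ≤ eulerFactor y (monicPrimeFactors f) := fun f =>
    zero_le_one.trans (one_le_eulerFactor hy (isPrimeSet_monicPrimeFactors f))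
  calc _ ≤ ∑ G ∈ coprimeTuples T e,
        eulerFactor y T * ∏ i, eulerFactor y (monicPrimeFactors (G i)) := by
        refine Finset.sum_le_sum fun G _ => ?_
        have h := eulerFactor_biUnion_le hy Finset.univ
          (fun i => isPrimeSet_monicPrimeFactors (G i))
        exact (eulerFactor_union_le hy hT h.1).trans
          (mul_le_mul_of_nonneg_left h.2 (by linarith))
    _ ≤ ∑ G ∈ Fintype.piFinset fun i => monics K (e i),
        eulerFactor y T * ∏ i, eulerFactor y (monicPrimeFactors (G i)) := by
        refine Finset.sum_le_sum_of_subset_of_nonneg (Finset.filter_subset _ _) fun G _ _ => ?_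
        exact mul_nonneg (by linarith) (Finset.prod_nonneg fun i _ => hpos _)
    _ = eulerFactor y T * ∏ i, ∑ f ∈ monics K (e i), eulerFactor y (monicPrimeFactors f) := by
        rw [← Finset.mul_sum, Finset.prod_univ_sum]
    _ ≤ eulerFactor y T *
        ∏ i, (Real.exp (y / (y - 1) ^ 2) * (Fintype.card K : ℝ) ^ e i) := by
        refine mul_le_mul_of_nonneg_left ?_ (by linarith)
        exact Finset.prod_le_prod (fun i _ => Finset.sum_nonneg fun f _ => hpos f)
          fun i _ => sum_eulerFactor_monicPrimeFactors_le hy _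
    _ = _ := by
        rw [Finset.prod_mul_distrib, Finset.prod_const, Finset.prod_pow_eq_pow_sum,
          Finset.card_univ, mul_assoc]

/-- Lowering the j-th degree by one leaves the other coordinates alone, so this is
`abs_sqfreeDiff_le` summed over them. -/
theorem abs_card_coprimeTuples_sub_le {y : ℝ} (hy : 1 < y) {T : Finset K[X]} (hT : IsPrimeSet T)
    (e : ι → ℕ) (j : ι) (hj : e j ≠ 0) :
    |((coprimeTuples T e).card : ℝ) -
        Fintype.card K * (coprimeTuples T (Function.update e j (e j - 1))).card| ≤
      Fintype.card K * (eulerFactor y T * Real.exp (y / (y - 1) ^ 2) ^ Fintype.card ι *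
        (Fintype.card K : ℝ) ^ ∑ i, Function.update e j 0 i) * y ^ e j := by
  have h1 := card_filter_coprimeTuples hT e j fun _ => True
  have h2 := card_filter_coprimeTuples hT (Function.update e j (e j - 1)) j fun _ => True
  rw [Finset.filter_true] at h1 h2
  rw [Function.update_idem, Function.update_self] at h2
  rw [h1, h2]
  push_cast
  rw [Finset.mul_sum, ← Finset.sum_sub_distrib]
  calc _ = |∑ G ∈ coprimeTuples T (Function.update e j 0), sqfreeDiff (avoidSet T G) (e j)| := by
        simp only [sqfreeDiff, if_neg hj]
    _ ≤ ∑ G ∈ coprimeTuples T (Function.update e j 0), |sqfreeDiff (avoidSet T G) (e j)| :=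
        Finset.abs_sum_le_sum_abs _ _
    _ ≤ ∑ G ∈ coprimeTuples T (Function.update e j 0),
          Fintype.card K * eulerFactor y (avoidSet T G) * y ^ e j :=
        Finset.sum_le_sum fun G _ => abs_sqfreeDiff_le hy (isPrimeSet_avoidSet hT G) _
    _ = Fintype.card K * (∑ G ∈ coprimeTuples T (Function.update e j 0),
          eulerFactor y (avoidSet T G)) * y ^ e j := by
        rw [Finset.mul_sum, Finset.sum_mul]
    _ ≤ _ := by
        have := sum_eulerFactor_avoidSet_le hy hT (Function.update e j 0)
        gcongr

theorem abs_card_filter_coprimeTuples_sub_le {l : ℕ} (hs : 1 < √(Fintype.card K : ℝ))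
    {T : Finset K[X]} (hT : IsPrimeSet T) (e : ι → ℕ) (j : ι) {A B : (ι → K[X]) → Prop}
    (h : ∀ G : ι → K[X], EquallyFrequent l (fun f => A (Function.update G j f))
      (fun f => B (Function.update G j f))) :
    |(((coprimeTuples T e).filter A).card : ℝ) - ((coprimeTuples T e).filter B).card| ≤
      l * √(Fintype.card K : ℝ) ^ l * (eulerFactor √(Fintype.card K : ℝ) T *
        Real.exp (√(Fintype.card K : ℝ) / (√(Fintype.card K : ℝ) - 1) ^ 2) ^ Fintype.card ι *
        (Fintype.card K : ℝ) ^ ∑ i, Function.update e j 0 i) * √(Fintype.card K : ℝ) ^ e j := by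
  rw [card_filter_coprimeTuples hT e j A, card_filter_coprimeTuples hT e j B]
  push_cast
  rw [← Finset.sum_sub_distrib]
  refine (Finset.abs_sum_le_sum_abs _ _).trans ?_
  refine (Finset.sum_le_sum fun G _ =>
    abs_sqfreeCount_sub_le hs (isPrimeSet_avoidSet hT G) (e j) (h G)).trans ?_
  rw [← Finset.sum_mul, ← Finset.mul_sum]
  have := sum_eulerFactor_avoidSet_le hs hT (Function.update e j 0)
  gcongr

end Tuples

/-! ### From single steps in the degrees to arbitrary changes -/

section Telescoping

variable {ι : Type*}

/-- The difference θ^n - θ^(n+m) is kept in the bound so that the induction telescopes: one step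
costs at most κ θ^(n+m), which is exactly the increment of the right side. -/
theorem abs_update_sub_le_of_step {f : (ι → ℕ) → ℝ} {κ θ : ℝ} (hθ : 0 < θ) (hθ1 : θ < 1)
    (h : ∀ e j, e j ≠ 0 → |f e - f (Function.update e j (e j - 1))| ≤ κ * θ ^ e j) (e : ι → ℕ)
    (j : ι) (n m : ℕ) :
    |f (Function.update e j (n + m)) - f (Function.update e j n)| ≤
      κ / (1 - θ) * (θ ^ n - θ ^ (n + m)) := by
  have h1 : 0 < 1 - θ := sub_pos.2 hθ1
  induction m with
  | zero => simp
  | succ m ih =>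
    have hs := h (Function.update e j (n + (m + 1))) j (by simp)
    rw [Function.update_self, Function.update_idem, show n + (m + 1) - 1 = n + m by omega] at hs
    have heq : κ * θ ^ (n + (m + 1)) ≤ κ / (1 - θ) * (θ ^ (n + m) - θ ^ (n + (m + 1))) := by
      have hκ : 0 ≤ κ := by
        have := (abs_nonneg _).trans hs
        have hp : 0 < θ ^ (n + (m + 1)) := by positivity
        exact nonneg_of_mul_nonneg_left this hp
      have : κ / (1 - θ) * (θ ^ (n + m) - θ ^ (n + (m + 1))) = κ * θ ^ (n + m) := by
        rw [← add_assoc, pow_succ]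
        field_simp
      rw [this]
      exact mul_le_mul_of_nonneg_left (pow_le_pow_of_le_one hθ.le hθ1.le (by omega)) hκ
    calc _ ≤ _ := abs_sub_le _ (f (Function.update e j (n + m))) _
      _ ≤ κ / (1 - θ) * (θ ^ (n + m) - θ ^ (n + (m + 1))) +
          κ / (1 - θ) * (θ ^ n - θ ^ (n + m)) := add_le_add (hs.trans heq) ih
      _ = _ := by ring

variable [Fintype ι]

/-- The coordinates are moved from e to d one after another, through the hybrids `s.piecewise d e`.
-/
theorem abs_sub_le_of_step {f : (ι → ℕ) → ℝ} {κ θ : ℝ} (hκ : 0 ≤ κ) (hθ : 0 < θ) (hθ1 : θ < 1)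
    (h : ∀ e j, e j ≠ 0 → |f e - f (Function.update e j (e j - 1))| ≤ κ * θ ^ e j)
    {e d : ι → ℕ} (hed : e ≤ d) : |f d - f e| ≤ κ / (1 - θ) * ∑ j, θ ^ e j := by
  have h1 : 0 < 1 - θ := sub_pos.2 hθ1
  have key : ∀ s : Finset ι, |f (s.piecewise d e) - f e| ≤ κ / (1 - θ) * ∑ j ∈ s, θ ^ e j := by
    intro s
    induction s using Finset.induction_on with
    | empty => simp
    | insert j s hjs ih =>
      rw [Finset.piecewise_insert, Finset.sum_insert hjs, mul_add]
      have hj := abs_update_sub_le_of_step hθ hθ1 h (s.piecewise d e) j (e j) (d j - e j)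
      rw [Nat.add_sub_cancel' (hed j)] at hj
      have hself : Function.update (s.piecewise d e) j (e j) = s.piecewise d e := by
        rw [Function.update_eq_self_iff, Finset.piecewise_eq_of_notMem _ _ _ hjs]
      rw [hself] at hj
      refine (abs_sub_le _ (f (s.piecewise d e)) _).trans (add_le_add (hj.trans ?_) ih)
      refine mul_le_mul_of_nonneg_left ?_ (by positivity)
      exact sub_le_self _ (by positivity)
  simpa using key Finset.univ

end Telescoping

/-! ### Equidistribution of character values by interpolation -/

section Characters

variable {K : Type*} [Field K]

/-- Since p is prime, any value of χ other than 1 at a unit is a primitive p-th root of unity, and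
its powers are values as well. -/
theorem MulChar.exists_eq_of_pow_eq_one {p : ℕ} (hp : p.Prime) {χ : MulChar K ℂ}
    (hχ : orderOf χ = p) {z : ℂ} (hz : z ^ p = 1) : ∃ u : K, χ u = z := by
  have hne : χ ≠ 1 := by
    rintro rfl
    rw [orderOf_one] at hχ
    exact hp.one_lt.ne hχ
  obtain ⟨a, ha⟩ := MulChar.ne_one_iff.1 hne
  have hpow : χ a ^ p = 1 := by
    rw [← MulChar.pow_apply_coe, ← hχ, pow_orderOf_eq_one, MulChar.one_apply_coe]
  have hprim : IsPrimitiveRoot (χ a) p := by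
    have : Fact p.Prime := ⟨hp⟩
    rw [← orderOf_eq_prime hpow ha]
    exact IsPrimitiveRoot.orderOf _
  have : NeZero p := ⟨hp.ne_zero⟩
  obtain ⟨i, -, hi⟩ := hprim.eq_pow_of_pow_eq_one hz
  exact ⟨(a : K) ^ i, by rw [map_pow, hi]⟩

theorem MulChar.pow_eq_one_of_ne_zero {p : ℕ} {χ : MulChar K ℂ}
    (hχ : orderOf χ = p) {u : K} (hu : u ≠ 0) : χ u ^ p = 1 := by
  have := MulChar.pow_apply_coe χ p (Units.mk0 u hu)
  rw [Units.val_mk0] at this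
  rw [← this, ← hχ, pow_orderOf_eq_one]
  exact MulChar.one_apply (IsUnit.mk0 u hu)

variable [Fintype K]

/-- Choose u(a) with χ(u(a)) = η'(a)/η(a) and add to f the interpolant of (u - 1) f on S. Its degree
is below |S| ≤ n, so f stays monic of degree n while f(a) becomes u(a) f(a). This injects one set
into the other, and the roles of η and η' can be exchanged. -/
theorem equallyFrequent_char {p : ℕ} (hp : p ≠ 0) (χ : MulChar K ℂ)
    (hχ : ∀ z : ℂ, z ^ p = 1 → ∃ u : K, χ u = z) (S : Finset K) (c : K → K) {η η' : K → ℂ}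
    (hη : ∀ a ∈ S, η a ^ p = 1) (hη' : ∀ a ∈ S, η' a ^ p = 1) :
    EquallyFrequent S.card (fun f : K[X] => ∀ a ∈ S, χ (c a * f.eval a) = η a)
      (fun f => ∀ a ∈ S, χ (c a * f.eval a) = η' a) := by
  intro g _ n hn
  have aux : ∀ {η η' : K → ℂ}, (∀ a ∈ S, η a ^ p = 1) → (∀ a ∈ S, η' a ^ p = 1) →
      ((monics K n).filter fun f => ∀ a ∈ S, χ (c a * (g * f).eval a) = η a).card ≤
      ((monics K n).filter fun f => ∀ a ∈ S, χ (c a * (g * f).eval a) = η' a).card := by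
    intro η η' hη hη'
    have hne : ∀ {z : ℂ}, z ^ p = 1 → z ≠ 0 := by
      rintro z hz rfl
      rw [zero_pow hp] at hz
      exact zero_ne_one hz
    have hu : ∀ a, ∃ u : K, a ∈ S → χ u = η' a / η a := by
      intro a
      by_cases ha : a ∈ S
      · obtain ⟨u, hu⟩ := hχ (η' a / η a) (by rw [div_pow, hη a ha, hη' a ha, div_one])
        exact ⟨u, fun _ => hu⟩
      · exact ⟨0, fun h => absurd h ha⟩
    choose u hu using hu
    have hu0 : ∀ a ∈ S, u a ≠ 0 := by
      intro a ha h0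
      have := hu a ha
      rw [h0, MulChar.map_zero] at this
      exact div_ne_zero (hne (hη' a ha)) (hne (hη a ha)) this.symm
    have hinj : Set.InjOn (id : K → K) S := Function.injective_id.injOn
    let I : K[X] → K[X] := fun f => Lagrange.interpolate S id fun a => (u a - 1) * f.eval a
    have hI : ∀ f, ∀ a ∈ S, (f + I f).eval a = u a * f.eval a := by
      intro f a ha
      have := Lagrange.eval_interpolate_at_node (fun a => (u a - 1) * f.eval a) hinj ha
      rw [eval_add]
      simp only [id] at this
      rw [show (I f).eval a = _ from this]
      ring
    have hIdeg : ∀ f, (I f).degree < (n : WithBot ℕ) := fun f =>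
      (Lagrange.degree_interpolate_lt _ hinj).trans_le (by exact_mod_cast hn)
    refine Finset.card_le_card_of_injOn (fun f => f + I f) ?_ ?_
    · intro f hf
      rw [Finset.mem_coe, Finset.mem_filter, mem_monics] at hf ⊢
      obtain ⟨⟨hm, hd⟩, hA⟩ := hf
      have hfd : f.degree = n := by rw [degree_eq_natDegree hm.ne_zero, hd]
      have hlt : (I f).degree < f.degree := hfd ▸ hIdeg f
      refine ⟨⟨hm.add_of_left hlt, ?_⟩, fun a ha => ?_⟩
      · rw [natDegree_add_eq_left_of_degree_lt hlt, hd]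
      · have h1 := hA a ha
        rw [eval_mul] at h1 ⊢
        rw [hI f a ha, show c a * (g.eval a * (u a * f.eval a)) =
          u a * (c a * (g.eval a * f.eval a)) by ring, map_mul, h1, hu a ha,
          div_mul_cancel₀ _ (hne (hη a ha))]
    -- Since u(a) ≠ 0, the image determines f on S, hence the interpolant, hence f.
    · intro f _ f' _ h
      have hval : ∀ a ∈ S, f.eval a = f'.eval a := by
        intro a ha
        have := congrArg (eval a) h
        simp only [hI _ a ha] at this
        exact mul_left_cancel₀ (hu0 a ha) this
      have hII : I f = I f' := by
        refine Lagrange.interpolate_eq_of_values_eq_on _ _ fun a ha => ?_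
        rw [hval a ha]
      simpa [hII] using h
  convert le_antisymm (aux hη hη') (aux hη' hη)

end Characters

/-! ### Vanishing patterns and reduction to tuples without roots -/

section VanishingPatterns

/-- The number of points that the pattern `τ` assigns to the index `i`. -/
noncomputable def vanishDegree {K ι : Type*} [Fintype K] (τ : K → Option ι) (i : ι) : ℕ :=
  (Finset.univ.filter fun a => τ a = some i).card

theorem sum_vanishDegree {K ι : Type*} [Fintype K] [Fintype ι] (τ : K → Option ι) :
    ∑ i, vanishDegree τ i = (Finset.univ.filter fun a => τ a ≠ none).card := by
  rw [Finset.card_eq_sum_card_fiberwise (f := τ)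
    (t := Finset.univ.image some) fun a ha => by
      obtain ⟨i, hi⟩ := Option.ne_none_iff_exists'.1 (Finset.mem_filter.1 ha).2
      simp [hi]]
  rw [Finset.sum_image fun _ _ _ _ h => Option.some_injective _ h]
  refine Finset.sum_congr rfl fun i _ => ?_
  rw [vanishDegree, Finset.filter_filter]
  congr 1
  refine Finset.filter_congr fun a _ => ⟨fun h => ⟨by simp [h], h⟩, fun h => h.2⟩


variable {K : Type*} [Field K] {ι : Type*}

/-- `τ a = some i` precisely when `F i` vanishes at `a`. -/
def HasPattern (F : ι → K[X]) (τ : K → Option ι) : Prop :=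
  ∀ a i, τ a = some i ↔ (F i).eval a = 0

theorem HasPattern.unique {F : ι → K[X]} {τ σ : K → Option ι} (hτ : HasPattern F τ)
    (hσ : HasPattern F σ) : τ = σ := by
  funext a
  ext i
  exact (hτ a i).trans (hσ a i).symm

variable [Fintype K]

/-- The monic linear polynomials. -/
noncomputable def linears (K : Type*) [Field K] [Fintype K] : Finset K[X] :=
  Finset.univ.image fun a : K => X - C a

theorem isPrimeSet_linears : IsPrimeSet (linears K) := by
  intro P hP
  obtain ⟨a, -, rfl⟩ := Finset.mem_image.1 hP
  exact ⟨monic_X_sub_C a, irreducible_X_sub_C a⟩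

theorem eulerFactor_linears (y : ℝ) :
    eulerFactor y (linears K) = ((1 - y⁻¹)⁻¹) ^ Fintype.card K := by
  rw [eulerFactor, linears, Finset.prod_image]
  · simp
  · intro a _ b _ h
    exact C_injective (sub_right_injective h)

theorem forall_linears_not_dvd_iff {f : K[X]} :
    (∀ P ∈ linears K, ¬ P ∣ f) ↔ ∀ a, f.eval a ≠ 0 := by
  simp [linears, dvd_iff_isRoot]

/-- The product of the linear factors that the pattern `τ` assigns to the index `i`. -/
noncomputable def vanishFactor (τ : K → Option ι) (i : ι) : K[X] :=
  ∏ a with τ a = some i, (X - C a)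

theorem vanishFactor_monic (τ : K → Option ι) (i : ι) : (vanishFactor τ i).Monic :=
  monic_prod_of_monic _ _ fun a _ => monic_X_sub_C a

theorem natDegree_vanishFactor (τ : K → Option ι) (i : ι) :
    (vanishFactor τ i).natDegree = vanishDegree τ i := by
  rw [vanishFactor, natDegree_prod_of_monic _ _ fun a _ => monic_X_sub_C a]
  simp [vanishDegree]

theorem eval_vanishFactor_eq_zero_iff (τ : K → Option ι) (i : ι) (a : K) :
    (vanishFactor τ i).eval a = 0 ↔ τ a = some i := by
  rw [vanishFactor, eval_prod, Finset.prod_eq_zero_iff]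
  constructor
  · rintro ⟨b, hb, h⟩
    rw [eval_sub, eval_X, eval_C, sub_eq_zero] at h
    rw [h]
    exact (Finset.mem_filter.1 hb).2
  · intro h
    exact ⟨a, by simpa using h, by simp⟩

theorem isCoprime_vanishFactor {τ : K → Option ι} {i : ι} {g : K[X]}
    (hg : ∀ a, τ a = some i → g.eval a ≠ 0) : IsCoprime (vanishFactor τ i) g := by
  refine IsCoprime.prod_left fun a ha => ?_
  refine ((irreducible_X_sub_C a).coprime_iff_not_dvd).2 fun h => ?_
  exact hg a (Finset.mem_filter.1 ha).2 (dvd_iff_isRoot.1 h)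

theorem squarefree_vanishFactor (τ : K → Option ι) (i : ι) : Squarefree (vanishFactor τ i) := by
  refine Finset.squarefree_prod_of_pairwise_isCoprime ?_ fun a _ =>
    (irreducible_X_sub_C a).squarefree
  intro a _ b _ hab
  exact (isCoprime_X_sub_C_of_isUnit_sub (sub_ne_zero.2 hab).isUnit).isRelPrime

theorem vanishFactor_mul_mem {τ : K → Option ι} [Fintype ι] {d : ι → ℕ} (hd : vanishDegree τ ≤ d)
    {F : ι → K[X]} (hF : F ∈ coprimeTuples (linears K) (d - vanishDegree τ)) :
    vanishFactor τ * F ∈ coprimeTuples ∅ d ∧ HasPattern (vanishFactor τ * F) τ := by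
  rw [mem_coprimeTuples] at hF ⊢
  simp only [forall_linears_not_dvd_iff] at hF
  obtain ⟨h1, h2, h3, h4⟩ := hF
  refine ⟨⟨fun i => ?_, fun i => ?_, fun i P hP => absurd hP (Finset.notMem_empty P),
    fun i j hij => ?_⟩, fun a i => ?_⟩
  · refine ⟨(vanishFactor_monic τ i).mul (h1 i).1, ?_⟩
    rw [Pi.mul_apply, (vanishFactor_monic τ i).natDegree_mul (h1 i).1, natDegree_vanishFactor,
      (h1 i).2, Pi.sub_apply]
    exact Nat.add_sub_cancel' (hd i)
  · rw [Pi.mul_apply, squarefree_mul_iff]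
    exact ⟨(isCoprime_vanishFactor fun a _ => h3 i a).isRelPrime, squarefree_vanishFactor τ i, h2 i⟩
  · rw [Pi.mul_apply, Pi.mul_apply]
    have hcop : ∀ i j, IsCoprime (vanishFactor τ i) (F j) := fun i j =>
      isCoprime_vanishFactor fun a _ => h3 j a
    refine IsCoprime.mul_left (IsCoprime.mul_right ?_ (hcop i j))
      (IsCoprime.mul_right (hcop j i).symm (h4 i j hij))
    refine isCoprime_vanishFactor fun a ha h0 => hij ?_
    rw [eval_vanishFactor_eq_zero_iff, ha] at h0
    exact Option.some_injective _ h0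
  · rw [Pi.mul_apply, eval_mul, mul_eq_zero, eval_vanishFactor_eq_zero_iff]
    exact ⟨.inl, fun h => h.resolve_right (h3 i a)⟩

/-- Square-freeness makes the cofactor prime to the linear factors already removed, so no prescribed
root is a root twice; the pattern lists all roots, so the cofactor has none. -/
theorem exists_eq_vanishFactor_mul {τ : K → Option ι} [Fintype ι] {d : ι → ℕ}
    {F : ι → K[X]} (hF : F ∈ coprimeTuples (∅ : Finset K[X]) d) (hτ : HasPattern F τ) :
    vanishDegree τ ≤ d ∧ ∃ G ∈ coprimeTuples (linears K) (d - vanishDegree τ),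
      F = vanishFactor τ * G := by
  rw [mem_coprimeTuples] at hF
  obtain ⟨h1, h2, -, h4⟩ := hF
  have hdvd : ∀ i, vanishFactor τ i ∣ F i := by
    intro i
    refine Finset.prod_dvd_of_coprime ?_ fun a ha => ?_
    · intro a _ b _ hab
      exact isCoprime_X_sub_C_of_isUnit_sub (sub_ne_zero.2 hab).isUnit
    · exact dvd_iff_isRoot.2 ((hτ a i).1 (Finset.mem_filter.1 ha).2)
  choose G hG using hdvd
  have hm : ∀ i, (G i).Monic := fun i =>
    (vanishFactor_monic τ i).of_mul_monic_left (hG i ▸ (h1 i).1)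
  have hdeg : ∀ i, vanishDegree τ i + (G i).natDegree = d i := by
    intro i
    rw [← (h1 i).2, hG i, (vanishFactor_monic τ i).natDegree_mul (hm i), natDegree_vanishFactor]
  have hsq : ∀ i, IsCoprime (vanishFactor τ i) (G i) ∧ Squarefree (G i) := by
    intro i
    have := h2 i
    rw [hG i, squarefree_mul_iff] at this
    exact ⟨this.1.isCoprime, this.2.2⟩
  refine ⟨fun i => Nat.le.intro (hdeg i), G, ?_, funext hG⟩
  rw [mem_coprimeTuples]
  refine ⟨fun i => ⟨hm i, ?_⟩, fun i => (hsq i).2, fun i => ?_, fun i j hij => ?_⟩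
  · have := hdeg i
    rw [Pi.sub_apply]
    omega
  · rw [forall_linears_not_dvd_iff]
    intro a ha
    have hL : (vanishFactor τ i).eval a = 0 := by
      rw [eval_vanishFactor_eq_zero_iff, hτ a i, hG i, eval_mul, ha, mul_zero]
    obtain ⟨u, v, huv⟩ := (hsq i).1
    have := congrArg (eval a) huv
    simp [hL, ha] at this
  · have := h4 i j hij
    rw [hG i, hG j] at this
    exact this.of_mul_left_right.of_mul_right_right

theorem card_filter_hasPattern [Fintype ι] (τ : K → Option ι) (d : ι → ℕ)
    (A : (ι → K[X]) → Prop) :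
    ((coprimeTuples (∅ : Finset K[X]) d).filter fun F => HasPattern F τ ∧ A F).card =
      if vanishDegree τ ≤ d then ((coprimeTuples (linears K) (d - vanishDegree τ)).filter
        fun F => A (vanishFactor τ * F)).card else 0 := by
  split_ifs with hd
  · symm
    refine Finset.card_bij (fun F _ => vanishFactor τ * F) ?_ ?_ ?_
    · intro F hF
      rw [Finset.mem_filter] at hF ⊢
      have := vanishFactor_mul_mem hd hF.1
      exact ⟨this.1, this.2, hF.2⟩
    · intro F _ G _ h
      funext i
      exact mul_left_cancel₀ (vanishFactor_monic τ i).ne_zero (congrFun h i)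
    · intro F hF
      rw [Finset.mem_filter] at hF
      obtain ⟨-, G, hG, rfl⟩ := exists_eq_vanishFactor_mul hF.1 hF.2.1
      exact ⟨G, by rw [Finset.mem_filter]; exact ⟨hG, hF.2.2⟩, rfl⟩
  · rw [Finset.card_eq_zero, Finset.filter_eq_empty_iff]
    rintro F hF ⟨hτ, -⟩
    exact hd (exists_eq_vanishFactor_mul hF hτ).1

/-- Coprime polynomials have no common root, so at each point at most one coordinate vanishes. -/
theorem exists_hasPattern [Fintype ι] {d : ι → ℕ} {F : ι → K[X]}
    (hF : F ∈ coprimeTuples (∅ : Finset K[X]) d) : ∃ τ : K → Option ι, HasPattern F τ := by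
  have h4 := (mem_coprimeTuples.1 hF).2.2.2
  have : ∀ a, ∃ o : Option ι, ∀ i, o = some i ↔ (F i).eval a = 0 := by
    intro a
    by_cases h : ∃ i, (F i).eval a = 0
    · obtain ⟨i, hi⟩ := h
      refine ⟨some i, fun j => ⟨fun h => ?_, fun hj => ?_⟩⟩
      · rwa [← Option.some_injective _ h]
      · by_contra hne
        obtain ⟨u, v, huv⟩ := h4 i j fun h => hne (h ▸ rfl)
        have := congrArg (eval a) huv
        simp [hi, hj] at this
    · exact ⟨none, fun i => ⟨fun h => (Option.some_ne_none _ h.symm).elim,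
        fun hi => (h ⟨i, hi⟩).elim⟩⟩
  choose τ hτ using this
  exact ⟨τ, hτ⟩

/-- The central decomposition: summing over patterns leaves only tuples avoiding all linear primes,
for which every pattern has the same shape of count with shifted degrees. -/
theorem card_filter_coprimeTuples_eq_sum [Fintype ι] (d : ι → ℕ) (A : (ι → K[X]) → Prop) :
    ((coprimeTuples (∅ : Finset K[X]) d).filter A).card = ∑ τ : K → Option ι,
      if vanishDegree τ ≤ d then ((coprimeTuples (linears K) (d - vanishDegree τ)).filter
        fun F => A (vanishFactor τ * F)).card else 0 := by
  -- The default pattern is never used on coprime tuples, because they all have a pattern.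
  let π : (ι → K[X]) → (K → Option ι) := fun F =>
    if h : ∃ τ, HasPattern F τ then h.choose else fun _ => none
  rw [Finset.card_eq_sum_card_fiberwise (f := π) (t := Finset.univ) fun _ _ => by simp]
  refine Finset.sum_congr rfl fun τ _ => ?_
  rw [← card_filter_hasPattern, Finset.filter_filter]
  congr 1
  refine Finset.filter_congr fun F hF => ?_
  have hex := exists_hasPattern hF
  have hπ : π F = hex.choose := dif_pos hex
  constructor
  · rintro ⟨hA, rfl⟩
    exact ⟨hπ ▸ hex.choose_spec, hA⟩
  · rintro ⟨hτ, hA⟩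
    exact ⟨hA, hπ ▸ hex.choose_spec.unique hτ⟩

end VanishingPatterns

/-! ### Polynomials of the family and tuples -/

section Family

variable {K : Type*} [Field K] {ι : Type*} [Fintype ι]

/-- The product of the powers `G i ^ k i`. -/
noncomputable def prodPow (k : ι → ℕ) (G : ι → K[X]) : K[X] := ∏ i, G i ^ k i

/-- P divides G i exactly once and is prime to the other coordinates, so its multiplicity in the
product is k i. -/
theorem pow_dvd_prodPow_iff {k : ι → ℕ} {G : ι → K[X]} (hsq : ∀ i, Squarefree (G i))
    (hcop : ∀ i j, i ≠ j → IsCoprime (G i) (G j)) {P : K[X]} (hP : Irreducible P) {i : ι}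
    (hPi : P ∣ G i) (n : ℕ) : P ^ n ∣ prodPow k G ↔ n ≤ k i := by
  rw [prodPow, ← Finset.mul_prod_erase _ _ (Finset.mem_univ i)]
  have hR : IsCoprime P (∏ j ∈ Finset.univ.erase i, G j ^ k j) :=
    IsCoprime.prod_right fun j hj =>
      ((hcop i j (Finset.ne_of_mem_erase hj).symm).of_isCoprime_of_dvd_left hPi).pow_right
  obtain ⟨u, hu⟩ := hPi
  have hPu : IsCoprime P u := by
    have := hsq i
    rw [hu, squarefree_mul_iff] at this
    exact this.1.isCoprime
  constructor
  · intro h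
    have h1 : P ^ n ∣ G i ^ k i := hR.pow_left.dvd_of_dvd_mul_right h
    rw [hu, mul_pow] at h1
    have h2 : P ^ n ∣ P ^ k i := (hPu.pow (m := n) (n := k i)).dvd_of_dvd_mul_right h1
    exact (pow_dvd_pow_iff hP.ne_zero hP.not_isUnit).1 h2
  · intro h
    refine Dvd.dvd.mul_right ?_ _
    exact (pow_dvd_pow _ h).trans (pow_dvd_pow_of_dvd ⟨u, hu⟩ _)

variable [Fintype K]

/-- The multiplicity of a prime in the product tells in which coordinate it lies, because the
exponents are distinct. -/
theorem prodPow_injOn {k : ι → ℕ} (hk : Function.Injective k) (hk0 : ∀ i, k i ≠ 0)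
    (d : ι → ℕ) :
    Set.InjOn (prodPow (K := K) k) (coprimeTuples (∅ : Finset K[X]) d) := by
  have aux : ∀ {G H : ι → K[X]}, G ∈ coprimeTuples (∅ : Finset K[X]) d →
      H ∈ coprimeTuples (∅ : Finset K[X]) d → prodPow k G = prodPow k H → ∀ i, G i ∣ H i := by
    intro G H hG hH h i
    rw [mem_coprimeTuples] at hG hH
    obtain ⟨g1, g2, -, g4⟩ := hG
    obtain ⟨h1, h2, -, h4⟩ := hH
    have hcross : ∀ j, j ≠ i → IsCoprime (G i) (H j) := by
      intro j hj
      refine isCoprime_of_irreducible_dvd (fun h0 => (g1 i).1.ne_zero h0.1) fun P hP hPi hPj => ?_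
      have e1 := fun n => pow_dvd_prodPow_iff (k := k) g2 g4 hP hPi n
      have e2 := fun n => pow_dvd_prodPow_iff (k := k) h2 h4 hP hPj n
      rw [h] at e1
      exact hj (hk (le_antisymm ((e1 _).1 ((e2 _).2 le_rfl)) ((e2 _).1 ((e1 _).2 le_rfl))))
    have hdvd : G i ∣ prodPow k H := by
      rw [← h]
      exact (dvd_pow_self _ (hk0 i)).trans
        (Finset.dvd_prod_of_mem (fun i => G i ^ k i) (Finset.mem_univ i))
    rw [prodPow, ← Finset.mul_prod_erase _ _ (Finset.mem_univ i)] at hdvd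
    have hR : IsCoprime (G i) (∏ j ∈ Finset.univ.erase i, H j ^ k j) :=
      IsCoprime.prod_right fun j hj => (hcross j (Finset.ne_of_mem_erase hj)).pow_right
    exact ((g2 i).dvd_pow_iff_dvd (hk0 i)).1 (hR.dvd_of_dvd_mul_right hdvd)
  intro G hG H hH h
  funext i
  exact eq_of_monic_of_associated ((mem_coprimeTuples.1 hG).1 i).1
    ((mem_coprimeTuples.1 hH).1 i).1
    (associated_of_dvd_dvd (aux hG hH h i) (aux hH hG h.symm i))

theorem polyFamily_eq_image (r : ℕ) (d : ℕ → ℕ) :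
    polyFamily K r d = prodPow (fun i : Finset.Icc 1 r => (i : ℕ)) ''
      (coprimeTuples (∅ : Finset K[X]) fun i : Finset.Icc 1 r => d i) := by
  ext F
  simp only [polyFamily, Set.mem_image, Finset.mem_coe, mem_coprimeTuples]
  constructor
  · rintro ⟨G, h1, h2, rfl⟩
    refine ⟨fun i => G i, ⟨fun i => ⟨(h1 i i.2).1, (h1 i i.2).2.2⟩, fun i => (h1 i i.2).2.1,
      fun i P hP => absurd hP (Finset.notMem_empty P), fun i j hij =>
        h2 i i.2 j j.2 fun h => hij (Subtype.ext h)⟩, ?_⟩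
    exact (Finset.prod_coe_sort (Finset.Icc 1 r) fun i => G i ^ i)
  · rintro ⟨G, ⟨h1, h2, -, h4⟩, rfl⟩
    refine ⟨fun i => if h : i ∈ Finset.Icc 1 r then G ⟨i, h⟩ else 1, ?_, ?_, ?_⟩
    · intro i hi
      simp only [dif_pos hi]
      exact ⟨(h1 ⟨i, hi⟩).1, h2 _, (h1 ⟨i, hi⟩).2⟩
    · intro i hi j hj hij
      simp only [dif_pos hi, dif_pos hj]
      exact h4 _ _ fun h => hij (congrArg Subtype.val h)
    · rw [prodPow, ← Finset.prod_coe_sort (Finset.Icc 1 r)]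
      refine Finset.prod_congr rfl fun i _ => ?_
      simp only [dif_pos i.2]

theorem ncard_polyFamily_filter (r : ℕ) (d : ℕ → ℕ) (A : K[X] → Prop) :
    {F ∈ polyFamily K r d | A F}.ncard =
      ((coprimeTuples (∅ : Finset K[X]) fun i : Finset.Icc 1 r => d i).filter
        fun G => A (prodPow (fun i : Finset.Icc 1 r => (i : ℕ)) G)).card := by
  rw [← Set.ncard_coe_finset, polyFamily_eq_image, ← Set.InjOn.ncard_image
    (f := prodPow (fun i : Finset.Icc 1 r => (i : ℕ)))]
  · congr 1
    ext F
    simp only [Set.mem_ofPred_eq, Set.mem_image, Finset.coe_filter, Finset.mem_coe]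
    constructor
    · rintro ⟨⟨G, hG, rfl⟩, hA⟩
      exact ⟨G, ⟨hG, hA⟩, rfl⟩
    · rintro ⟨G, ⟨hG, hA⟩, rfl⟩
      exact ⟨⟨G, hG, rfl⟩, hA⟩
  · have hk0 : ∀ i : Finset.Icc 1 r, (i : ℕ) ≠ 0 := fun i => by
      have := (Finset.mem_Icc.1 i.2).1
      omega
    exact (prodPow_injOn Subtype.val_injective hk0 fun i => d i).mono
      (Finset.coe_subset.2 (Finset.filter_subset _ _))

end Family

/-! ### Sieving by small primes and a union bound over large ones -/

section LowerBound

variable {K : Type*} [Field K] [Fintype K]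

/-- The monic polynomials of degree `n` not divisible by any element of `T`. -/
noncomputable def roughs (T : Finset K[X]) (n : ℕ) : Finset K[X] :=
  (monics K n).filter fun f => ∀ P ∈ T, ¬ P ∣ f

theorem mem_roughs {T : Finset K[X]} {n : ℕ} {f : K[X]} :
    f ∈ roughs T n ↔ (f.Monic ∧ f.natDegree = n) ∧ ∀ P ∈ T, ¬ P ∣ f := by
  rw [roughs, Finset.mem_filter, mem_monics]

theorem card_roughs_le (T : Finset K[X]) (n : ℕ) :
    ((roughs T n).card : ℝ) ≤ (Fintype.card K : ℝ) ^ n := by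
  have := Finset.card_filter_le (monics K n) fun f => ∀ P ∈ T, ¬ P ∣ f
  rw [card_monics] at this
  exact_mod_cast this

/-- Multiplicity is allowed here, so the multiples of P are counted by T and not by `insert P T`:
avoiding P multiplies the generating series by 1 - u^(deg P). -/
theorem card_roughs_insert {T : Finset K[X]} (hT : IsPrimeSet T) {P : K[X]} (hP : P.Monic)
    (hP' : Irreducible P) (hPT : P ∉ T) (n : ℕ) :
    (roughs T n).card = (roughs (insert P T) n).card +
      if P.natDegree ≤ n then (roughs T (n - P.natDegree)).card else 0 := by
  have key : ∀ f : K[X], (∀ Q ∈ T, ¬ Q ∣ P * f) ↔ ∀ Q ∈ T, ¬ Q ∣ f := by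
    intro f
    refine forall₂_congr fun Q hQ => not_congr ⟨fun h => ?_, fun h => h.mul_left _⟩
    rcases (hT Q hQ).2.prime.dvd_or_dvd h with h | h
    · exact absurd (eq_of_dvd_of_irreducible (hT Q hQ).1 (hT Q hQ).2 hP hP' h ▸ hQ) hPT
    · exact h
  have h := card_filter_dvd hP n fun f => ∀ Q ∈ T, ¬ Q ∣ f
  simp only [key] at h
  unfold roughs
  rw [← h, ← Finset.card_filter_add_card_filter_not (s := (monics K n).filter fun f =>
    ∀ P ∈ T, ¬ P ∣ f) (fun f => ¬ P ∣ f)]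
  simp only [Finset.filter_filter, not_not, Finset.forall_mem_insert]
  congr 2 <;> · ext f; simp only [Finset.mem_filter]; tauto

/-- Once n is at least the degree of the product of all primes in T, no term of the
inclusion–exclusion is truncated and the sieve is exact. -/
theorem card_roughs_eq {T : Finset K[X]} (hT : IsPrimeSet T) {n : ℕ}
    (hn : ∑ P ∈ T, P.natDegree ≤ n) :
    ((roughs T n).card : ℝ) =
      (Fintype.card K : ℝ) ^ n * ∏ P ∈ T, (1 - ((Fintype.card K : ℝ) ^ P.natDegree)⁻¹) := by
  have hq : (0 : ℝ) < Fintype.card K := by exact_mod_cast Fintype.card_pos (α := K)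
  induction T using Finset.induction_on generalizing n with
  | empty => simp [roughs, card_monics]
  | insert P T hPT ih =>
    have hT' := hT.mono (Finset.subset_insert P T)
    have hP := hT P (Finset.mem_insert_self _ _)
    rw [Finset.sum_insert hPT] at hn
    have h := congrArg (Nat.cast (R := ℝ)) (card_roughs_insert hT' hP.1 hP.2 hPT n)
    rw [if_pos (by omega)] at h
    push_cast at h
    rw [ih hT' (by omega), ih hT' (by omega), pow_sub₀ _ hq.ne' (by omega)] at h
    rw [Finset.prod_insert hPT]
    linear_combination -h

variable {ι : Type*} [Fintype ι]

/-- The degrees absorbed by a polynomial of degree `k` at the positions `i` and `j`. -/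
noncomputable def pairDegree (i j : ι) (k : ℕ) (l : ι) : ℕ :=
  (if l = i then k else 0) + if l = j then k else 0

theorem sum_pairDegree (i j : ι) (k : ℕ) : ∑ l, pairDegree i j k l = 2 * k := by
  simp [pairDegree, Finset.sum_add_distrib, two_mul]

/-- A tuple fails because some prime P divides two coordinates or its square divides one. The
product of two conditionals covers both cases, i = j being the square. Roughness forces deg P > y,
and the cofactors remain rough. -/
theorem exists_mul_of_not_mem_coprimeTuples {y : ℕ} {d : ι → ℕ} {F : ι → K[X]}
    (hF : ∀ l, F l ∈ roughs (irreducibles K y) (d l))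
    (hbad : F ∉ coprimeTuples (∅ : Finset K[X]) d) :
    ∃ (i j : ι) (P : K[X]) (G : ι → K[X]), P.Monic ∧ y < P.natDegree ∧
      pairDegree i j P.natDegree ≤ d ∧
      (∀ l, G l ∈ roughs (irreducibles K y) (d l - pairDegree i j P.natDegree l)) ∧
      F = fun l => ((if l = i then P else 1) * if l = j then P else 1) * G l := by
  simp only [mem_roughs] at hF
  have hfac : ∃ (i j : ι) (P : K[X]), P.Monic ∧ Irreducible P ∧
      ∀ l, ((if l = i then P else 1) * if l = j then P else 1) ∣ F l := by
    by_contra hno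
    push Not at hno
    refine hbad (mem_coprimeTuples.2 ⟨fun l => (hF l).1, fun i => ?_,
      fun i P hP => absurd hP (Finset.notMem_empty P), fun i j hij => ?_⟩)
    · rw [squarefree_iff_irreducible_sq_not_dvd_of_ne_zero (hF i).1.1.ne_zero]
      intro P hP hd
      obtain ⟨Q, hQ, hQ', ha⟩ := exists_monic_irreducible_associated hP
      obtain ⟨l, hl⟩ := hno i i Q hQ hQ'
      by_cases h : l = i
      · subst h
        simp only [if_true] at hl
        exact hl ((ha.mul_mul ha).symm.dvd.trans hd)
      · simp [h] at hl
    · refine isCoprime_of_irreducible_dvd (fun h0 => (hF i).1.1.ne_zero h0.1)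
        fun P hP hPi hPj => ?_
      obtain ⟨Q, hQ, hQ', ha⟩ := exists_monic_irreducible_associated hP
      obtain ⟨l, hl⟩ := hno i j Q hQ hQ'
      by_cases h : l = i
      · subst h
        simp only [if_true, if_neg hij, mul_one] at hl
        exact hl (ha.symm.dvd.trans hPi)
      · by_cases h' : l = j
        · subst h'
          simp only [if_true, if_neg h, one_mul] at hl
          exact hl (ha.symm.dvd.trans hPj)
        · simp [h, h'] at hl
  obtain ⟨i, j, P, hP, hP', hd⟩ := hfac
  choose G hG using hd
  have hm : ∀ l, ((if l = i then P else 1) * if l = j then P else 1 : K[X]).Monic := by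
    intro l
    refine Monic.mul ?_ ?_ <;> split_ifs <;> first | exact hP | exact monic_one
  have hmd : ∀ l, ((if l = i then P else 1) * if l = j then P else 1 : K[X]).natDegree =
      pairDegree i j P.natDegree l := by
    intro l
    unfold pairDegree
    split_ifs <;> simp [hP.natDegree_mul hP]
  have hGm : ∀ l, (G l).Monic := fun l => (hm l).of_mul_monic_left (hG l ▸ (hF l).1.1)
  have hdeg : ∀ l, pairDegree i j P.natDegree l + (G l).natDegree = d l := by
    intro l
    rw [← (hF l).1.2, hG l, (hm l).natDegree_mul (hGm l), hmd]
  refine ⟨i, j, P, G, hP, ?_, fun l => Nat.le.intro (hdeg l), fun l => mem_roughs.2 ⟨⟨hGm l, ?_⟩,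
    fun Q hQ hd => ?_⟩, funext hG⟩
  · by_contra hlt
    refine (hF i).2 P (mem_irreducibles.2 ⟨hP, hP', not_lt.1 hlt⟩) ?_
    rw [hG i, if_pos rfl, mul_assoc]
    exact dvd_mul_right _ _
  · have := hdeg l
    omega
  · refine (hF l).2 Q hQ ?_
    rw [hG l]
    exact hd.mul_left _

/-- Union bound for the failing tuples over the positions i, j and the degree k of the repeated
factor, which is only remembered as one of the q^k monics. -/
theorem prod_card_roughs_le (y : ℕ) (d : ι → ℕ) :
    ∏ l, (roughs (irreducibles K y) (d l)).card ≤
      (coprimeTuples (∅ : Finset K[X]) d).card +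
      ∑ i : ι, ∑ j : ι, ∑ k ∈ Finset.Ioc y (∑ l, d l),
        if pairDegree i j k ≤ d then Fintype.card K ^ k *
          ∏ l, (roughs (irreducibles K y) (d l - pairDegree i j k l)).card else 0 := by
  rw [← Fintype.card_piFinset]
  let B : ι → ι → ℕ → Finset (ι → K[X]) := fun i j k =>
    if pairDegree i j k ≤ d then
      (monics K k ×ˢ Fintype.piFinset fun l =>
        roughs (irreducibles K y) (d l - pairDegree i j k l)).image
      fun x l => ((if l = i then x.1 else 1) * if l = j then x.1 else 1) * x.2 l
    else ∅
  have hB : ∀ i j k, (B i j k).card ≤ if pairDegree i j k ≤ d then Fintype.card K ^ k *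
      ∏ l, (roughs (irreducibles K y) (d l - pairDegree i j k l)).card else 0 := by
    intro i j k
    simp only [B]
    split_ifs
    · refine Finset.card_image_le.trans ?_
      rw [Finset.card_product, card_monics, Fintype.card_piFinset]
    · simp
  have hsub : (Fintype.piFinset fun l => roughs (irreducibles K y) (d l)) ⊆
      coprimeTuples (∅ : Finset K[X]) d ∪ Finset.univ.biUnion fun i => Finset.univ.biUnion fun j =>
        (Finset.Ioc y (∑ l, d l)).biUnion fun k => B i j k := by
    intro F hF
    rw [Fintype.mem_piFinset] at hF
    rw [Finset.mem_union]
    by_cases hgood : F ∈ coprimeTuples (∅ : Finset K[X]) d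
    · exact .inl hgood
    · obtain ⟨i, j, P, G, hP, hy, hle, hG, rfl⟩ := exists_mul_of_not_mem_coprimeTuples hF hgood
      right
      simp only [Finset.mem_biUnion, Finset.mem_univ, true_and]
      refine ⟨i, j, P.natDegree, Finset.mem_Ioc.2 ⟨hy, ?_⟩, ?_⟩
      · have h1 := hle i
        have h2 : d i ≤ ∑ l, d l := Finset.single_le_sum (fun _ _ => Nat.zero_le _)
          (Finset.mem_univ i)
        simp only [pairDegree, if_true] at h1
        omega
      · simp only [B, if_pos hle]
        refine Finset.mem_image.2 ⟨(P, G), ?_, rfl⟩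
        rw [Finset.mem_product, Fintype.mem_piFinset]
        exact ⟨mem_monics.2 ⟨hP, rfl⟩, hG⟩
  refine (Finset.card_le_card hsub).trans ((Finset.card_union_le _ _).trans ?_)
  refine Nat.add_le_add_left (Finset.card_biUnion_le.trans (Finset.sum_le_sum fun i _ => ?_)) _
  refine Finset.card_biUnion_le.trans (Finset.sum_le_sum fun j _ => ?_)
  exact Finset.card_biUnion_le.trans (Finset.sum_le_sum fun k _ => hB i j k)

theorem sum_Ioc_inv_pow_le {q : ℝ} (hq : 2 ≤ q) (y N : ℕ) :
    ∑ k ∈ Finset.Ioc y N, (q ^ k)⁻¹ ≤ 2 / q * (q ^ y)⁻¹ := by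
  have hq0 : 0 < q := by linarith
  have h : ∀ m, ∑ k ∈ Finset.Ioc y (y + m), (q ^ k)⁻¹ ≤
      2 / q * ((q ^ y)⁻¹ - (q ^ (y + m))⁻¹) := by
    intro m
    induction m with
    | zero => simp
    | succ m ih =>
      rw [← add_assoc, Finset.sum_Ioc_succ_top (by omega)]
      have hw : 0 < (q ^ (y + m))⁻¹ := by positivity
      have : (q ^ (y + m + 1))⁻¹ = (q ^ (y + m))⁻¹ * q⁻¹ := by rw [pow_succ, mul_inv]
      rw [this]
      have h2 : (q ^ (y + m))⁻¹ * q⁻¹ ≤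
          2 / q * ((q ^ (y + m))⁻¹ - (q ^ (y + m))⁻¹ * q⁻¹) := by
        have h3 : q⁻¹ ≤ 1 / 2 := by
          rw [inv_eq_one_div]
          exact one_div_le_one_div_of_le (by norm_num) hq
        have h4 : 0 < q⁻¹ := by positivity
        rw [div_eq_mul_inv]
        have : (0 : ℝ) ≤ (q ^ (y + m))⁻¹ * q⁻¹ * (1 - 2 * q⁻¹) := by
          apply mul_nonneg (by positivity); linarith
        nlinarith
      linarith
  rcases le_total N y with hN | hN
  · rw [Finset.Ioc_eq_empty_of_le hN, Finset.sum_empty]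
    positivity
  · obtain ⟨m, rfl⟩ := Nat.exists_eq_add_of_le hN
    refine (h m).trans (mul_le_mul_of_nonneg_left (sub_le_self _ (by positivity)) (by positivity))

end LowerBound

/-! ### Positive density of coprime tuples -/

section Density

variable {K : Type*} [Field K] [Fintype K] {ι : Type*} [Fintype ι]

theorem two_le_card_field : (2 : ℝ) ≤ Fintype.card K := by
  exact_mod_cast Fintype.one_lt_card (α := K)

theorem pow_mul_pow_sum_sub_pairDegree {d : ι → ℕ} {i j : ι} {k : ℕ} (h : pairDegree i j k ≤ d)
    {q : ℝ} (hq : 0 < q) :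
    q ^ k * q ^ ∑ l, (d l - pairDegree i j k l) = q ^ (∑ l, d l) * (q ^ k)⁻¹ := by
  have hs : ∑ l, (d l - pairDegree i j k l) + 2 * k = ∑ l, d l := by
    rw [← sum_pairDegree i j k, ← Finset.sum_add_distrib]
    exact Finset.sum_congr rfl fun l _ => Nat.sub_add_cancel (h l)
  rw [← hs, pow_add, two_mul, pow_add]
  field_simp

theorem pair_term_le {y : ℕ} {d : ι → ℕ} {i j : ι} {k : ℕ} (h : pairDegree i j k ≤ d) :
    (Fintype.card K : ℝ) ^ k *
      ∏ l, ((roughs (irreducibles K y) (d l - pairDegree i j k l)).card : ℝ) ≤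
      (Fintype.card K : ℝ) ^ (∑ l, d l) * ((Fintype.card K : ℝ) ^ k)⁻¹ := by
  have hq : (0 : ℝ) < Fintype.card K := by exact_mod_cast Fintype.card_pos (α := K)
  rw [← pow_mul_pow_sum_sub_pairDegree h hq]
  refine mul_le_mul_of_nonneg_left ?_ (by positivity)
  rw [← Finset.prod_pow_eq_pow_sum]
  exact Finset.prod_le_prod (fun l _ => by positivity) fun l _ => card_roughs_le _ _

theorem prod_card_roughs_le_real (y : ℕ) (d : ι → ℕ) :
    ∏ l, ((roughs (irreducibles K y) (d l)).card : ℝ) ≤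
      (coprimeTuples (∅ : Finset K[X]) d).card +
      ∑ i : ι, ∑ j : ι, ∑ k ∈ Finset.Ioc y (∑ l, d l),
        if pairDegree i j k ≤ d then (Fintype.card K : ℝ) ^ k *
          ∏ l, ((roughs (irreducibles K y) (d l - pairDegree i j k l)).card : ℝ) else 0 := by
  exact_mod_cast prod_card_roughs_le (K := K) y d

/-- With no sieving (y = 0), each of the r² pairs loses a proportion at most Σ_(k ≥ 1) q^(-k) ≤ 2/q,
and 2r²/q ≤ 1/2. -/
theorem half_le_card_coprimeTuples (hq : 4 * Fintype.card ι ^ 2 ≤ Fintype.card K) (d : ι → ℕ) :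
    1 / 2 * (Fintype.card K : ℝ) ^ (∑ l, d l) ≤ (coprimeTuples (∅ : Finset K[X]) d).card := by
  have h2 := two_le_card_field (K := K)
  have hq' : 4 * (Fintype.card ι : ℝ) ^ 2 ≤ Fintype.card K := by exact_mod_cast hq
  have h := prod_card_roughs_le_real (K := K) 0 d
  have hT : irreducibles K 0 = ∅ := by
    refine Finset.eq_empty_of_forall_notMem fun P hP => ?_
    have h1 := (isPrimeSet_irreducibles 0).natDegree_pos hP
    have h2 := (mem_irreducibles.1 hP).2.2
    omega
  have hl : ∏ l, ((roughs (irreducibles K 0) (d l)).card : ℝ) =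
      (Fintype.card K : ℝ) ^ ∑ l, d l := by
    rw [← Finset.prod_pow_eq_pow_sum]
    refine Finset.prod_congr rfl fun l _ => ?_
    rw [hT]
    simp [roughs, card_monics]
  rw [hl] at h
  set q : ℝ := (Fintype.card K : ℝ)
  have hsum : ∀ i j : ι, (∑ k ∈ Finset.Ioc 0 (∑ l, d l), if pairDegree i j k ≤ d then q ^ k *
      ∏ l, ((roughs (irreducibles K 0) (d l - pairDegree i j k l)).card : ℝ) else 0) ≤
      q ^ (∑ l, d l) * (2 / q) := by
    intro i j
    have := sum_Ioc_inv_pow_le h2 0 (∑ l, d l)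
    rw [pow_zero, inv_one, mul_one] at this
    refine le_trans ?_ (mul_le_mul_of_nonneg_left this (by positivity))
    rw [Finset.mul_sum]
    refine Finset.sum_le_sum fun k _ => ?_
    split_ifs with hk
    · exact pair_term_le hk
    · positivity
  have hs := Finset.sum_le_sum fun i (_ : i ∈ Finset.univ) =>
    Finset.sum_le_sum fun j (_ : j ∈ Finset.univ) => hsum i j
  simp only [Finset.sum_const, Finset.card_univ, nsmul_eq_mul] at hs
  have hq0 : 0 < q := by linarith
  have hr : (Fintype.card ι : ℝ) * (Fintype.card ι * (q ^ (∑ l, d l) * (2 / q))) ≤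
      1 / 2 * q ^ (∑ l, d l) := by
    have hp : 0 < q ^ (∑ l, d l) := by positivity
    rw [show (Fintype.card ι : ℝ) * (Fintype.card ι * (q ^ (∑ l, d l) * (2 / q))) =
      (4 * (Fintype.card ι : ℝ) ^ 2 / q) * (1 / 2) * q ^ (∑ l, d l) by ring]
    refine mul_le_mul_of_nonneg_right ?_ hp.le
    have : 4 * (Fintype.card ι : ℝ) ^ 2 / q ≤ 1 := (div_le_one hq0).2 hq'
    linarith
  linarith

theorem card_irreducibles_le (y : ℕ) {Q : ℕ} (hQ : Fintype.card K ≤ Q) :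
    (irreducibles K y).card ≤ (y + 1) * Q ^ y := by
  refine Finset.card_biUnion_le.trans ?_
  calc _ ≤ ∑ _n ∈ Finset.range (y + 1), Q ^ y := by
        refine Finset.sum_le_sum fun n hn => ?_
        refine (Finset.card_filter_le _ _).trans ?_
        rw [card_monics]
        refine (Nat.pow_le_pow_left hQ n).trans (Nat.pow_le_pow_right ?_ ?_)
        · exact Fintype.card_pos.trans_le hQ
        · have := Finset.mem_range.1 hn
          omega
    _ = _ := by simp

theorem half_pow_le_prod_irreducibles (y : ℕ) {B : ℕ} (hB : (irreducibles K y).card ≤ B) :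
    (1 / 2 : ℝ) ^ B ≤
      ∏ P ∈ irreducibles K y, (1 - ((Fintype.card K : ℝ) ^ P.natDegree)⁻¹) := by
  have h2 := two_le_card_field (K := K)
  calc (1 / 2 : ℝ) ^ B ≤ (1 / 2 : ℝ) ^ (irreducibles K y).card :=
        pow_le_pow_of_le_one (by norm_num) (by norm_num) hB
    _ = ∏ _P ∈ irreducibles K y, (1 / 2 : ℝ) := by simp
    _ ≤ _ := by
      refine Finset.prod_le_prod (fun _ _ => by norm_num) fun P hP => ?_
      have hd := (isPrimeSet_irreducibles y).natDegree_pos hP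
      have : (2 : ℝ) ≤ (Fintype.card K : ℝ) ^ P.natDegree :=
        h2.trans (le_self_pow₀ (by linarith) hd.ne')
      have h3 : ((Fintype.card K : ℝ) ^ P.natDegree)⁻¹ ≤ 1 / 2 := by
        rw [inv_eq_one_div]
        exact one_div_le_one_div_of_le (by norm_num) this
      linarith

/-- Split the union bound at K₀. For k ≤ K₀ the remaining degrees are still at least L, so the sieve
is exact and the loss carries the factor ρ^r of the main term. For k > K₀ the trivial count is used,
and the tail can be made small against ρ^r by the choice of K₀. -/
theorem rough_density_le {y L K₀ : ℕ} (hL : ∑ P ∈ irreducibles K y, P.natDegree ≤ L) {d : ι → ℕ}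
    (hd : ∀ l, L + 2 * K₀ ≤ d l) {ρ : ℝ}
    (hρ : ρ = ∏ P ∈ irreducibles K y, (1 - ((Fintype.card K : ℝ) ^ P.natDegree)⁻¹))
    (hρ0 : 0 ≤ ρ) :
    (Fintype.card K : ℝ) ^ (∑ l, d l) * ρ ^ Fintype.card ι ≤
      (coprimeTuples (∅ : Finset K[X]) d).card + (Fintype.card ι : ℝ) ^ 2 *
        ((Fintype.card K : ℝ) ^ (∑ l, d l) *
          (ρ ^ Fintype.card ι * (1 / 2) ^ y + (1 / 2) ^ K₀)) := by
  have h2 := two_le_card_field (K := K)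
  have h := prod_card_roughs_le_real (K := K) y d
  have hrough : ∀ n, L ≤ n → ((roughs (irreducibles K y) n).card : ℝ) =
      (Fintype.card K : ℝ) ^ n * ρ := fun n hn => by
    rw [hρ]
    exact card_roughs_eq (isPrimeSet_irreducibles y) (hL.trans hn)
  set q : ℝ := (Fintype.card K : ℝ)
  have hq0 : 0 < q := by linarith
  have hprod : ∀ e : ι → ℕ, (∀ l, L ≤ e l) →
      ∏ l, ((roughs (irreducibles K y) (e l)).card : ℝ) =
        q ^ (∑ l, e l) * ρ ^ Fintype.card ι := by
    intro e he
    rw [Finset.prod_congr rfl fun l _ => hrough _ (he l), Finset.prod_mul_distrib,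
      Finset.prod_pow_eq_pow_sum, Finset.prod_const, Finset.card_univ]
  rw [hprod d fun l => le_trans (Nat.le_add_right _ _) (hd l)] at h
  have htail : ∀ y N : ℕ, ∑ k ∈ Finset.Ioc y N, (q ^ k)⁻¹ ≤ (1 / 2) ^ y := by
    intro y N
    refine (sum_Ioc_inv_pow_le h2 y N).trans ?_
    have h3 : 2 / q ≤ 1 := (div_le_one hq0).2 h2
    have h4 : (q ^ y)⁻¹ ≤ (1 / 2) ^ y := by
      rw [← inv_pow]
      refine pow_le_pow_left₀ (by positivity) ?_ y
      rw [inv_eq_one_div]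
      exact one_div_le_one_div_of_le (by norm_num) h2
    calc 2 / q * (q ^ y)⁻¹ ≤ 1 * (q ^ y)⁻¹ := mul_le_mul_of_nonneg_right h3 (by positivity)
      _ ≤ _ := by rwa [one_mul]
  have hsum : ∀ i j : ι, (∑ k ∈ Finset.Ioc y (∑ l, d l), if pairDegree i j k ≤ d then q ^ k *
      ∏ l, ((roughs (irreducibles K y) (d l - pairDegree i j k l)).card : ℝ) else 0) ≤
      q ^ (∑ l, d l) * (ρ ^ Fintype.card ι * (1 / 2) ^ y + (1 / 2) ^ K₀) := by
    intro i j
    calc _ ≤ ∑ k ∈ Finset.Ioc y (∑ l, d l), (q ^ (∑ l, d l) * ρ ^ Fintype.card ι * (q ^ k)⁻¹ +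
          if K₀ < k then q ^ (∑ l, d l) * (q ^ k)⁻¹ else 0) := by
          refine Finset.sum_le_sum fun k _ => ?_
          split_ifs with h1 h3 h3
          · exact (pair_term_le h1).trans (le_add_of_nonneg_left (by positivity))
          · rw [hprod, ← mul_assoc, pow_mul_pow_sum_sub_pairDegree h1 hq0, add_zero]
            · exact le_of_eq (by ring)
            · intro l
              have h4 := hd l
              have h5 : pairDegree i j k l ≤ 2 * k := by
                unfold pairDegree
                split_ifs <;> omega
              omega
          · positivity
          · positivity
      _ ≤ q ^ (∑ l, d l) * ρ ^ Fintype.card ι * (1 / 2) ^ y +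
          q ^ (∑ l, d l) * (1 / 2) ^ K₀ := by
          rw [Finset.sum_add_distrib, ← Finset.mul_sum]
          refine add_le_add (mul_le_mul_of_nonneg_left (htail _ _) (by positivity)) ?_
          rw [← Finset.sum_filter, ← Finset.mul_sum]
          refine mul_le_mul_of_nonneg_left (le_trans ?_ (htail K₀ (∑ l, d l))) (by positivity)
          refine Finset.sum_le_sum_of_subset_of_nonneg (fun k hk => ?_) fun _ _ _ => by positivity
          rw [Finset.mem_filter, Finset.mem_Ioc] at hk
          exact Finset.mem_Ioc.2 ⟨hk.2, hk.1.2⟩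
      _ = _ := by ring
  have hs := Finset.sum_le_sum fun i (_ : i ∈ Finset.univ) =>
    Finset.sum_le_sum fun j (_ : j ∈ Finset.univ) => hsum i j
  simp only [Finset.sum_const, Finset.card_univ, nsmul_eq_mul] at hs
  rw [← mul_assoc, ← sq] at hs
  linarith

end Density

universe u

/-- Over finite fields of bounded size, the tuples of large degrees have positive density. -/
theorem exists_density_lower_bound (ι : Type*) [Fintype ι] (Q : ℕ) :
    ∃ (c : ℝ) (L : ℕ), 0 < c ∧ ∀ (K : Type u) [Field K] [Fintype K], Fintype.card K ≤ Q →
      ∀ d : ι → ℕ, (∀ l, L ≤ d l) →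
        c * (Fintype.card K : ℝ) ^ (∑ l, d l) ≤ (coprimeTuples (∅ : Finset K[X]) d).card := by
  set r := Fintype.card ι with hr
  -- Since y < 2^y, this gives r² (1/2)^y ≤ 1/2, so repeated primes of degree in (y, K₀] remove at
  -- most half of the rough tuples.
  set y := 2 * r ^ 2 with hy
  set B := (y + 1) * Q ^ y with hB
  set β : ℝ := ((1 / 2) ^ B) ^ r with hβ
  have hβ0 : 0 < β := by positivity
  -- Here β is a lower bound for ρ^r, uniform over the fields in question. The tail beyond K₀ costs
  -- at most β/4, leaving ρ^r - ρ^r/2 - β/4 ≥ β/4.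
  obtain ⟨K₀, hK₀⟩ := exists_pow_lt_of_lt_one (x := β / (4 * ((r : ℝ) ^ 2 + 1))) (y := 1 / 2)
    (by positivity) (by norm_num)
  refine ⟨β / 4, y * B + 2 * K₀, by positivity, fun K _ _ hK d hd => ?_⟩
  have hcard := card_irreducibles_le (K := K) y hK
  have hL : ∑ P ∈ irreducibles K y, P.natDegree ≤ y * B := by
    refine (Finset.sum_le_card_nsmul _ _ y fun P hP => (mem_irreducibles.1 hP).2.2).trans ?_
    rw [smul_eq_mul, mul_comm]
    exact Nat.mul_le_mul_left _ hcard
  have hρ := half_pow_le_prod_irreducibles (K := K) y hcard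
  obtain ⟨ρ, hρdef⟩ : ∃ ρ, ρ = ∏ P ∈ irreducibles K y,
    (1 - ((Fintype.card K : ℝ) ^ P.natDegree)⁻¹) := ⟨_, rfl⟩
  rw [← hρdef] at hρ
  have hρ0 : 0 ≤ ρ := le_trans (by positivity) hρ
  have h := rough_density_le hL hd hρdef hρ0
  have hβρ : β ≤ ρ ^ r := pow_le_pow_left₀ (by positivity) hρ r
  have hy1 : (r : ℝ) ^ 2 * (1 / 2) ^ y ≤ 1 / 2 := by
    have : (y : ℝ) < 2 ^ y := by exact_mod_cast Nat.lt_two_pow_self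
    rw [hy] at this
    push_cast at this
    rw [one_div, inv_pow, ← div_eq_mul_inv, div_le_iff₀ (by positivity)]
    rw [hy]
    linarith
  have hK1 : (r : ℝ) ^ 2 * (1 / 2) ^ K₀ ≤ β / 4 := by
    have h1 : (r : ℝ) ^ 2 * (1 / 2) ^ K₀ ≤ ((r : ℝ) ^ 2 + 1) * (β / (4 * ((r : ℝ) ^ 2 + 1))) :=
      mul_le_mul (by linarith) hK₀.le (by positivity) (by positivity)
    refine h1.trans (le_of_eq ?_)
    field_simp
  set X : ℝ := (Fintype.card K : ℝ) ^ (∑ l, d l)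
  have hX : 0 ≤ X := by positivity
  rw [← hr] at h
  have e1 : ρ ^ r * ((r : ℝ) ^ 2 * (1 / 2) ^ y) ≤ ρ ^ r * (1 / 2) :=
    mul_le_mul_of_nonneg_left hy1 (by positivity)
  have e2 : X * (ρ ^ r - ρ ^ r * ((r : ℝ) ^ 2 * (1 / 2) ^ y) - (r : ℝ) ^ 2 * (1 / 2) ^ K₀) ≥
      X * (β / 4) := mul_le_mul_of_nonneg_left (by linarith) hX
  nlinarith

/-! ### Density of all tuples in terms of rootless ones -/

section Asymptotics

theorem inv_pow_sum_vanishDegree {K ι : Type*} [Fintype K] [Fintype ι] {q : ℝ} (τ : K → Option ι) :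
    (q ^ ∑ i, vanishDegree τ i)⁻¹ = ∏ a, if τ a = none then 1 else q⁻¹ := by
  rw [sum_vanishDegree, Finset.prod_ite, Finset.prod_const_one, one_mul, Finset.prod_const,
    inv_pow]

/-- The weight of a pattern is a product over points; each point contributes 1 for `none` and 1/q
for each of the r indices. -/
theorem sum_inv_pow_sum_vanishDegree {K ι : Type*} [Fintype K] [Fintype ι] {q : ℝ} :
    ∑ τ : K → Option ι, (q ^ ∑ i, vanishDegree τ i)⁻¹ =
      (1 + Fintype.card ι / q) ^ Fintype.card K := by
  simp only [inv_pow_sum_vanishDegree]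
  have h := Finset.prod_univ_sum (fun _ : K => (Finset.univ : Finset (Option ι)))
    fun _ o => if o = none then (1 : ℝ) else q⁻¹
  rw [Fintype.piFinset_univ] at h
  rw [← h]
  simp [Fintype.sum_option, div_eq_mul_inv]


variable {K : Type*} [Field K] [Fintype K] {ι : Type*} [Fintype ι]

/-- The normalized number of coprime tuples without roots. -/
noncomputable def rootlessDensity (K : Type*) [Field K] [Fintype K] {ι : Type*} [Fintype ι]
    (e : ι → ℕ) : ℝ :=
  (coprimeTuples (linears K) e).card / (Fintype.card K : ℝ) ^ ∑ i, e i

/-- The constant in the average of Euler factors over tuples of length `r`. -/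
noncomputable def eulerConst (q r : ℕ) (y : ℝ) : ℝ :=
  ((1 - y⁻¹)⁻¹) ^ q * Real.exp (y / (y - 1) ^ 2) ^ r

theorem one_le_eulerConst {q r : ℕ} {y : ℝ} (hy : 1 < y) : 1 ≤ eulerConst q r y := by
  refine one_le_mul_of_one_le_of_one_le (one_le_pow₀ ?_) (one_le_pow₀ ?_)
  · simpa using one_le_euler_term hy Nat.one_pos
  · rw [Real.one_le_exp_iff]
    have := sub_pos.2 hy
    positivity

theorem card_coprimeTuples_le (T : Finset K[X]) (e : ι → ℕ) :
    ((coprimeTuples T e).card : ℝ) ≤ (Fintype.card K : ℝ) ^ ∑ i, e i := by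
  have : (coprimeTuples T e).card ≤ (Fintype.piFinset fun i => monics K (e i)).card :=
    Finset.card_le_card (Finset.filter_subset _ _)
  rw [Fintype.card_piFinset, Finset.prod_congr rfl fun i _ => card_monics (e i),
    Finset.prod_pow_eq_pow_sum] at this
  exact_mod_cast this

theorem rootlessDensity_nonneg (e : ι → ℕ) : 0 ≤ rootlessDensity K e := by
  unfold rootlessDensity; positivity

theorem rootlessDensity_le_one (e : ι → ℕ) : rootlessDensity K e ≤ 1 :=
  div_le_one_of_le₀ (card_coprimeTuples_le _ _) (by positivity)

theorem sum_update_add (e : ι → ℕ) (j : ι) (n : ℕ) :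
    ∑ i, Function.update e j n i + e j = ∑ i, e i + n := by
  rw [Finset.sum_update_of_mem (Finset.mem_univ j), ← Finset.sum_erase_add _ e (Finset.mem_univ j),
    Finset.sdiff_singleton_eq_erase]
  ring

theorem abs_rootlessDensity_step_le {y : ℝ} (hy : 1 < y) (e : ι → ℕ) (j : ι) (hj : e j ≠ 0) :
    |rootlessDensity K e - rootlessDensity K (Function.update e j (e j - 1))| ≤
      Fintype.card K * eulerConst (Fintype.card K) (Fintype.card ι) y *
        (y / Fintype.card K) ^ e j := by
  have h := abs_card_coprimeTuples_sub_le hy (isPrimeSet_linears (K := K)) e j hj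
  rw [eulerFactor_linears] at h
  have h0 := sum_update_add e j 0
  have h1 := sum_update_add e j (e j - 1)
  have hq : (0 : ℝ) < Fintype.card K := by exact_mod_cast Fintype.card_pos (α := K)
  unfold rootlessDensity eulerConst
  set n := Fintype.card K
  have e1 : ∑ i, e i = ∑ i, Function.update e j (e j - 1) i + 1 := by omega
  have e2 : ∑ i, e i = ∑ i, Function.update e j 0 i + e j := by omega
  have hrew : ((coprimeTuples (linears K) e).card : ℝ) / (n : ℝ) ^ ∑ i, e i -
      (coprimeTuples (linears K) (Function.update e j (e j - 1))).card /
        (n : ℝ) ^ ∑ i, Function.update e j (e j - 1) i =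
      ((coprimeTuples (linears K) e).card -
        n * (coprimeTuples (linears K) (Function.update e j (e j - 1))).card) /
        (n : ℝ) ^ ∑ i, e i := by
    rw [e1, pow_succ]
    field_simp
  rw [hrew, abs_div, abs_of_pos (show 0 < (n : ℝ) ^ ∑ i, e i by positivity),
    div_le_iff₀ (by positivity)]
  refine h.trans (le_of_eq ?_)
  rw [e2, pow_add, div_pow]
  field_simp

/-- The steps decay like (y/q)^(e j). The ratio is at most 1/2, so the geometric sums cost the
factor 2. -/
theorem abs_rootlessDensity_sub_le {y : ℝ} (hy : 1 < y) (hyq : 2 * y ≤ Fintype.card K)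
    {e d : ι → ℕ} (hed : e ≤ d) :
    |rootlessDensity K d - rootlessDensity K e| ≤
      2 * Fintype.card K * eulerConst (Fintype.card K) (Fintype.card ι) y *
        ∑ j, (y / Fintype.card K) ^ e j := by
  have hq : (0 : ℝ) < Fintype.card K := by exact_mod_cast Fintype.card_pos (α := K)
  have hθ : y / Fintype.card K ≤ 1 / 2 := by
    rw [div_le_iff₀ hq]
    linarith
  have hθ0 : 0 < y / Fintype.card K := by positivity
  have hE := one_le_eulerConst (q := Fintype.card K) (r := Fintype.card ι) hy
  refine (abs_sub_le_of_step (by positivity) hθ0 (by linarith)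
    (fun e j hj => abs_rootlessDensity_step_le hy e j hj) hed).trans ?_
  refine mul_le_mul_of_nonneg_right ?_ (by positivity)
  rw [div_le_iff₀ (by linarith)]
  have : 0 ≤ Fintype.card K * eulerConst (Fintype.card K) (Fintype.card ι) y := by positivity
  nlinarith

/-- The tuples of degrees `d - b`, weighted against all tuples of degrees `d`. -/
theorem abs_shifted_density_sub_le {y : ℝ} (hy : 1 < y) (hyq : 2 * y ≤ Fintype.card K)
    (d b : ι → ℕ) :
    |(if b ≤ d then ((coprimeTuples (linears K) (d - b)).card : ℝ) /
        (Fintype.card K : ℝ) ^ ∑ i, d i else 0) -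
        ((Fintype.card K : ℝ) ^ ∑ i, b i)⁻¹ * rootlessDensity K d| ≤
      ((Fintype.card K : ℝ) ^ ∑ i, b i)⁻¹ *
        (2 * Fintype.card K * eulerConst (Fintype.card K) (Fintype.card ι) y *
          ∑ j, (y / Fintype.card K) ^ d j * (Fintype.card K / y) ^ b j) := by
  have hq2 := two_le_card_field (K := K)
  have hE := one_le_eulerConst (q := Fintype.card K) (r := Fintype.card ι) hy
  split_ifs with hb
  · have h := abs_rootlessDensity_sub_le hy hyq (show d - b ≤ d from tsub_le_self)
    have hs : ∑ i, d i = ∑ i, (d - b) i + ∑ i, b i := by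
      rw [← Finset.sum_add_distrib]
      exact Finset.sum_congr rfl fun i _ => (Nat.sub_add_cancel (hb i)).symm
    have h1 : ((coprimeTuples (linears K) (d - b)).card : ℝ) / (Fintype.card K : ℝ) ^ ∑ i, d i =
        ((Fintype.card K : ℝ) ^ ∑ i, b i)⁻¹ * rootlessDensity K (d - b) := by
      rw [hs, pow_add, rootlessDensity]
      field_simp
    rw [h1, ← mul_sub, abs_mul, abs_of_pos (by positivity), abs_sub_comm]
    refine mul_le_mul_of_nonneg_left (h.trans (le_of_eq ?_)) (by positivity)
    congr 1
    refine Finset.sum_congr rfl fun j _ => ?_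
    rw [Pi.sub_apply, pow_sub₀ _ (by positivity) (hb j), ← inv_pow, inv_div]
  -- An impossible shift has b i > d i for some i; then (y/q)^(d i) (q/y)^(b i) ≥ 1, so the claimed
  -- error already exceeds the main term.
  · rw [zero_sub, abs_neg, abs_mul, abs_of_pos (show 0 < ((Fintype.card K : ℝ) ^ ∑ i, b i)⁻¹ by
      positivity), abs_of_nonneg (rootlessDensity_nonneg d)]
    refine mul_le_mul_of_nonneg_left ((rootlessDensity_le_one d).trans ?_) (by positivity)
    rw [Pi.le_def] at hb
    push Not at hb
    obtain ⟨i, hi⟩ := hb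
    have h1 : 1 ≤ (y / Fintype.card K) ^ d i * ((Fintype.card K : ℝ) / y) ^ b i := by
      have h2 : 1 ≤ (Fintype.card K : ℝ) / y := by
        rw [one_le_div (by linarith)]
        linarith
      calc (1 : ℝ) = (y / Fintype.card K) ^ d i * ((Fintype.card K : ℝ) / y) ^ d i := by
            rw [← mul_pow, div_mul_div_cancel₀ (by positivity), div_self (by linarith), one_pow]
        _ ≤ _ := mul_le_mul_of_nonneg_left (pow_le_pow_right₀ h2 hi.le) (by positivity)
    have h3 : 1 ≤ ∑ j, (y / Fintype.card K) ^ d j * ((Fintype.card K : ℝ) / y) ^ b j :=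
      h1.trans (Finset.single_le_sum (f := fun j => (y / Fintype.card K) ^ d j *
        ((Fintype.card K : ℝ) / y) ^ b j) (fun j _ => by positivity) (Finset.mem_univ i))
    refine one_le_mul_of_one_le_of_one_le ?_ h3
    exact one_le_mul_of_one_le_of_one_le (by linarith) hE

/-- Sum the shifted estimate over the (1 + r)^q patterns. The growth (q/y)^(b j) is absorbed by the
weight q^(-Σ b), so every pattern has the same error. -/
theorem abs_density_sub_le {y : ℝ} (hy : 1 < y) (hyq : 2 * y ≤ Fintype.card K) (d : ι → ℕ) :
    |((coprimeTuples (∅ : Finset K[X]) d).card : ℝ) / (Fintype.card K : ℝ) ^ ∑ i, d i -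
        (1 + (Fintype.card ι : ℝ) / Fintype.card K) ^ Fintype.card K * rootlessDensity K d| ≤
      (1 + Fintype.card ι : ℝ) ^ Fintype.card K *
        (2 * Fintype.card K * eulerConst (Fintype.card K) (Fintype.card ι) y *
          ∑ j, (y / Fintype.card K) ^ d j) := by
  have hq2 := two_le_card_field (K := K)
  have hE := one_le_eulerConst (q := Fintype.card K) (r := Fintype.card ι) hy
  have h := congrArg (Nat.cast (R := ℝ)) (card_filter_coprimeTuples_eq_sum (K := K) d fun _ => True)
  simp only [Finset.filter_true] at h
  push_cast at h
  rw [h, Finset.sum_div, ← sum_inv_pow_sum_vanishDegree (K := K) (ι := ι), Finset.sum_mul,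
    ← Finset.sum_sub_distrib]
  refine (Finset.abs_sum_le_sum_abs _ _).trans ?_
  calc _ ≤ ∑ τ : K → Option ι, (2 * Fintype.card K *
        eulerConst (Fintype.card K) (Fintype.card ι) y * ∑ j, (y / Fintype.card K) ^ d j) := by
        refine Finset.sum_le_sum fun τ _ => ?_
        rw [ite_div, zero_div]
        refine (abs_shifted_density_sub_le hy hyq d (vanishDegree τ)).trans ?_
        rw [mul_left_comm, Finset.mul_sum]
        refine mul_le_mul_of_nonneg_left (Finset.sum_le_sum fun j _ => ?_) (by positivity)
        rw [mul_left_comm]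
        refine mul_le_of_le_one_right (by positivity) ?_
        rw [inv_mul_le_one₀ (by positivity)]
        calc ((Fintype.card K : ℝ) / y) ^ vanishDegree τ j
            ≤ (Fintype.card K : ℝ) ^ vanishDegree τ j :=
              pow_le_pow_left₀ (by positivity) (div_le_self (by linarith) hy.le) _
          _ ≤ _ := pow_le_pow_right₀ (by linarith)
              (Finset.single_le_sum (fun _ _ => Nat.zero_le _) (Finset.mem_univ j))
    _ = _ := by
        rw [Finset.sum_const, Finset.card_univ, Fintype.card_fun, Fintype.card_option, nsmul_eq_mul]
        push_cast
        ring

end Asymptotics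

/-! ### Prescribed character values on rootless tuples -/

section Conditional

variable {K : Type*} [Field K] {ι : Type*} [Fintype ι]

theorem eval_prodPow (k : ι → ℕ) (F : ι → K[X]) (a : K) :
    (prodPow k F).eval a = ∏ i, (F i).eval a ^ k i := by
  simp [prodPow, eval_prod]

variable [Fintype K]

/-- The values of `χ` at the points of `S` of the product of the powers of `F` are `η`. -/
def HasCharValues (χ : MulChar K ℂ) (k : ι → ℕ) (S : Finset K) (η : K → ℂ) (F : ι → K[X]) : Prop :=
  ∀ a ∈ S, χ ((prodPow k F).eval a) = η a

/-- With exponent 1 the coordinate j enters linearly; everything else is a constant at each point,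
and `equallyFrequent_char` allows arbitrary constants. -/
theorem equallyFrequent_hasCharValues {p : ℕ} (hp : p.Prime) {χ : MulChar K ℂ}
    (hχ : orderOf χ = p) {k : ι → ℕ} {j : ι} (hkj : k j = 1) {S : Finset K} {η η' : K → ℂ}
    (hη : ∀ a ∈ S, η a ^ p = 1) (hη' : ∀ a ∈ S, η' a ^ p = 1) (H G : ι → K[X]) :
    EquallyFrequent S.card (fun f => HasCharValues χ k S η (H * Function.update G j f))
      (fun f => HasCharValues χ k S η' (H * Function.update G j f)) := by
  have hev : ∀ (f : K[X]) (a : K), (prodPow k (H * Function.update G j f)).eval a =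
      ((H j).eval a * ∏ i ∈ Finset.univ.erase j, ((H i).eval a * (G i).eval a) ^ k i) *
        f.eval a := by
    intro f a
    rw [eval_prodPow, ← Finset.mul_prod_erase _ _ (Finset.mem_univ j), hkj, pow_one, Pi.mul_apply,
      Function.update_self, eval_mul, mul_right_comm]
    congr 2
    refine Finset.prod_congr rfl fun i hi => ?_
    rw [Pi.mul_apply, Function.update_of_ne (Finset.ne_of_mem_erase hi), eval_mul]
  have h := equallyFrequent_char hp.ne_zero χ (fun z hz => χ.exists_eq_of_pow_eq_one hp hχ hz) S
    (fun a => (H j).eval a * ∏ i ∈ Finset.univ.erase j, ((H i).eval a * (G i).eval a) ^ k i) hη hη'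
  simpa only [HasCharValues, hev] using h

/-- The bound for the deviation from equidistribution of character values. -/
noncomputable def charError (K : Type*) [Field K] [Fintype K] {ι : Type*} [Fintype ι] (l : ℕ)
    (j : ι) (e : ι → ℕ) : ℝ :=
  l * √(Fintype.card K : ℝ) ^ l *
    (eulerConst (Fintype.card K) (Fintype.card ι) √(Fintype.card K : ℝ) *
      (Fintype.card K : ℝ) ^ ∑ i, Function.update e j 0 i) * √(Fintype.card K : ℝ) ^ e j

theorem abs_card_hasCharValues_sub_le {p : ℕ} (hp : p.Prime) {χ : MulChar K ℂ}
    (hχ : orderOf χ = p) {k : ι → ℕ} {j : ι} (hkj : k j = 1) {S : Finset K} {η η' : K → ℂ}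
    (hη : ∀ a ∈ S, η a ^ p = 1) (hη' : ∀ a ∈ S, η' a ^ p = 1) (H : ι → K[X]) (e : ι → ℕ) :
    |(((coprimeTuples (linears K) e).filter fun F => HasCharValues χ k S η (H * F)).card : ℝ) -
        ((coprimeTuples (linears K) e).filter fun F => HasCharValues χ k S η' (H * F)).card| ≤
      charError K S.card j e := by
  have hs : 1 < √(Fintype.card K : ℝ) :=
    Real.lt_sqrt_of_sq_lt (by have := two_le_card_field (K := K); linarith)
  have h := abs_card_filter_coprimeTuples_sub_le hs (isPrimeSet_linears (K := K)) e j
    (A := fun F => HasCharValues χ k S η (H * F)) (B := fun F => HasCharValues χ k S η' (H * F))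
    (equallyFrequent_hasCharValues hp hχ hkj hη hη' H)
  rwa [eulerFactor_linears] at h

/-- The p^|S| possible value patterns partition the tuples, and any two of them are almost equally
frequent, so each is close to the average. -/
theorem abs_card_hasCharValues_sub_average_le {p : ℕ} (hp : p.Prime) {χ : MulChar K ℂ}
    (hχ : orderOf χ = p) {k : ι → ℕ} {j : ι} (hkj : k j = 1) {S : Finset K} {η : K → ℂ}
    (hη : ∀ a ∈ S, η a ^ p = 1) {H : ι → K[X]} (hH : ∀ i, ∀ a ∈ S, (H i).eval a ≠ 0)
    (e : ι → ℕ) :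
    |(((coprimeTuples (linears K) e).filter fun F => HasCharValues χ k S η (H * F)).card : ℝ) -
        ((p : ℝ) ^ S.card)⁻¹ * (coprimeTuples (linears K) e).card| ≤ charError K S.card j e := by
  let V : Finset (K → ℂ) := Fintype.piFinset fun a =>
    if a ∈ S then nthRootsFinset p (1 : ℂ) else {1}
  have hV : (V.card : ℝ) = (p : ℝ) ^ S.card := by
    have h1 : ∀ a, (if a ∈ S then nthRootsFinset p (1 : ℂ) else {1}).card =
        if a ∈ S then p else 1 := by
      intro a
      split_ifs
      · exact (Complex.isPrimitiveRoot_exp p hp.ne_zero).card_nthRootsFinset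
      · rfl
    rw [Fintype.card_piFinset, Finset.prod_congr rfl fun a _ => h1 a]
    simp
  have hmem : ∀ η' ∈ V, ∀ a ∈ S, η' a ^ p = 1 := by
    intro η' h a ha
    have := Fintype.mem_piFinset.1 h a
    rwa [if_pos ha, mem_nthRootsFinset hp.pos] at this
  have hsum : ((coprimeTuples (linears K) e).card : ℝ) = ∑ η' ∈ V,
      (((coprimeTuples (linears K) e).filter fun F =>
        HasCharValues χ k S η' (H * F)).card : ℝ) := by
    rw [Finset.card_eq_sum_card_fiberwise (t := V)
      (f := fun F a => if a ∈ S then χ ((prodPow k (H * F)).eval a) else 1)]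
    · push_cast
      refine Finset.sum_congr rfl fun η' hη' => ?_
      congr 2
      refine Finset.filter_congr fun F _ => ?_
      constructor
      · rintro rfl a ha
        simp [ha]
      · intro h
        funext a
        split_ifs with ha
        · exact h a ha
        · have := Fintype.mem_piFinset.1 hη' a
          rw [if_neg ha, Finset.mem_singleton] at this
          exact this.symm
    · intro F hF
      have hroot := fun i => forall_linears_not_dvd_iff.1 ((mem_coprimeTuples.1 hF).2.2.1 i)
      refine Fintype.mem_piFinset.2 fun a => ?_
      dsimp only
      split_ifs with ha
      · rw [mem_nthRootsFinset hp.pos]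
        refine χ.pow_eq_one_of_ne_zero hχ ?_
        rw [eval_prodPow]
        refine Finset.prod_ne_zero_iff.2 fun i _ => pow_ne_zero _ ?_
        rw [Pi.mul_apply, eval_mul]
        exact mul_ne_zero (hH i a ha) (hroot i a)
      · exact Finset.mem_singleton_self _
  have hp0 : (0 : ℝ) < (p : ℝ) ^ S.card := by
    have : (0 : ℝ) < p := by exact_mod_cast hp.pos
    positivity
  set N := fun η' : K → ℂ => (((coprimeTuples (linears K) e).filter
    fun F => HasCharValues χ k S η' (H * F)).card : ℝ) with hN
  have hle : |∑ η' ∈ V, (N η - N η')| ≤ (p : ℝ) ^ S.card * charError K S.card j e := by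
    refine (Finset.abs_sum_le_sum_abs _ _).trans ?_
    refine (Finset.sum_le_sum fun η' h =>
      abs_card_hasCharValues_sub_le hp hχ hkj hη (hmem η' h) H e).trans ?_
    rw [Finset.sum_const, nsmul_eq_mul, hV]
  rw [Finset.sum_sub_distrib, Finset.sum_const, nsmul_eq_mul, hV, ← hsum] at hle
  have heq : N η - ((p : ℝ) ^ S.card)⁻¹ * (coprimeTuples (linears K) e).card =
      ((p : ℝ) ^ S.card)⁻¹ * ((p : ℝ) ^ S.card * N η - (coprimeTuples (linears K) e).card) := by
    field_simp
  rw [show (((coprimeTuples (linears K) e).filter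
    fun F => HasCharValues χ k S η (H * F)).card : ℝ) = N η from rfl, heq, abs_mul,
    abs_of_pos (by positivity), inv_mul_le_iff₀ hp0]
  exact hle

end Conditional

/-! ### Density of the tuples with all character values prescribed -/

section ConditionalDensity

theorem card_compatible {K ι : Type*} [Fintype K] [Fintype ι] (S : Finset K) :
    (Finset.univ.filter fun τ : K → Option ι => ∀ a, τ a = none ↔ a ∈ S).card =
      Fintype.card ι ^ Sᶜ.card := by
  have : (Finset.univ.filter fun τ : K → Option ι => ∀ a, τ a = none ↔ a ∈ S) =
      Fintype.piFinset fun a => if a ∈ S then {none} else Finset.univ.image some := by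
    ext τ
    simp only [Finset.mem_filter, Finset.mem_univ, true_and, Fintype.mem_piFinset]
    refine forall_congr' fun a => ?_
    split_ifs with ha
    · simp [ha]
    · rcases h : τ a with _ | i <;> simp [ha]
  rw [this, Fintype.card_piFinset]
  have h1 : ∀ a, (if a ∈ S then {none} else Finset.univ.image (some : ι → Option ι)).card =
      if a ∈ Sᶜ then Fintype.card ι else 1 := by
    intro a
    by_cases ha : a ∈ S
    · simp [ha]
    · simp [ha, Finset.card_image_of_injective _ (Option.some_injective ι)]
  rw [Finset.prod_congr rfl fun a _ => h1 a, Finset.prod_ite_mem, Finset.univ_inter,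
    Finset.prod_const]


variable {K : Type*} [Field K] [Fintype K] {ι : Type*} [Fintype ι]

/-- The quotient of powers is √q^(-(d j - b j)) q^(-m), at most √q^(-d j - m) because b j ≤ m. -/
theorem charError_shift_le {l m : ℕ} {j : ι} {d b : ι → ℕ} (hb : b ≤ d) (hm : ∑ i, b i = m) :
    charError K l j (d - b) / (Fintype.card K : ℝ) ^ ∑ i, d i ≤
      l * √(Fintype.card K : ℝ) ^ l *
        eulerConst (Fintype.card K) (Fintype.card ι) √(Fintype.card K : ℝ) /
        (√(Fintype.card K : ℝ) ^ d j * √(Fintype.card K : ℝ) ^ m) := by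
  have hq2 := two_le_card_field (K := K)
  have hs : 1 < √(Fintype.card K : ℝ) := Real.lt_sqrt_of_sq_lt (by linarith)
  have hE := one_le_eulerConst (q := Fintype.card K) (r := Fintype.card ι) hs
  have hsq : (Fintype.card K : ℝ) = √(Fintype.card K : ℝ) ^ 2 := (Real.sq_sqrt (by linarith)).symm
  have hbj : b j ≤ m := hm ▸ Finset.single_le_sum (fun _ _ => Nat.zero_le _) (Finset.mem_univ j)
  have hs1 : ∑ i, Function.update (d - b) j 0 i + (d j - b j) + m = ∑ i, d i := by
    have h1 := sum_update_add (d - b) j 0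
    have h2 : ∑ i, (d - b) i + ∑ i, b i = ∑ i, d i := by
      rw [← Finset.sum_add_distrib]
      exact Finset.sum_congr rfl fun i _ => Nat.sub_add_cancel (hb i)
    rw [Pi.sub_apply] at h1
    omega
  have hdb := hb j
  unfold charError
  generalize ∑ i, Function.update (d - b) j 0 i = u at *
  rw [div_le_div_iff₀ (by positivity) (by positivity), ← hs1]
  have hpow : (Fintype.card K : ℝ) ^ u * √(Fintype.card K : ℝ) ^ (d j - b j) *
      (√(Fintype.card K : ℝ) ^ d j * √(Fintype.card K : ℝ) ^ m) ≤
      (Fintype.card K : ℝ) ^ (u + (d j - b j) + m) := by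
    conv_lhs => rw [hsq]
    conv_rhs => rw [hsq]
    rw [Real.sqrt_sq (by positivity), ← pow_mul, ← pow_mul, ← pow_add, ← pow_add, ← pow_add]
    exact pow_le_pow_right₀ hs.le (by omega)
  rw [Pi.sub_apply]
  calc _ = l * √(Fintype.card K : ℝ) ^ l *
        eulerConst (Fintype.card K) (Fintype.card ι) √(Fintype.card K : ℝ) *
        ((Fintype.card K : ℝ) ^ u * √(Fintype.card K : ℝ) ^ (d j - b j) *
          (√(Fintype.card K : ℝ) ^ d j * √(Fintype.card K : ℝ) ^ m)) := by ring
    _ ≤ _ := mul_le_mul_of_nonneg_left hpow (by positivity)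

theorem eval_prodPow_vanishFactor_mul_eq_zero_iff {k : ι → ℕ} (hk : ∀ i, k i ≠ 0)
    {τ : K → Option ι} {F : ι → K[X]} (hF : ∀ i a, (F i).eval a ≠ 0) (a : K) :
    (prodPow k (vanishFactor τ * F)).eval a = 0 ↔ τ a ≠ none := by
  rw [eval_prodPow, Finset.prod_eq_zero_iff, Option.ne_none_iff_exists']
  simp [pow_eq_zero_iff (hk _), hF, eval_vanishFactor_eq_zero_iff]

/-- The values of `χ` at all points of the product of the powers of `F` are `η`. -/
def HasAllCharValues (χ : MulChar K ℂ) (k : ι → ℕ) (η : K → ℂ) (F : ι → K[X]) : Prop :=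
  ∀ a, χ ((prodPow k F).eval a) = η a

/-- Only the r^|Sᶜ| patterns whose zero set is Sᶜ occur. For each, the character count is compared
with p^(-|S|) times the number of rootless tuples of the lowered degrees, and the latter with
p^(-|S|) q^(-|Sᶜ|) ν; the two summands are these two errors. -/
theorem abs_conditional_density_sub_le {p : ℕ} (hp : p.Prime) {χ : MulChar K ℂ}
    (hχ : orderOf χ = p) {k : ι → ℕ} (hk : ∀ i, k i ≠ 0) {j : ι} (hkj : k j = 1) {S : Finset K}
    {η : K → ℂ} (hη : ∀ a ∈ S, η a ^ p = 1) (hη0 : ∀ a, a ∉ S → η a = 0) {y : ℝ} (hy : 1 < y)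
    (hyq : 2 * y ≤ Fintype.card K) (d : ι → ℕ) :
    |(((coprimeTuples (∅ : Finset K[X]) d).filter 
        (HasAllCharValues χ k η)).card : ℝ) / (Fintype.card K : ℝ) ^ ∑ i, d i -
      ((p : ℝ) ^ S.card)⁻¹ * ((Fintype.card ι : ℝ) / Fintype.card K) ^ Sᶜ.card *
        rootlessDensity K d| ≤
      (Fintype.card ι : ℝ) ^ Sᶜ.card *
        (S.card * √(Fintype.card K : ℝ) ^ S.card *
          eulerConst (Fintype.card K) (Fintype.card ι) √(Fintype.card K : ℝ) /
          (√(Fintype.card K : ℝ) ^ d j * √(Fintype.card K : ℝ) ^ Sᶜ.card) +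
        ((p : ℝ) ^ S.card)⁻¹ * (((Fintype.card K : ℝ) ^ Sᶜ.card)⁻¹ *
          (2 * Fintype.card K * eulerConst (Fintype.card K) (Fintype.card ι) y *
            ((Fintype.card K / y) ^ Sᶜ.card * ∑ i, (y / Fintype.card K) ^ d i)))) := by
  have hq2 := two_le_card_field (K := K)
  have hs : 1 < √(Fintype.card K : ℝ) := Real.lt_sqrt_of_sq_lt (by linarith)
  have hEs := one_le_eulerConst (q := Fintype.card K) (r := Fintype.card ι) hs
  have hE := one_le_eulerConst (q := Fintype.card K) (r := Fintype.card ι) hy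
  have hp0 : (0 : ℝ) < p := by exact_mod_cast hp.pos
  have hne : ∀ a ∈ S, η a ≠ 0 := by
    intro a ha h0
    have := hη a ha
    rw [h0, zero_pow hp.ne_zero] at this
    exact zero_ne_one this
  let V : Finset (K → Option ι) := Finset.univ.filter fun τ => ∀ a, τ a = none ↔ a ∈ S
  have hterm : ∀ τ : K → Option ι,
      ((coprimeTuples (linears K) (d - vanishDegree τ)).filter fun F =>
        HasAllCharValues χ k η (vanishFactor τ * F)).card =
      if τ ∈ V then ((coprimeTuples (linears K) (d - vanishDegree τ)).filter fun F =>
        HasCharValues χ k S η (vanishFactor τ * F)).card else 0 := by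
    intro τ
    have hz : ∀ F ∈ coprimeTuples (linears K) (d - vanishDegree τ), ∀ a,
        (prodPow k (vanishFactor τ * F)).eval a = 0 ↔ τ a ≠ none := fun F hF a =>
      eval_prodPow_vanishFactor_mul_eq_zero_iff hk
        (fun i => forall_linears_not_dvd_iff.1 ((mem_coprimeTuples.1 hF).2.2.1 i)) a
    split_ifs with hτ
    · congr 1
      refine Finset.filter_congr fun F hF => ⟨fun h a _ => h a, fun h a => ?_⟩
      by_cases ha : a ∈ S
      · exact h a ha
      · rw [hη0 a ha, (hz F hF a).2 fun h0 => ha (((Finset.mem_filter.1 hτ).2 a).1 h0),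
          MulChar.map_zero]
    · rw [Finset.card_eq_zero, Finset.filter_eq_empty_iff]
      intro F hF h
      refine hτ (Finset.mem_filter.2 ⟨Finset.mem_univ _, fun a => ⟨fun h0 => ?_, fun ha => ?_⟩⟩)
      · by_contra ha
        have h1 := h a
        rw [hη0 a ha] at h1
        have h2 : (prodPow k (vanishFactor τ * F)).eval a ≠ 0 := fun h3 => (hz F hF a).1 h3 h0
        have h3 := χ.pow_eq_one_of_ne_zero hχ h2
        rw [h1, zero_pow hp.ne_zero] at h3
        exact zero_ne_one h3
      · by_contra h0
        have h1 := h a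
        rw [(hz F hF a).2 h0, MulChar.map_zero] at h1
        exact hne a ha h1.symm
  have hcount : (((coprimeTuples (∅ : Finset K[X]) d).filter 
        (HasAllCharValues χ k η)).card : ℝ) =
      ∑ τ ∈ V, if vanishDegree τ ≤ d then
        (((coprimeTuples (linears K) (d - vanishDegree τ)).filter fun F =>
          HasCharValues χ k S η (vanishFactor τ * F)).card : ℝ) else 0 := by
    rw [card_filter_coprimeTuples_eq_sum]
    push_cast
    rw [Finset.sum_filter]
    refine Finset.sum_congr rfl fun τ _ => ?_
    rw [hterm]
    by_cases hτ : τ ∈ V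
    · rw [if_pos hτ, if_pos (Finset.mem_filter.1 hτ).2]
    · rw [if_neg hτ, if_neg fun h => hτ (Finset.mem_filter.2 ⟨Finset.mem_univ _, h⟩)]
      simp
  have hVcard : (V.card : ℝ) = (Fintype.card ι : ℝ) ^ Sᶜ.card := by
    exact_mod_cast card_compatible (ι := ι) S
  have hVdeg : ∀ τ ∈ V, ∑ i, vanishDegree τ i = Sᶜ.card := by
    intro τ hτ
    rw [sum_vanishDegree]
    congr 1
    ext a
    simp [(Finset.mem_filter.1 hτ).2 a]
  have hmain : ((p : ℝ) ^ S.card)⁻¹ * ((Fintype.card ι : ℝ) / Fintype.card K) ^ Sᶜ.card *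
      rootlessDensity K d = ∑ τ ∈ V, ((p : ℝ) ^ S.card)⁻¹ *
        (((Fintype.card K : ℝ) ^ ∑ i, vanishDegree τ i)⁻¹ * rootlessDensity K d) := by
    rw [Finset.sum_congr rfl fun τ hτ => by rw [hVdeg τ hτ], Finset.sum_const, nsmul_eq_mul, hVcard,
      div_pow]
    ring
  rw [hcount, hmain, Finset.sum_div, ← Finset.sum_sub_distrib]
  refine (Finset.abs_sum_le_sum_abs _ _).trans ?_
  rw [← hVcard, ← nsmul_eq_mul]
  refine Finset.sum_le_card_nsmul _ _ _ fun τ hτ => ?_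
  set b := vanishDegree τ with hb
  have hbS : ∑ i, b i = Sᶜ.card := hVdeg τ hτ
  have hH : ∀ i, ∀ a ∈ S, (vanishFactor τ i).eval a ≠ 0 := by
    intro i a ha h0
    rw [eval_vanishFactor_eq_zero_iff, ((Finset.mem_filter.1 hτ).2 a).2 ha] at h0
    exact Option.some_ne_none _ h0.symm
  have hchar := abs_card_hasCharValues_sub_average_le hp hχ hkj hη hH (d - b)
  have hshift := abs_shifted_density_sub_le hy hyq d b
  have hY : ∑ i, (y / (Fintype.card K : ℝ)) ^ d i * ((Fintype.card K : ℝ) / y) ^ b i ≤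
      ((Fintype.card K : ℝ) / y) ^ Sᶜ.card * ∑ i, (y / (Fintype.card K : ℝ)) ^ d i := by
    rw [Finset.mul_sum]
    refine Finset.sum_le_sum fun i _ => ?_
    rw [mul_comm]
    refine mul_le_mul_of_nonneg_right (pow_le_pow_right₀ ?_ ?_) (by positivity)
    · rw [one_le_div (by linarith)]
      linarith
    · rw [← hbS]
      exact Finset.single_le_sum (fun _ _ => Nat.zero_le _) (Finset.mem_univ i)
  have hsecond : |((p : ℝ) ^ S.card)⁻¹ * (if b ≤ d then
      ((coprimeTuples (linears K) (d - b)).card : ℝ) /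
        (Fintype.card K : ℝ) ^ ∑ i, d i else 0) - ((p : ℝ) ^ S.card)⁻¹ *
        (((Fintype.card K : ℝ) ^ ∑ i, b i)⁻¹ * rootlessDensity K d)| ≤
      ((p : ℝ) ^ S.card)⁻¹ * (((Fintype.card K : ℝ) ^ Sᶜ.card)⁻¹ *
          (2 * Fintype.card K * eulerConst (Fintype.card K) (Fintype.card ι) y *
            ((Fintype.card K / y) ^ Sᶜ.card * ∑ i, (y / Fintype.card K) ^ d i))) := by
    rw [← mul_sub, abs_mul, abs_of_pos (show 0 < ((p : ℝ) ^ S.card)⁻¹ by positivity)]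
    refine mul_le_mul_of_nonneg_left (hshift.trans ?_) (by positivity)
    rw [hbS]
    refine mul_le_mul_of_nonneg_left (mul_le_mul_of_nonneg_left hY (by positivity)) (by positivity)
  refine (abs_sub_le _ (((p : ℝ) ^ S.card)⁻¹ * (if b ≤ d then
    ((coprimeTuples (linears K) (d - b)).card : ℝ) / (Fintype.card K : ℝ) ^ ∑ i, d i else 0))
    _).trans (add_le_add ?_ hsecond)
  split_ifs with hbd
  · refine le_trans ?_ (charError_shift_le (K := K) (j := j) hbd hbS)
    rw [← mul_div_assoc, ← sub_div, abs_div, abs_of_pos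
      (show 0 < (Fintype.card K : ℝ) ^ ∑ i, d i by positivity)]
    exact div_le_div_of_nonneg_right hchar (by positivity)
  · rw [zero_div, mul_zero, sub_zero, abs_zero]
    positivity

end ConditionalDensity

/-- Passing from densities to their quotient. -/
theorem exists_relative_error {N R M ν a b EN ER c : ℝ} (hR : 0 < R) (hM : 0 < M) (hc : 0 < c)
    (hcR : c ≤ R) (hN : |N - a * ν| ≤ EN) (hRb : |R - b * ν| ≤ ER) (hab : a = M * b) :
    ∃ δ, |δ| ≤ (EN / M + ER) / c ∧ N / R = M * (1 + δ) := by
  refine ⟨(N - M * R) / (M * R), ?_, by field_simp; ring⟩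
  have h1 : |N - M * R| ≤ EN + M * ER := by
    -- Since a = M b, the unknown ν drops out.
    have : N - M * R = (N - a * ν) - M * (R - b * ν) := by rw [hab]; ring
    rw [this]
    refine (abs_sub _ _).trans (add_le_add hN ?_)
    rw [abs_mul, abs_of_pos hM]
    exact mul_le_mul_of_nonneg_left hRb hM.le
  have h0 : 0 ≤ EN + M * ER := (abs_nonneg _).trans h1
  rw [abs_div, abs_of_pos (show 0 < M * R by positivity)]
  calc _ ≤ (EN + M * ER) / (M * R) := div_le_div_of_nonneg_right h1 (by positivity)
    _ ≤ (EN + M * ER) / (M * c) := div_le_div_of_nonneg_left h0 (by positivity)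
        (mul_le_mul_of_nonneg_left hcR hM.le)
    _ = _ := by field_simp

/-! ### From explicit errors to the stated error term -/

section Numerics

/-- Both factors decrease in y. The factor independent of q is also raised to the power q, so that
all losses become A^q with one base A. -/
theorem eulerConst_le {q r : ℕ} (hq : q ≠ 0) {y₀ y : ℝ} (hy₀ : 1 < y₀) (hy : y₀ ≤ y) :
    eulerConst q r y ≤ ((1 - y₀⁻¹)⁻¹ * Real.exp (y₀ / (y₀ - 1) ^ 2) ^ r) ^ q := by
  have h0 : 0 < y₀ := by linarith
  have h1 : y⁻¹ ≤ y₀⁻¹ := inv_anti₀ h0 hy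
  have h2 : y₀⁻¹ < 1 := inv_lt_one_of_one_lt₀ hy₀
  have h3 : (1 - y⁻¹)⁻¹ ≤ (1 - y₀⁻¹)⁻¹ := inv_anti₀ (by linarith) (by linarith)
  have h4 : y / (y - 1) ^ 2 ≤ y₀ / (y₀ - 1) ^ 2 := by
    have e : ∀ z : ℝ, 1 < z → z / (z - 1) ^ 2 = (z - 1)⁻¹ + ((z - 1)⁻¹) ^ 2 := by
      intro z hz
      have : z - 1 ≠ 0 := by linarith
      field_simp
      ring
    rw [e y (by linarith), e y₀ hy₀]
    have h5 : (y - 1)⁻¹ ≤ (y₀ - 1)⁻¹ := inv_anti₀ (by linarith) (by linarith)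
    have h6 : 0 ≤ (y - 1)⁻¹ := inv_nonneg.2 (by linarith)
    gcongr
  rw [mul_pow, eulerConst]
  have h6 : 1 ≤ Real.exp (y₀ / (y₀ - 1) ^ 2) ^ r := one_le_pow₀ (Real.one_le_exp (by
    have := sub_pos.2 hy₀; positivity))
  have h7 : 0 ≤ (1 - y⁻¹)⁻¹ := inv_nonneg.2 (by linarith)
  have h8 : 0 ≤ (1 - y₀⁻¹)⁻¹ := inv_nonneg.2 (by linarith)
  refine mul_le_mul (pow_le_pow_left₀ h7 h3 q) ?_ (by positivity) (by positivity)
  refine (pow_le_pow_left₀ (by positivity) (Real.exp_le_exp.2 h4) r).trans ?_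
  exact le_self_pow₀ h6 hq

/-- If A ≤ q^ε this holds without the constant; otherwise q ≤ A^(1/ε) and A^q is bounded. -/
theorem pow_le_const_mul_rpow {A ε : ℝ} (hA : 1 ≤ A) (hε : 0 < ε) {q : ℕ} (hq : 1 ≤ q) :
    A ^ q ≤ A ^ (A ^ (1 / ε)) * (q : ℝ) ^ (ε * q) := by
  have hq1 : (1 : ℝ) ≤ q := by exact_mod_cast hq
  have h1 : 1 ≤ A ^ (A ^ (1 / ε)) := Real.one_le_rpow hA (by positivity)
  have h2 : 1 ≤ (q : ℝ) ^ (ε * q) := Real.one_le_rpow hq1 (by positivity)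
  rcases le_total A ((q : ℝ) ^ ε) with h | h
  · have : A ^ q ≤ (q : ℝ) ^ (ε * q) := by
      rw [Real.rpow_mul (by positivity), Real.rpow_natCast]
      exact pow_le_pow_left₀ (by linarith) h q
    exact this.trans (le_mul_of_one_le_left (by linarith) h1)
  · have h3 : (q : ℝ) ≤ A ^ (1 / ε) := by
      have := Real.rpow_le_rpow (by positivity) h (show 0 ≤ 1 / ε by positivity)
      rwa [← Real.rpow_mul (by positivity), mul_one_div_cancel hε.ne', Real.rpow_one] at this
    have h4 : A ^ q ≤ A ^ (A ^ (1 / ε)) := by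
      rw [← Real.rpow_natCast]
      exact Real.rpow_le_rpow_of_exponent_le hA h3
    exact h4.trans (le_mul_of_one_le_right (by linarith) h2)

theorem errorTerm_nonneg (p q m : ℕ) (d : ℕ → ℕ) (ε : ℝ) : 0 ≤ errorTerm p q m d ε := by
  unfold errorTerm; positivity

/-- The exponent is m + ε (Σ d + q - m), increasing in ε because m ≤ q. -/
theorem errorTerm_mono {p q m : ℕ} (hq : 1 ≤ q) (hm : m ≤ q) (d : ℕ → ℕ) {ε ε' : ℝ}
    (h : ε' ≤ ε) : errorTerm p q m d ε' ≤ errorTerm p q m d ε := by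
  have hq1 : (1 : ℝ) ≤ q := by exact_mod_cast hq
  have hm' : (m : ℝ) ≤ q := by exact_mod_cast hm
  unfold errorTerm
  gcongr ?_ * _ + _
  refine Real.rpow_le_rpow_of_exponent_le hq1 ?_
  have hD : (0 : ℝ) ≤ ∑ j ∈ Finset.Icc 2 (p - 1), (d j : ℝ) := by positivity
  nlinarith

theorem sum_Icc_one_eq {p : ℕ} (hp : 3 ≤ p) (f : ℕ → ℝ) :
    ∑ i ∈ Finset.Icc 1 (p - 1), f i = f 1 + ∑ i ∈ Finset.Icc 2 (p - 1), f i := by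
  rw [← Finset.sum_insert (by simp)]
  congr 1
  ext i
  simp only [Finset.mem_Icc, Finset.mem_insert]
  omega

/-- The explicit error for y = q^ε fits into the stated one with a factor q^(-εq) to spare, which
later absorbs A^q. The terms with index at least 2 use ε d i ≤ ε Σ d. The term with index 1 has
exponent (1 - ε)(m - d 1), and ε ≤ 1/2 puts it under the square-root term; that term is thus used
twice, whence the 2. -/
theorem le_two_mul_errorTerm {p q m : ℕ} (hp : 3 ≤ p) (hq : 2 ≤ q) (hm : m ≤ q) (d : ℕ → ℕ)
    {ε : ℝ} (hε : 0 < ε) (hε2 : ε ≤ 1 / 2) :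
    √(q : ℝ) ^ q / √(q : ℝ) ^ d 1 + ((q : ℝ) / (q : ℝ) ^ ε) ^ m *
        ∑ i ∈ Finset.Icc 1 (p - 1), ((q : ℝ) ^ ε / q) ^ d i ≤
      2 * (q : ℝ) ^ (-(ε * q)) * errorTerm p q m d ε := by
  have hq1 : (1 : ℝ) ≤ q := by exact_mod_cast (by omega : 1 ≤ q)
  have hq0 : (0 : ℝ) < q := by linarith
  have hm' : (m : ℝ) ≤ q := by exact_mod_cast hm
  have hm0 : (0 : ℝ) ≤ m := by positivity
  have hs : ∀ n : ℕ, √(q : ℝ) ^ n = (q : ℝ) ^ ((n : ℝ) / 2) := by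
    intro n
    rw [Real.sqrt_eq_rpow, ← Real.rpow_natCast, ← Real.rpow_mul hq0.le]
    congr 1
    ring
  have h1 : √(q : ℝ) ^ q / √(q : ℝ) ^ d 1 ≤
      (q : ℝ) ^ (-(ε * q)) * (q : ℝ) ^ (-((d 1 : ℝ) - (m : ℝ)) / 2 + (q : ℝ)) := by
    rw [hs, hs, ← Real.rpow_sub hq0, ← Real.rpow_add hq0]
    refine Real.rpow_le_rpow_of_exponent_le hq1 ?_
    nlinarith
  have hy1 : ∀ n : ℕ, ((q : ℝ) / (q : ℝ) ^ ε) ^ n = (q : ℝ) ^ ((1 - ε) * n) := by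
    intro n
    rw [Real.rpow_mul hq0.le, Real.rpow_natCast, Real.rpow_sub hq0, Real.rpow_one]
  have hy2 : ∀ n : ℕ, ((q : ℝ) ^ ε / q) ^ n = (q : ℝ) ^ (-((1 - ε) * n)) := by
    intro n
    rw [← neg_mul, Real.rpow_mul hq0.le, Real.rpow_natCast, neg_sub, Real.rpow_sub hq0,
      Real.rpow_one]
  have h2 : ((q : ℝ) / (q : ℝ) ^ ε) ^ m * ((q : ℝ) ^ ε / q) ^ d 1 ≤
      (q : ℝ) ^ (-(ε * q)) * (q : ℝ) ^ (-((d 1 : ℝ) - (m : ℝ)) / 2 + (q : ℝ)) := by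
    rw [hy1, hy2, ← Real.rpow_add hq0, ← Real.rpow_add hq0]
    refine Real.rpow_le_rpow_of_exponent_le hq1 ?_
    have hd : (0 : ℝ) ≤ d 1 := by positivity
    nlinarith
  have h3 : ∀ i ∈ Finset.Icc 2 (p - 1), ((q : ℝ) / (q : ℝ) ^ ε) ^ m * ((q : ℝ) ^ ε / q) ^ d i ≤
      (q : ℝ) ^ (-(ε * q)) * ((q : ℝ) ^ (ε * ((∑ j ∈ Finset.Icc 2 (p - 1), (d j : ℝ)) + (q : ℝ)) +
        (1 - ε) * (m : ℝ)) * (q : ℝ) ^ (-(d i : ℝ))) := by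
    intro i hi
    rw [hy1, hy2, ← Real.rpow_add hq0, ← Real.rpow_add hq0, ← Real.rpow_add hq0]
    refine Real.rpow_le_rpow_of_exponent_le hq1 ?_
    have hd : (d i : ℝ) ≤ ∑ j ∈ Finset.Icc 2 (p - 1), (d j : ℝ) :=
      Finset.single_le_sum (f := fun j => (d j : ℝ)) (fun _ _ => by positivity) hi
    nlinarith
  have h4 := Finset.sum_le_sum h3
  rw [← Finset.mul_sum, ← Finset.mul_sum, ← Finset.mul_sum] at h4
  rw [sum_Icc_one_eq hp, mul_add]
  unfold errorTerm
  set X := (q : ℝ) ^ (-(ε * q))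
  set Y := (q : ℝ) ^ (-((d 1 : ℝ) - (m : ℝ)) / 2 + (q : ℝ))
  set Z := (q : ℝ) ^ (ε * ((∑ j ∈ Finset.Icc 2 (p - 1), (d j : ℝ)) + (q : ℝ)) +
        (1 - ε) * (m : ℝ)) * ∑ i ∈ Finset.Icc 2 (p - 1), (q : ℝ) ^ (-(d i : ℝ))
  have hXZ : 0 ≤ X * Z := by positivity
  have : 2 * X * (Z + Y) = X * Z + X * Z + X * Y + X * Y := by ring
  linarith

theorem inv_pow_le_errorTerm {p q m L Q : ℕ} (hq : 1 ≤ q) (hqQ : q ≤ Q) {d : ℕ → ℕ}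
    {ε : ℝ} (hε : 0 < ε) (hε2 : ε ≤ 1 / 2) {i : ℕ} (hi : i ∈ Finset.Icc 1 (p - 1))
    (hd : d i < L) : ((Q : ℝ) ^ L)⁻¹ ≤ errorTerm p q m d ε := by
  have hq1 : (1 : ℝ) ≤ q := by exact_mod_cast hq
  have hq0 : (0 : ℝ) < q := by linarith
  have hm0 : (0 : ℝ) ≤ m := by positivity
  have hdL : (d i : ℝ) ≤ L := by exact_mod_cast hd.le
  have hd0 : (0 : ℝ) ≤ d i := by positivity
  have h1 : ((Q : ℝ) ^ L)⁻¹ ≤ (q : ℝ) ^ (-(L : ℝ)) := by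
    rw [Real.rpow_neg hq0.le, Real.rpow_natCast]
    exact inv_anti₀ (by positivity) (pow_le_pow_left₀ hq0.le (by exact_mod_cast hqQ) L)
  refine h1.trans ?_
  unfold errorTerm
  by_cases h : i = 1
  · subst h
    refine le_add_of_nonneg_of_le (by positivity) (Real.rpow_le_rpow_of_exponent_le hq1 ?_)
    linarith
  · have hi2 : i ∈ Finset.Icc 2 (p - 1) := by
      rw [Finset.mem_Icc] at hi ⊢
      omega
    refine le_add_of_le_of_nonneg ?_ (by positivity)
    have h2 : (q : ℝ) ^ (-(d i : ℝ)) ≤ ∑ j ∈ Finset.Icc 2 (p - 1), (q : ℝ) ^ (-(d j : ℝ)) :=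
      Finset.single_le_sum (f := fun j => (q : ℝ) ^ (-(d j : ℝ))) (fun _ _ => by positivity) hi2
    have h3 : (q : ℝ) ^ (-(L : ℝ)) ≤ (q : ℝ) ^ (-(d i : ℝ)) :=
      Real.rpow_le_rpow_of_exponent_le hq1 (by linarith)
    refine (h3.trans h2).trans (le_mul_of_one_le_left (by positivity) ?_)
    refine Real.one_le_rpow hq1 ?_
    have : (0 : ℝ) ≤ ∑ j ∈ Finset.Icc 2 (p - 1), (d j : ℝ) := by positivity
    have h5 : 0 ≤ 1 - ε := by linarith
    positivity

/-- The total relative error in terms of the exponential constant `A`. -/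
theorem relative_error_le {p q r m l n : ℕ} (hr : 1 ≤ r) (hlm : l + m = q) (hp : 1 ≤ p)
    {y₀ y s : ℝ} (hy₀ : 1 < y₀) (hy : y₀ ≤ y) (hyq : y ≤ q) (hs : y₀ ≤ s) (hsq : s ^ 2 = q) {W : ℝ}
    (hW : 0 ≤ W) :
    (r : ℝ) ^ m * (l * s ^ l * eulerConst q r s / (s ^ n * s ^ m) + ((p : ℝ) ^ l)⁻¹ *
        (((q : ℝ) ^ m)⁻¹ * (2 * q * eulerConst q r y * ((q / y) ^ m * W)))) /
        (((p : ℝ) ^ l)⁻¹ * ((r : ℝ) / q) ^ m / (1 + (r : ℝ) / q) ^ q) +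
      (1 + r : ℝ) ^ q * (2 * q * eulerConst q r y * W) ≤
    ((1 + r) * p * 8 * ((1 - y₀⁻¹)⁻¹ * Real.exp (y₀ / (y₀ - 1) ^ 2) ^ r)) ^ q *
      (s ^ q / s ^ n + (q / y) ^ m * W) := by
  have hq1 : (1 : ℝ) ≤ q := by linarith
  have hq : q ≠ 0 := by rintro rfl; norm_num at hq1
  have hq0 : (0 : ℝ) < q := by linarith
  have hr0 : (1 : ℝ) ≤ r := by exact_mod_cast hr
  have hp0 : (1 : ℝ) ≤ p := by exact_mod_cast hp
  have hs1 : 1 < s := by linarith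
  have hy1 : 1 < y := by linarith
  have hE1 := one_le_eulerConst (q := q) (r := r) hy1
  have hE2 := one_le_eulerConst (q := q) (r := r) hs1
  have hE3 := eulerConst_le (r := r) hq hy₀ hy
  have hE4 := eulerConst_le (r := r) hq hy₀ hs
  have h2q : (q : ℝ) ≤ 2 ^ q := by exact_mod_cast (Nat.lt_two_pow_self (n := q)).le
  have hl : (l : ℝ) ≤ q := by exact_mod_cast (by omega : l ≤ q)
  generalize (1 - y₀⁻¹)⁻¹ * Real.exp (y₀ / (y₀ - 1) ^ 2) ^ r = E at *
  have hEq0 : 0 < E ^ q := by linarith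
  -- Dividing by the main term cancels r^m; the powers of s = √q combine through q^m = s^m s^m and
  -- s^l s^m = s^q.
  have hfirst : (r : ℝ) ^ m * (l * s ^ l * eulerConst q r s / (s ^ n * s ^ m) + ((p : ℝ) ^ l)⁻¹ *
        (((q : ℝ) ^ m)⁻¹ * (2 * q * eulerConst q r y * ((q / y) ^ m * W)))) /
        (((p : ℝ) ^ l)⁻¹ * ((r : ℝ) / q) ^ m / (1 + (r : ℝ) / q) ^ q) =
      (1 + (r : ℝ) / q) ^ q * (p ^ l * l * eulerConst q r s * (s ^ q / s ^ n) +
        2 * q * eulerConst q r y * ((q / y) ^ m * W)) := by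
    have hsq' : (q : ℝ) ^ m = s ^ m * s ^ m := by rw [← hsq, ← pow_mul, two_mul, pow_add]
    have hsp : s ^ q = s ^ l * s ^ m := by rw [← hlm, pow_add]
    have hpos : (0 : ℝ) < (1 + (r : ℝ) / q) ^ q := by positivity
    generalize (1 + (r : ℝ) / q) ^ q = Z at *
    have hs0 : 0 < s := by linarith
    have hy0 : 0 < y := by linarith
    rw [div_pow (r : ℝ), hsp]
    generalize ((q : ℝ) / y) ^ m = V at *
    rw [hsq']
    field_simp
  rw [hfirst]
  have hZ : (1 + (r : ℝ) / q) ^ q ≤ (1 + r : ℝ) ^ q := by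
    refine pow_le_pow_left₀ (by positivity) ?_ q
    have := div_le_self (show (0 : ℝ) ≤ r by linarith) hq1
    linarith
  have hV1 : 1 ≤ ((q : ℝ) / y) ^ m := by
    refine one_le_pow₀ ?_
    rwa [one_le_div (by linarith)]
  have hVW : W ≤ ((q : ℝ) / y) ^ m * W := le_mul_of_one_le_left hW hV1
  have h4 : (4 : ℝ) ≤ 4 ^ q := le_self_pow₀ (by norm_num) hq
  have e1 : (p : ℝ) ^ l * l * eulerConst q r s ≤ p ^ q * 8 ^ q * E ^ q := by
    have a1 : (p : ℝ) ^ l ≤ p ^ q := pow_le_pow_right₀ hp0 (by omega)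
    have a2 : (l : ℝ) ≤ 8 ^ q :=
      (hl.trans h2q).trans (pow_le_pow_left₀ (by norm_num) (by norm_num) q)
    gcongr
  -- The base 8 comes from 4 ≤ 4^q and q ≤ 2^q.
  have e2 : 2 * (2 * q * eulerConst q r y) ≤ p ^ q * 8 ^ q * E ^ q := by
    have a1 : (1 : ℝ) ≤ p ^ q := one_le_pow₀ hp0
    have a2 : 4 * (q : ℝ) ≤ 8 ^ q := by
      calc 4 * (q : ℝ) ≤ 4 ^ q * 2 ^ q := by gcongr
        _ = 8 ^ q := by rw [← mul_pow]; norm_num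
    calc 2 * (2 * q * eulerConst q r y) = 4 * q * eulerConst q r y := by ring
      _ ≤ 8 ^ q * E ^ q := by gcongr
      _ = 1 * 8 ^ q * E ^ q := by ring
      _ ≤ _ := by gcongr
  have hsn : 0 ≤ s ^ q / s ^ n := by
    have : 0 < s := by linarith
    positivity
  calc _ ≤ (1 + r : ℝ) ^ q * (p ^ l * l * eulerConst q r s * (s ^ q / s ^ n) +
        2 * q * eulerConst q r y * ((q / y) ^ m * W)) +
        (1 + r : ℝ) ^ q * (2 * q * eulerConst q r y * ((q / y) ^ m * W)) := by
        gcongr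
    _ = (1 + r : ℝ) ^ q * (p ^ l * l * eulerConst q r s * (s ^ q / s ^ n) +
        2 * (2 * q * eulerConst q r y) * ((q / y) ^ m * W)) := by ring
    _ ≤ (1 + r : ℝ) ^ q * (p ^ q * 8 ^ q * E ^ q * (s ^ q / s ^ n) +
        p ^ q * 8 ^ q * E ^ q * ((q / y) ^ m * W)) := by
        gcongr
    _ = _ := by
        have : ((1 + (r : ℝ)) * p * 8 * E) ^ q = (1 + r : ℝ) ^ q * p ^ q * 8 ^ q * E ^ q := by
          rw [mul_pow, mul_pow, mul_pow]
        rw [this]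
        ring

end Numerics

/-! ### Quotient of the two densities -/

section Ratio

variable {K : Type*} [Field K] [Fintype K] {ι : Type*} [Fintype ι]

/-- The quotient of the conditional count by the total count, with explicit relative error. -/
theorem exists_ratio_error {p : ℕ} (hp : p.Prime) {χ : MulChar K ℂ}
    (hχ : orderOf χ = p) {k : ι → ℕ} (hk : ∀ i, k i ≠ 0) {j : ι} (hkj : k j = 1) {S : Finset K}
    {η : K → ℂ} (hη : ∀ a ∈ S, η a ^ p = 1) (hη0 : ∀ a, a ∉ S → η a = 0) {y₀ y : ℝ} (hy₀ : 1 < y₀)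
    (hy : y₀ ≤ y) (hyq : 2 * y ≤ Fintype.card K) (hs : y₀ ≤ √(Fintype.card K : ℝ)) (d : ι → ℕ)
    {c : ℝ} (hc : 0 < c) (hcd : c * (Fintype.card K : ℝ) ^ (∑ i, d i) ≤
      (coprimeTuples (∅ : Finset K[X]) d).card) :
    ∃ δ : ℝ, |δ| ≤ ((1 + Fintype.card ι) * p * 8 *
        ((1 - y₀⁻¹)⁻¹ * Real.exp (y₀ / (y₀ - 1) ^ 2) ^ Fintype.card ι)) ^ Fintype.card K *
      (√(Fintype.card K : ℝ) ^ Fintype.card K / √(Fintype.card K : ℝ) ^ d j +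
        (Fintype.card K / y) ^ Sᶜ.card * ∑ i, (y / Fintype.card K) ^ d i) / c ∧
      (((coprimeTuples (∅ : Finset K[X]) d).filter (HasAllCharValues χ k η)).card : ℝ) /
        (coprimeTuples (∅ : Finset K[X]) d).card =
      ((p : ℝ) ^ S.card)⁻¹ * ((Fintype.card ι : ℝ) / Fintype.card K) ^ Sᶜ.card /
        (1 + (Fintype.card ι : ℝ) / Fintype.card K) ^ Fintype.card K * (1 + δ) := by
  have hq2 := two_le_card_field (K := K)
  have hy1 : 1 < y := by linarith
  have hy0 : 0 < y := by linarith
  have hp0 : (0 : ℝ) < p := by exact_mod_cast hp.pos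
  have hι : 1 ≤ Fintype.card ι := Fintype.card_pos_iff.2 ⟨j⟩
  have hι0 : (0 : ℝ) < Fintype.card ι := by exact_mod_cast hι
  have hX : (0 : ℝ) < (Fintype.card K : ℝ) ^ (∑ i, d i) := by positivity
  have hcR : c ≤ ((coprimeTuples (∅ : Finset K[X]) d).card : ℝ) /
      (Fintype.card K : ℝ) ^ (∑ i, d i) := (le_div_iff₀ hX).2 hcd
  have hb0 : (0 : ℝ) < (1 + (Fintype.card ι : ℝ) / Fintype.card K) ^ Fintype.card K := by
    positivity
  obtain ⟨δ, hδ, heq⟩ := exists_relative_error (hc.trans_le hcR)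
    (M := ((p : ℝ) ^ S.card)⁻¹ * ((Fintype.card ι : ℝ) / Fintype.card K) ^ Sᶜ.card /
        (1 + (Fintype.card ι : ℝ) / Fintype.card K) ^ Fintype.card K) (by positivity) hc hcR
    (abs_conditional_density_sub_le hp hχ hk hkj hη hη0 hy1 hyq d)
    (abs_density_sub_le hy1 hyq d) (by rw [div_mul_cancel₀ _ hb0.ne'])
  refine ⟨δ, hδ.trans (div_le_div_of_nonneg_right ?_ hc.le), ?_⟩
  · exact relative_error_le hι (Finset.card_add_card_compl S) hp.one_le hy₀ hy (by linarith) hs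
      (Real.sq_sqrt (by linarith)) (Finset.sum_nonneg fun i _ => by positivity)
  · rw [← heq, div_div_div_cancel_right₀ hX.ne']

end Ratio

/-! ### The main term and the conclusion -/

theorem main_term_eq {p q m l : ℕ} (hp : 2 ≤ p) (hq : 1 ≤ q) (hlm : l + m = q) :
    ((p : ℝ) ^ l)⁻¹ * (((p - 1 : ℕ) : ℝ) / q) ^ m / (1 + ((p - 1 : ℕ) : ℝ) / q) ^ q =
      (((p : ℝ) - 1) / ((q : ℝ) + (p : ℝ) - 1)) ^ m *
        ((q : ℝ) / ((p : ℝ) * ((q : ℝ) + (p : ℝ) - 1))) ^ (q - m) := by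
  have hp2 : (2 : ℝ) ≤ p := by exact_mod_cast hp
  have hq1 : (1 : ℝ) ≤ q := by exact_mod_cast hq
  have hw : (0 : ℝ) < q + p - 1 := by linarith
  rw [Nat.cast_sub (by omega), Nat.cast_one, show q - m = l by omega]
  have h1 : 1 + ((p : ℝ) - 1) / q = (q + p - 1) / q := by field_simp; ring
  rw [h1]
  generalize (q : ℝ) + p - 1 = w at *
  have h2 : (w / q) ^ q = (w / q) ^ l * (w / q) ^ m := by rw [← pow_add, hlm]
  rw [h2, div_pow, div_pow, div_pow, div_pow, div_pow, mul_pow]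
  field_simp

/-- Needed where no lower bound for the size of the family is available: over bounded q the main
term stays away from 0. -/
theorem main_term_lower {p q m l Q : ℕ} (hp : 2 ≤ p) (hq : 1 ≤ q) (hlm : l + m = q) (hqQ : q ≤ Q) :
    (((p : ℝ) * Q * p) ^ Q)⁻¹ ≤
      ((p : ℝ) ^ l)⁻¹ * (((p - 1 : ℕ) : ℝ) / q) ^ m / (1 + ((p - 1 : ℕ) : ℝ) / q) ^ q := by
  have hp1 : (1 : ℝ) ≤ p := by exact_mod_cast (by omega : 1 ≤ p)
  have hr1 : (1 : ℝ) ≤ (p - 1 : ℕ) := by exact_mod_cast (by omega : 1 ≤ p - 1)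
  have hq1 : (1 : ℝ) ≤ q := by exact_mod_cast hq
  have hqQ' : (q : ℝ) ≤ Q := by exact_mod_cast hqQ
  have hrp : 1 + ((p - 1 : ℕ) : ℝ) / q ≤ p := by
    have := div_le_self (show (0 : ℝ) ≤ (p - 1 : ℕ) by linarith) hq1
    rw [Nat.cast_sub (by omega)] at this ⊢
    push_cast at this ⊢
    linarith
  have h1 : ((p : ℝ) ^ q)⁻¹ ≤ ((p : ℝ) ^ l)⁻¹ :=
    inv_anti₀ (by positivity) (pow_le_pow_right₀ hp1 (by omega))
  have h2 : ((q : ℝ) ^ q)⁻¹ ≤ (((p - 1 : ℕ) : ℝ) / q) ^ m := by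
    calc ((q : ℝ) ^ q)⁻¹ ≤ ((q : ℝ) ^ m)⁻¹ :=
          inv_anti₀ (by positivity) (pow_le_pow_right₀ hq1 (by omega))
      _ = (1 / q) ^ m := by rw [one_div, inv_pow]
      _ ≤ _ := by gcongr
  have h3 : ((p : ℝ) ^ q)⁻¹ ≤ ((1 + ((p - 1 : ℕ) : ℝ) / q) ^ q)⁻¹ :=
    inv_anti₀ (by positivity) (pow_le_pow_left₀ (by positivity) hrp q)
  rw [div_eq_mul_inv]
  calc (((p : ℝ) * Q * p) ^ Q)⁻¹ ≤ (((p : ℝ) * q * p) ^ q)⁻¹ := by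
        refine inv_anti₀ (by positivity) ?_
        refine (pow_le_pow_left₀ (by positivity) ?_ q).trans (pow_le_pow_right₀ ?_ hqQ)
        · gcongr
        · have : (1 : ℝ) ≤ p * Q := one_le_mul_of_one_le_of_one_le hp1 (by linarith)
          exact one_le_mul_of_one_le_of_one_le this hp1
    _ = ((p : ℝ) ^ q)⁻¹ * ((q : ℝ) ^ q)⁻¹ * ((p : ℝ) ^ q)⁻¹ := by
        rw [mul_pow, mul_pow, mul_inv, mul_inv]
    _ ≤ _ := by gcongr

/-- A number of `[0, 1]` is a bounded multiple of any number bounded away from `0`. -/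
theorem exists_relative_error_of_le_one {ρ M T : ℝ} (hρ : 0 ≤ ρ) (hρ1 : ρ ≤ 1) (hT : 0 < T)
    (hM : T⁻¹ ≤ M) : ∃ δ : ℝ, |δ| ≤ 1 + T ∧ ρ = M * (1 + δ) := by
  have hM0 : 0 < M := (inv_pos.2 hT).trans_le hM
  refine ⟨ρ / M - 1, ?_, by field_simp; ring⟩
  have h2 : ρ / M ≤ T := by
    rw [div_le_iff₀ hM0]
    have := mul_le_mul_of_nonneg_left hM hT.le
    rw [mul_inv_cancel₀ hT.ne'] at this
    linarith
  have h3 : 0 ≤ ρ / M := by positivity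
  rw [abs_le]
  constructor <;> linarith

set_option maxHeartbeats 800000 in
theorem theorem7p2 (p : ℕ) (hp : p.Prime) (hp2 : p ≠ 2) (ε : ℝ) (hε : 0 < ε) :
    ∃ C : ℝ, ∀ (K : Type*) [Field K] [Fintype K] (q : ℕ), Fintype.card K = q → q ≡ 1 [MOD p] →
      ∀ χ : MulChar K ℂ, orderOf χ = p →
      ∀ x : Fin q ≃ K, ∀ e : Fin q → ℂ, (∀ i, e i = 0 ∨ e i ^ p = 1) →
      ∀ m : ℕ, {i | e i = 0}.ncard = m →
      ∀ d : ℕ → ℕ, ∃ δ : ℝ, |δ| ≤ C * errorTerm p q m d ε ∧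
        ({F ∈ polyFamily K (p - 1) d | ∀ i, χ (F.eval (x i)) = e i}.ncard : ℝ) /
            ((polyFamily K (p - 1) d).ncard : ℝ) =
          (((p : ℝ) - 1) / ((q : ℝ) + (p : ℝ) - 1)) ^ m *
            ((q : ℝ) / ((p : ℝ) * ((q : ℝ) + (p : ℝ) - 1))) ^ (q - m) * (1 + δ) := by
  have hp3 : 3 ≤ p := by have := hp.two_le; omega
  -- A smaller exponent gives a smaller error term, so ε may be capped at 1/2; then y = q^ε' ≤ √q.
  obtain ⟨ε', hε', hε'2, hεε⟩ : ∃ ε' : ℝ, 0 < ε' ∧ ε' ≤ 1 / 2 ∧ ε' ≤ ε :=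
    ⟨min ε (1 / 2), lt_min hε (by norm_num), min_le_right _ _, min_le_left _ _⟩
  set ι := Finset.Icc 1 (p - 1)
  set r := Fintype.card ι with hr
  have hrp : r = p - 1 := by simp [hr, ι]
  -- From this size on the plain union bound gives density at least 1/2.
  set Q := 4 * r ^ 2 with hQ
  obtain ⟨c₁, L, hc₁, hlow⟩ := exists_density_lower_bound ι Q
  -- A lower bound for both q^ε' and √q that does not depend on q, so A depends on p and ε only.
  set y₀ : ℝ := 2 ^ ε' with hy₀def
  have hy₀ : 1 < y₀ := Real.one_lt_rpow (by norm_num) hε'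
  set A : ℝ := (1 + r) * p * 8 * ((1 - y₀⁻¹)⁻¹ * Real.exp (y₀ / (y₀ - 1) ^ 2) ^ r) with hA
  have hA1 : 1 ≤ A := by
    have h1 : (1 : ℝ) ≤ p := by exact_mod_cast hp.one_le
    have h2 : 1 ≤ (1 - y₀⁻¹)⁻¹ := by simpa using one_le_euler_term hy₀ Nat.one_pos
    have h3 : 1 ≤ Real.exp (y₀ / (y₀ - 1) ^ 2) ^ r := one_le_pow₀ (Real.one_le_exp (by
      have := sub_pos.2 hy₀; positivity))
    have h4 : (1 : ℝ) ≤ 1 + r := by simp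
    refine one_le_mul_of_one_le_of_one_le (one_le_mul_of_one_le_of_one_le
      (one_le_mul_of_one_le_of_one_le h4 h1) (by norm_num)) (one_le_mul_of_one_le_of_one_le h2 h3)
  set C₁ := A ^ (A ^ (1 / ε')) with hC₁
  have hC₁0 : 0 ≤ C₁ := by positivity
  set C₂ : ℝ := (1 + ((p : ℝ) * Q * p) ^ Q) * (Q : ℝ) ^ L with hC₂
  have hC₂0 : 0 ≤ C₂ := by positivity
  -- One summand per case: large q with density 1/2, bounded q with large degrees and density c₁,
  -- and bounded q with a small degree.
  refine ⟨2 * C₁ / (1 / 2) + 2 * C₁ / c₁ + C₂, ?_⟩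
  intro K _ _ q hq hmod χ hχ x e he m hm d
  subst hq
  have hq2 : 2 ≤ Fintype.card K := Fintype.one_lt_card
  -- As p divides q - 1 > 0, q ≥ p + 1 ≥ 4. This gives 2 q^ε' ≤ 2√q ≤ q, as the stability estimate
  -- requires.
  have hq4 : 4 ≤ Fintype.card K := by
    have h1 : p ∣ Fintype.card K - 1 := (Nat.modEq_iff_dvd' (by omega)).1 hmod.symm
    have := Nat.le_of_dvd (by omega) h1
    omega
  let η : K → ℂ := fun a => e (x.symm a)
  let S : Finset K := Finset.univ.filter fun a => η a ≠ 0
  have hSm : Sᶜ.card = m := by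
    rw [← hm, ← Set.ncard_coe_finset, ← Set.ncard_image_of_injective _ x.injective]
    congr 1
    ext a
    simp only [S, η, Finset.coe_compl, Set.mem_compl_iff, Finset.mem_coe, Finset.mem_filter,
      Finset.mem_univ, true_and, not_not, Set.mem_image, Set.mem_ofPred_eq]
    constructor
    · intro h
      exact ⟨x.symm a, h, x.apply_symm_apply a⟩
    · rintro ⟨i, hi, rfl⟩
      rwa [x.symm_apply_apply]
  have hSq : S.card + m = Fintype.card K := by rw [← hSm]; exact Finset.card_add_card_compl S
  have hmq : m ≤ Fintype.card K := by omega
  have hη : ∀ a ∈ S, η a ^ p = 1 := fun a ha =>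
    (he (x.symm a)).resolve_left (Finset.mem_filter.1 ha).2
  have hη0 : ∀ a, a ∉ S → η a = 0 := by
    intro a ha
    by_contra h
    exact ha (Finset.mem_filter.2 ⟨Finset.mem_univ _, h⟩)
  set d' : ι → ℕ := fun i => d i with hd'
  have hden : (polyFamily K (p - 1) d).ncard = (coprimeTuples (∅ : Finset K[X]) d').card := by
    have := ncard_polyFamily_filter (K := K) (p - 1) d fun _ => True
    simpa using this
  have hnum : {F ∈ polyFamily K (p - 1) d | ∀ i, χ (F.eval (x i)) = e i}.ncard =
      ((coprimeTuples (∅ : Finset K[X]) d').filter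
        (HasAllCharValues χ (fun i : ι => (i : ℕ)) η)).card := by
    have hset : {F ∈ polyFamily K (p - 1) d | ∀ i, χ (F.eval (x i)) = e i} =
        {F ∈ polyFamily K (p - 1) d | ∀ a, χ (F.eval a) = η a} := by
      ext F
      refine and_congr_right fun _ => ⟨fun h a => ?_, fun h i => ?_⟩
      · simpa using h (x.symm a)
      · simpa [η] using h (x i)
    rw [hset, ncard_polyFamily_filter]
    congr 1
  rw [hden, hnum, ← main_term_eq (l := S.card) hp.two_le (by omega) hSq]
  have hET := errorTerm_nonneg p (Fintype.card K) m d ε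
  have hET' := errorTerm_nonneg p (Fintype.card K) m d ε'
  have hmono := errorTerm_mono (p := p) (by omega : 1 ≤ Fintype.card K) hmq d hεε
  have hq1 : (1 : ℝ) ≤ Fintype.card K := by exact_mod_cast (by omega : 1 ≤ Fintype.card K)
  have hq4' : (4 : ℝ) ≤ Fintype.card K := by exact_mod_cast hq4
  have hq0 : (0 : ℝ) < Fintype.card K := by linarith
  have hgood : ∀ c : ℝ, 0 < c → c * (Fintype.card K : ℝ) ^ (∑ i, d' i) ≤
      (coprimeTuples (∅ : Finset K[X]) d').card →
      ∃ δ : ℝ, |δ| ≤ 2 * C₁ / c * errorTerm p (Fintype.card K) m d ε ∧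
      (((coprimeTuples (∅ : Finset K[X]) d').filter
        (HasAllCharValues χ (fun i : ι => (i : ℕ)) η)).card : ℝ) /
        (coprimeTuples (∅ : Finset K[X]) d').card =
      ((p : ℝ) ^ S.card)⁻¹ * (((p - 1 : ℕ) : ℝ) / Fintype.card K) ^ m /
        (1 + ((p - 1 : ℕ) : ℝ) / Fintype.card K) ^ Fintype.card K * (1 + δ) := by
    intro c hc hcd
    have hyy : y₀ ≤ (Fintype.card K : ℝ) ^ ε' :=
      Real.rpow_le_rpow (by norm_num) (by linarith) hε'.le
    have hys : (Fintype.card K : ℝ) ^ ε' ≤ √(Fintype.card K : ℝ) := by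
      rw [Real.sqrt_eq_rpow]
      exact Real.rpow_le_rpow_of_exponent_le hq1 hε'2
    have hs2 : 2 ≤ √(Fintype.card K : ℝ) := Real.le_sqrt_of_sq_le (by linarith)
    have hss : √(Fintype.card K : ℝ) * √(Fintype.card K : ℝ) = Fintype.card K :=
      Real.mul_self_sqrt hq0.le
    have h1ι : 1 ∈ Finset.Icc 1 (p - 1) := by rw [Finset.mem_Icc]; omega
    obtain ⟨δ, hδ, heq⟩ := exists_ratio_error hp hχ (k := fun i : ι => (i : ℕ))
      (fun i => by have := (Finset.mem_Icc.1 i.2).1; omega) (j := ⟨1, h1ι⟩) rfl hη hη0 hy₀ hyy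
      (by nlinarith) (hyy.trans hys) d' hc hcd
    refine ⟨δ, hδ.trans ?_, ?_⟩
    · have hsum : ∑ i : ι, ((Fintype.card K : ℝ) ^ ε' / Fintype.card K) ^ d' i =
          ∑ i ∈ Finset.Icc 1 (p - 1), ((Fintype.card K : ℝ) ^ ε' / Fintype.card K) ^ d i :=
        Finset.sum_coe_sort (Finset.Icc 1 (p - 1)) fun i =>
          ((Fintype.card K : ℝ) ^ ε' / Fintype.card K) ^ d i
      rw [hSm, hsum]
      have h1 := le_two_mul_errorTerm hp3 hq2 hmq d hε' hε'2
      -- The loss A^q ≤ C₁ q^(ε'q) meets the spare factor q^(-ε'q) of `h1`.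
      have h2 := pow_le_const_mul_rpow hA1 hε' (by omega : 1 ≤ Fintype.card K)
      have h3 : (Fintype.card K : ℝ) ^ (ε' * Fintype.card K) *
          (Fintype.card K : ℝ) ^ (-(ε' * Fintype.card K)) = 1 := by
        rw [← Real.rpow_add hq0, add_neg_cancel, Real.rpow_zero]
      rw [div_mul_eq_mul_div]
      refine div_le_div_of_nonneg_right ?_ hc.le
      calc _ ≤ (C₁ * (Fintype.card K : ℝ) ^ (ε' * Fintype.card K)) *
            (2 * (Fintype.card K : ℝ) ^ (-(ε' * Fintype.card K)) *
              errorTerm p (Fintype.card K) m d ε') :=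
            mul_le_mul h2 h1 (add_nonneg (by positivity) (mul_nonneg (by positivity)
              (Finset.sum_nonneg fun i _ => by positivity))) (by positivity)
        _ = 2 * C₁ * errorTerm p (Fintype.card K) m d ε' *
            ((Fintype.card K : ℝ) ^ (ε' * Fintype.card K) *
              (Fintype.card K : ℝ) ^ (-(ε' * Fintype.card K))) := by ring
        _ = 2 * C₁ * errorTerm p (Fintype.card K) m d ε' := by rw [h3, mul_one]
        _ ≤ _ := by gcongr
    · rw [heq, hSm, ← hr, hrp]
  have hweak : ∀ {z : ℝ}, 0 ≤ 2 * C₁ / (1 / 2) + 2 * C₁ / c₁ + C₂ - z →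
      z * errorTerm p (Fintype.card K) m d ε ≤
        (2 * C₁ / (1 / 2) + 2 * C₁ / c₁ + C₂) * errorTerm p (Fintype.card K) m d ε :=
    fun hz => mul_le_mul_of_nonneg_right (by linarith) hET
  have hpos1 : 0 ≤ 2 * C₁ / (1 / 2) := by positivity
  have hpos2 : 0 ≤ 2 * C₁ / c₁ := by positivity
  by_cases hbig : Q ≤ Fintype.card K
  · obtain ⟨δ, hδ, heq⟩ := hgood (1 / 2) (by norm_num) (half_le_card_coprimeTuples hbig d')
    exact ⟨δ, hδ.trans (hweak (by linarith)), heq⟩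
  push Not at hbig
  by_cases hlarge : ∀ i : ι, L ≤ d' i
  · obtain ⟨δ, hδ, heq⟩ := hgood c₁ hc₁ (hlow K hbig.le d' hlarge)
    exact ⟨δ, hδ.trans (hweak (by linarith)), heq⟩
  -- In the remaining case q < Q and some degree is below L, so the error term is at least Q^(-L).
  -- It suffices that the quotient lies in [0, 1], which also covers the convention 0/0 = 0.
  push Not at hlarge
  obtain ⟨i, hi⟩ := hlarge
  have hE2 := inv_pow_le_errorTerm (m := m) (by omega : 1 ≤ Fintype.card K) hbig.le hε' hε'2 i.2 hi
  have hM := main_term_lower (l := S.card) hp.two_le (by omega) hSq hbig.le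
  have hQ0 : (0 : ℝ) < Q := by exact_mod_cast (by omega : 0 < Q)
  have hp0 : (0 : ℝ) < p := by exact_mod_cast hp.pos
  have hT0 : (0 : ℝ) < ((p : ℝ) * Q * p) ^ Q := by positivity
  obtain ⟨δ, hδ, heq⟩ := exists_relative_error_of_le_one (by positivity) (div_le_one_of_le₀
    (Nat.cast_le.2 (Finset.card_filter_le (coprimeTuples (∅ : Finset K[X]) d')
      (HasAllCharValues χ (fun i : ι => (i : ℕ)) η))) (Nat.cast_nonneg _)) hT0 hM
  refine ⟨δ, ?_, heq⟩
  refine hδ.trans (le_trans ?_ (hweak (z := C₂) (by linarith)))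
  have h4 : 1 ≤ (Q : ℝ) ^ L * errorTerm p (Fintype.card K) m d ε := by
    have := mul_le_mul_of_nonneg_left (hE2.trans hmono) (show (0 : ℝ) ≤ (Q : ℝ) ^ L by positivity)
    rwa [mul_inv_cancel₀ (by positivity)] at this
  calc (1 : ℝ) + ((p : ℝ) * Q * p) ^ Q
      ≤ (1 + ((p : ℝ) * Q * p) ^ Q) * ((Q : ℝ) ^ L * errorTerm p (Fintype.card K) m d ε) :=
        le_mul_of_one_le_right (by positivity) h4
    _ = C₂ * errorTerm p (Fintype.card K) m d ε := (mul_assoc _ _ _).symm
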